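/- Let $B$ be a braid word with $s$ strands and $\ell\ge 1$ crossings, $B=\prod_{j=1}^{\ell}\sigma_{i_j}^{\epsilon_j}$, let $\mathcal C$ be the set of components of its closure (the cycles of the permutation of the $s$ strand positions induced by $B$), and let $s_C$ be the number of strands of $C\in\mathcal C$, so $\sum_C s_C=s$. A family of functions $F_C:\mathbb R\to\mathbb R$, $C\in\mathcal C$, defines the $s$ strands $t\mapsto F_C\big(\tfrac{t+2\pi j}{s_C}\big)$, $t\in[0,2\pi]$. Consider the following algorithm. 1. Choose heights $0=\tau_1<\dots<\tau_{\ell+1}=2\pi$ and abscissae $x_1<\dots<x_s$. For each $C$ let $F_C$ be a real trigonometric polynomial of degree at most $\lfloor s_C\ell/2\rfloor$ that interpolates the $s_C\ell$ data points saying that, at height $\tau_k$ ($1\le k\le\ell$), the strand $(C,j)$ is at $x_p$, where $p$ is the position of that strand in the diagram of $B$ just before its $k$-th crossing. 2. Replace each $F_C(\theta)$ by $\tilde F_C(\theta)=F_C(\theta+a_C)+b_C+c_C\cos(\theta-\varphi_C)$, with $c_C=0$ if $s_C=1$, such that the strands of the $\tilde F_C$ are generic (every intersection of strands is transverse, at each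 height at most one pair of strands intersects, and there is no intersection at height $\pi$), are pairwise disjoint at every $\tau_j$, and their permutation on $[\tau_j,\tau_{j+1}]$ is the transposition $(i_j\leftrightarrow i_j+1)$ for every $j$. 3. Put $g(u,e^{it})=\prod_{C}\prod_{j=1}^{s_C}\big(u-\tilde F_C\big(\tfrac{2t+2\pi j}{s_C}\big)\big)$. 4. Put $p_k(u,re^{it})=r^{2ks}g(u/r^{2k},e^{it})$, where $k$ is the least integer such that $2ks$ is greater than the degree of $g$ in $e^{\pm it}$ and $p_k$ is a polynomial in $u,v,\bar v$, where $v=re^{it}$. 5. Let $t_1<\dots<t_{\ell'}$ be the heights in $[0,2\pi]$ at which strands of the $\tilde F_C$ intersect, the $k$-th intersection being between the $j_k$-th and the $(j_k+1)$-st smallest strand. Choose signs $\varepsilon_k\in\{\pm1\}$ such that $\prod_k\sigma_{j_k}^{\varepsilon_k}$ equals $B$ in the braid group, and non-zero real numbers $q_k=y_k/\cos(t_k/2)$ with the sign of $g$ at the critical point of $g(\cdot,e^{it/2})$ that lies between the two colliding roots, for $t\ne t_k$ near $t_k$. Let $\tilde A$ be a complex trigonometric polynomial of degree at most $\ell'$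 with $\tilde A(e^{it_k})=q_k$ and $\tfrac{\partial\arg\tilde A}{\partial t}(e^{it_k})=\varepsilon_k$ for all $k$. Put $A(e^{it})=\tilde A(e^{2it})\cos t$. 6. Put $f(u,re^{it})=p_k(u,re^{it})+r^mA(e^{it})$, where $m$ is the least odd integer that is larger than the degree of $A$ in $e^{\pm it}$ and larger than $2ks$. Then all steps can be carried out for every such $B$, and, whatever choices are made in Steps 1, 2 and 5, the result $f$ is a polynomial in $u$, $v$ and $\bar v$ with $$\deg(f)\le s\ell(2+s)+1+\sum_{C\in\mathcal C}s_C^2\,\ell .$$ -/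

import Mathlib

open Filter Topology

namespace BraidPoly

/-! ### Braid words, the braid group and the components of a closed braid -/

/-- A word in the Artin generators of the braid group on `n + 1` strands: the letter `(i, ε)` stands
for `σ_i ^ ε`, where `σ_i` is a positive crossing of the strands whose real parts are the `i`-th and
the `(i+1)`-st smallest (counted from `0`). Letters are read from left to right as the height `t`
increases. -/
abbrev BraidWord (n : ℕ) : Type := List (Fin n × ℤˣ)

/-- The Artin relations between the generators of the braid group on `n + 1` strands. -/
def braidRels (n : ℕ) : Set (FreeGroup (Fin n)) :=
  {r | ∃ i j : Fin n, (i : ℕ) + 1 < (j : ℕ) ∧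
      r = FreeGroup.of i * FreeGroup.of j * (FreeGroup.of j * FreeGroup.of i)⁻¹} ∪
  {r | ∃ i j : Fin n, (i : ℕ) + 1 = (j : ℕ) ∧
      r = FreeGroup.of i * FreeGroup.of j * FreeGroup.of i *
        (FreeGroup.of j * FreeGroup.of i * FreeGroup.of j)⁻¹}

/-- The Artin braid group on `n + 1` strands, i.e. the group of braid isotopy classes of braids. -/
abbrev BraidGroup (n : ℕ) : Type := PresentedGroup (braidRels n)

/-- The element of the braid group that is represented by a braid word. Two words represent
isotopic braids if and only if they have the same image. -/
def BraidWord.toGroup {n : ℕ} (B : BraidWord n) : BraidGroup n :=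
  (B.map fun a => (PresentedGroup.of a.1 : BraidGroup n) ^ (a.2 : ℤ)).prod

/-- The permutation of the `n + 1` positions that is induced by a braid word: the strand that starts
in position `p` ends in position `B.perm p`. -/
def BraidWord.perm {n : ℕ} (B : BraidWord n) : Equiv.Perm (Fin (n + 1)) :=
  B.foldl (fun π a => Equiv.swap a.1.castSucc a.1.succ * π) 1

/-- The components of the closure of the braid: the cycles (fixed points included) of its
permutation. -/
abbrev Component {n : ℕ} (B : BraidWord n) : Type :=
  Quotient (Equiv.Perm.SameCycle.setoid B.perm)

noncomputable instance {n : ℕ} (B : BraidWord n) : Fintype (Component B) := Fintype.ofFinite _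

/-- The number `s_C` of strands of the component `C`. -/
noncomputable def strandCount {n : ℕ} {B : BraidWord n} (C : Component B) : ℕ :=
  Nat.card {p : Fin (n + 1) // (Quotient.mk _ p : Component B) = C}

/-- The strands of the braid, indexed by a component `C` and a number `j` modulo `s_C`. -/
abbrev Strand {n : ℕ} (B : BraidWord n) : Type := Σ C : Component B, Fin (strandCount C)

/-! ### Trigonometric polynomials -/

/-- `F : ℝ → ℝ` is a real trigonometric polynomial of degree at most `d`. -/
def RealTrigDegLE (d : ℕ) (F : ℝ → ℝ) : Prop :=
  ∃ a b : ℕ → ℝ, ∀ t : ℝ,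
    F t = ∑ k ∈ Finset.range (d + 1), (a k * Real.cos (k * t) + b k * Real.sin (k * t))

/-- `h : ℝ → ℂ` is a complex trigonometric polynomial, i.e. a Laurent polynomial in `exp (i t)`,
of degree at most `d` with respect to `exp (i t)` and `exp (-i t)`. -/
def TrigDegLE (d : ℕ) (h : ℝ → ℂ) : Prop :=
  ∃ c : ℤ → ℂ, ∀ t : ℝ,
    h t = ∑ k ∈ Finset.Icc (-(d : ℤ)) d, c k * Complex.exp (k * t * Complex.I)

/-! ### Curves parametrized by one function for every component -/

/-- The strand `(C, j)` of the family `F`: `t ↦ F_C ((t + 2πj) / s_C)`. -/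
noncomputable def strand {n : ℕ} {B : BraidWord n} (F : Component B → ℝ → ℝ) (a : Strand B)
    (t : ℝ) : ℝ :=
  F a.1 ((t + 2 * Real.pi * (a.2 : ℕ)) / strandCount a.1)

/-- The number of strands that lie strictly below the strand `a` at height `t`. -/
noncomputable def rank {n : ℕ} {B : BraidWord n} (F : Component B → ℝ → ℝ) (a : Strand B)
    (t : ℝ) : ℕ :=
  Nat.card {c : Strand B // strand F c t < strand F a t}

/-- The heights in `[0, 2π]` at which two different strands intersect. -/
def crossingTimes {n : ℕ} {B : BraidWord n} (F : Component B → ℝ → ℝ) : Set ℝ :=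
  {t | t ∈ Set.Icc 0 (2 * Real.pi) ∧ ∃ a b : Strand B, a ≠ b ∧ strand F a t = strand F b t}

/-- At the heights `τ 0 < τ 1 < ⋯ < τ ℓ` the strands are disjoint, and the permutation of the
strands associated with the interval `[τ j, τ (j+1)]` is the transposition `(i ↔ i+1)`, where `σ_i`
is, up to sign, the `j`-th letter of the word `B`. -/
def RealizesPermutations {n : ℕ} (B : BraidWord n) (τ : Fin (B.length + 1) → ℝ)
    (F : Component B → ℝ → ℝ) : Prop :=
  (∀ j, ∀ a b : Strand B, a ≠ b → strand F a (τ j) ≠ strand F b (τ j)) ∧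
  ∀ (j : Fin B.length) (a : Strand B),
    rank F a (τ j.succ) =
      Equiv.swap ((B.get j).1 : ℕ) ((B.get j).1 + 1) (rank F a (τ j.castSucc))

/-- All singular crossings are generic: every intersection of two strands is transverse, and at
each height at most one pair of strands intersects (so no crossing involves three strands and
different crossings have different heights). Moreover no crossing has height `π`. -/
def IsGeneric {n : ℕ} {B : BraidWord n} (F : Component B → ℝ → ℝ) : Prop :=
  (∀ t ∈ Set.Icc 0 (2 * Real.pi), ∀ a b : Strand B, a ≠ b → strand F a t = strand F b t →
    deriv (strand F a) t ≠ deriv (strand F b) t) ∧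
  (∀ t ∈ Set.Icc 0 (2 * Real.pi), ∀ a b c d : Strand B, a ≠ b → c ≠ d →
    strand F a t = strand F b t → strand F c t = strand F d t → s(a, b) = s(c, d)) ∧
  Real.pi ∉ crossingTimes F

/-! ### The algorithm -/

/-- Heights `0 = τ 0 < τ 1 < ⋯ < τ ℓ = 2π` that separate the `ℓ` crossings of the diagram of `B`. -/
def IsSubdivision {n : ℕ} (B : BraidWord n) (τ : Fin (B.length + 1) → ℝ) : Prop :=
  StrictMono τ ∧ τ 0 = 0 ∧ τ (Fin.last _) = 2 * Real.pi

/-- Step 1. For every component `C`, the function `F_C` is a trigonometric polynomial of degree at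
most `⌊s_C ℓ / 2⌋` that solves the interpolation problem with the following `s_C ℓ` data points.
Place the `p`-th smallest strand at the abscissa `x p`; then, following the component `C` of
the closed braid through its `s_C` strands, `F_C` has to take the position of the strand in the
diagram of `B` at each of the heights `τ 0, …, τ (ℓ-1)`. -/
def StepOne {n : ℕ} (B : BraidWord n) (τ : Fin (B.length + 1) → ℝ) (F : Component B → ℝ → ℝ) :
    Prop :=
  ∃ x : Fin (n + 1) → ℝ, StrictMono x ∧
    ∀ C : Component B, RealTrigDegLE (strandCount C * B.length / 2) (F C) ∧
      ∀ (j : Fin (strandCount C)) (k : Fin B.length),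
        strand F ⟨C, j⟩ (τ k.castSucc) =
          x (BraidWord.perm (B.take k) ((B.perm ^ (j : ℕ)) C.out))

/-- Step 2. Each `F_C` is modified by adding a constant, by a translation of its variable and,
if the component has more than one strand, by adding terms of the form `ε cos (θ - φ)` (whose sum is
again of this form), in such a way that the result is generic and still realizes the permutations
of the letters of `B` in the intervals between the same heights. -/
def StepTwo {n : ℕ} (B : BraidWord n) (τ : Fin (B.length + 1) → ℝ)
    (F F' : Component B → ℝ → ℝ) : Prop :=
  (∃ a b c φ : Component B → ℝ, (∀ C, strandCount C = 1 → c C = 0) ∧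
    ∀ C θ, F' C θ = F C (θ + a C) + b C + c C * Real.cos (θ - φ C)) ∧
  RealizesPermutations B τ F' ∧ IsGeneric F'

/-- The family `F` is a possible result of the first two steps for the input `B`. -/
def IsGenericParametrization {n : ℕ} (B : BraidWord n) (F : Component B → ℝ → ℝ) : Prop :=
  ∃ τ F₀, IsSubdivision B τ ∧ StepOne B τ F₀ ∧ StepTwo B τ F₀ F

/-- Step 3. The function `g (u, exp (i t)) = ∏_C ∏_j (u - F_C ((2t + 2πj) / s_C))`. -/
noncomputable def gFun {n : ℕ} {B : BraidWord n} (F : Component B → ℝ → ℝ) (u : ℂ) (t : ℝ) : ℂ :=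
  ∏ C : Component B, ∏ j : Fin (strandCount C),
    (u - (F C ((2 * t + 2 * Real.pi * (j : ℕ)) / strandCount C) : ℂ))

/-- Step 4. The function `p_k (u, r exp (i t)) = r ^ (2ks) g (u / r ^ (2k), exp (i t))`, `r > 0`,
where `s = n + 1`. -/
noncomputable def pFun {n : ℕ} {B : BraidWord n} (F : Component B → ℝ → ℝ) (k : ℕ)
    (u : ℂ) (r t : ℝ) : ℂ :=
  (r : ℂ) ^ (2 * k * (n + 1)) * gFun F (u / (r : ℂ) ^ (2 * k)) t

/-- The polynomial `P` in three variables, evaluated at `u`, `v` and the complex conjugate of `v`,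
is equal to `h (u, r, t)` at `v = r exp (i t)` for all `r > 0`. A polynomial in `u`, `v` and the
conjugate of `v` is uniquely determined by this. -/
def Represents (P : MvPolynomial (Fin 3) ℂ) (h : ℂ → ℝ → ℝ → ℂ) : Prop :=
  ∀ (u : ℂ) (r t : ℝ), 0 < r →
    MvPolynomial.eval ![u, r * Complex.exp (t * Complex.I),
      (starRingEnd ℂ) (r * Complex.exp (t * Complex.I))] P = h u r t

/-- The exponents `k` that are allowed in Step 4: `2ks` is greater than the degree of `g` with
respect to `exp (i t)` and `exp (-i t)`, and `p_k` is a semiholomorphic polynomial. -/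
def AdmissibleK {n : ℕ} {B : BraidWord n} (F : Component B → ℝ → ℝ) (k : ℕ) : Prop :=
  (∃ d < 2 * k * (n + 1), ∀ u, TrigDegLE d (gFun F u)) ∧ ∃ P, Represents P (pFun F k)

/-- Step 5. `t 0 < t 1 < ⋯` are the heights of the singular crossings `τ_{i 0}, τ_{i 1}, …` of
the singular braid parametrized by `F`, the signs `ε` are such that resolving the crossings
accordingly gives a braid isotopic to `B`, and each `y k / cos (t k / 2)` is a non-zero real number
with the sign of the critical point of `g` associated with the `k`-th crossing (the critical
point that lies between the two roots that collide; the height `t` of the curves corresponds to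
the parameter `t / 2` of `g`). Then `A` is a trigonometric polynomial with the prescribed values
`y k / cos (t k / 2)` and the prescribed derivatives `ε k` of its argument; its degree is at most
the number of singular crossings. -/
def StepFive {n : ℕ} (B : BraidWord n) (F : Component B → ℝ → ℝ) (A : ℝ → ℂ) : Prop :=
  ∃ (N : ℕ) (t : Fin N → ℝ) (i : Fin N → Fin n) (ε : Fin N → ℤˣ) (y : Fin N → ℝ),
    StrictMono t ∧ Set.range t = crossingTimes F ∧
    (∀ k, ∀ a b : Strand B, a ≠ b → strand F a (t k) = strand F b (t k) →
      rank F a (t k) = i k) ∧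
    BraidWord.toGroup (List.ofFn fun k => (i k, ε k)) = B.toGroup ∧
    (∀ k, y k / Real.cos (t k / 2) ≠ 0) ∧
    (∀ k, ∀ a b : Strand B, a ≠ b → strand F a (t k) = strand F b (t k) →
      ∀ᶠ t' in 𝓝[≠] t k, ∃ c : ℝ,
        min (strand F a t') (strand F b t') < c ∧ c < max (strand F a t') (strand F b t') ∧
        deriv (fun u : ℂ => gFun F u (t' / 2)) c = 0 ∧
        SignType.sign (y k / Real.cos (t k / 2)) = SignType.sign (gFun F c (t' / 2)).re) ∧
    TrigDegLE N A ∧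
    ∀ k, A (t k) = ((y k / Real.cos (t k / 2) : ℝ) : ℂ) ∧
      ((A (t k)).re * deriv (fun t' => (A t').im) (t k) -
        (A (t k)).im * deriv (fun t' => (A t').re) (t k)) / ‖A (t k)‖ ^ 2 = ((ε k : ℤ) : ℝ)

/-- The trigonometric polynomial `t ↦ A (2t) cos t` that is built from the solution of the
interpolation problem. -/
noncomputable def oddExtension (A : ℝ → ℂ) (t : ℝ) : ℂ := A (2 * t) * (Real.cos t : ℂ)

/-- The exponents `m` that are allowed in Step 6: `m` is odd, larger than the degree of
`oddExtension A` with respect to `exp (i t)` and `exp (-i t)`, and larger than `2ks`. -/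
def AdmissibleM (n : ℕ) (A : ℝ → ℂ) (k m : ℕ) : Prop :=
  Odd m ∧ (∃ d < m, TrigDegLE d (oddExtension A)) ∧ 2 * k * (n + 1) < m

/-- Step 6. The polynomial `f` in `u`, `v` and the conjugate of `v` such that
`f (u, r exp (i t)) = p_k (u, r exp (i t)) + r ^ m A (2t) cos t`. -/
def StepSix {n : ℕ} {B : BraidWord n} (F : Component B → ℝ → ℝ) (A : ℝ → ℂ) (k m : ℕ)
    (f : MvPolynomial (Fin 3) ℂ) : Prop :=
  Represents f fun u r t => pFun F k u r t + (r : ℂ) ^ m * oddExtension A t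

end BraidPoly

/-! Degree bound. A strand of `C` runs through `F_C` at speed `1/s_C`, so the bound `⌊s_C ℓ/2⌋` on
the degree of `F_C` becomes the bound `ℓ/2` on the frequencies of every strand, whatever its
component. Two estimates follow.

The coefficient of `u^(s-j)` in `g` is, up to sign, a sum of products of `j` strands, evaluated at
`2t`. Single products have frequencies in a fractional lattice, but `g` is invariant under the
monodromy of the closed braid; averaging over translates by multiples of `2π` removes the fractional
frequencies without raising the degree. What remains has even frequencies of size at most `jℓ`, and
`r^(2kj)` turns these into monomials in `v` and its conjugate once `2k ≥ ℓ`. Hence `k ≤ ⌊ℓ/2⌋ + 1`.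
As `p_k` is weighted homogeneous, its degree is at most `2ks`.

The crossings are zeros of the product of the differences of all pairs of strands. Counting zeros of
this trigonometric polynomial gives at most `ℓ` crossings per pair, so the number `N` of crossings
satisfies `2N ≤ s²ℓ`. The function `A(2t) cos t` has degree at most `2N + 1` and only odd
frequencies, so `r^m A` is a polynomial of degree at most `m`, and `m ≤ max (2N + 3) (2ks + 1)`.
This is below the asserted bound even without the sum over the components.

Step 2. Perturb along a fixed direction `v` with parameter `ε`. At a zero of a perturbed difference,
`ε` is determined by the height, and the failures of genericity are zeros of analytic functions of
the height; so only finitely many `ε` are bad, unless two different pairs have proportional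
differences both before and after perturbation. In that case both pairs would always change order
together, whereas an adjacent transposition reverses only one pair. So neither order would ever
change, and following the strands around their component would give an increasing cyclic sequence.

Step 5. The signs are found separately on each interval of the subdivision. There the crossings
compose to one adjacent transposition, and the positive permutation braids form a section of
permutations under which every crossing contributes a generator or its inverse; the mirror
automorphism corrects the sign. Hermite interpolation with one degree per node then gives `A`: value
and first derivative at each of `N` nodes. The prescribed signs of critical values come from Rolle's
theorem between the colliding roots. -/

namespace BraidPoly

/-! ### Spans of exponentials with real frequencies -/

/-- The function `t ↦ exp (i x t)`. -/
noncomputable def wave (x t : ℝ) : ℂ := Complex.exp (x * t * Complex.I)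

/-- The span of the functions `t ↦ exp (i x t)`, `x ∈ s`. -/
noncomputable def trigSpan (s : Set ℝ) : Submodule ℂ (ℝ → ℂ) := Submodule.span ℂ (wave '' s)

/-- The frequencies in `[-D, D]` that are multiples of `1 / L`. -/
def freqs (L : ℕ) (D : ℝ) : Set ℝ := {x | |x| ≤ D ∧ ∃ k : ℤ, L * x = k}

theorem wave_add_freq (x y t : ℝ) : wave (x + y) t = wave x t * wave y t := by
  simp only [wave, ← Complex.exp_add]; congr 1; push_cast; ring

theorem wave_zero_freq (t : ℝ) : wave 0 t = 1 := by simp [wave]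

theorem wave_affine (x a b t : ℝ) : wave x (a * t + b) = wave x b * wave (a * x) t := by
  simp only [wave, ← Complex.exp_add]; congr 1; push_cast; ring

theorem wave_add (x t b : ℝ) : wave x (t + b) = wave x b * wave x t := by
  simpa using wave_affine x 1 b t

theorem wave_intCast_pi (k : ℤ) : wave k Real.pi = (-1) ^ k := by
  rw [wave, ← Complex.exp_pi_mul_I, ← Complex.exp_int_mul]; push_cast; ring_nf

theorem wave_mem {s : Set ℝ} {x : ℝ} (hx : x ∈ s) : wave x ∈ trigSpan s :=
  Submodule.subset_span ⟨x, hx, rfl⟩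

theorem trigSpan_mono {s s' : Set ℝ} (h : s ⊆ s') : trigSpan s ≤ trigSpan s' :=
  Submodule.span_mono (Set.image_mono h)

theorem trigSpan_mul {s s' u : Set ℝ} (h : ∀ x ∈ s, ∀ y ∈ s', x + y ∈ u) {f g : ℝ → ℂ}
    (hf : f ∈ trigSpan s) (hg : g ∈ trigSpan s') : f * g ∈ trigSpan u := by
  have : trigSpan s * trigSpan s' ≤ trigSpan u := by
    rw [trigSpan, trigSpan, Submodule.span_mul_span, Submodule.span_le]
    rintro _ ⟨_, ⟨x, hx, rfl⟩, _, ⟨y, hy, rfl⟩, rfl⟩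
    have : wave x * wave y = wave (x + y) := funext fun t => (wave_add_freq x y t).symm
    simpa only [this, SetLike.mem_coe] using wave_mem (h x hx y hy)
  exact this (Submodule.mul_mem_mul hf hg)

theorem trigSpan_affine {s u : Set ℝ} (a b : ℝ) (h : ∀ x ∈ s, a * x ∈ u) {f : ℝ → ℂ}
    (hf : f ∈ trigSpan s) : (fun t => f (a * t + b)) ∈ trigSpan u := by
  induction hf using Submodule.span_induction with
  | mem f hf =>
    obtain ⟨x, hx, rfl⟩ := hf
    have : (fun t => wave x (a * t + b)) = wave x b • wave (a * x) := by
      funext t; simp [wave_affine]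
    rw [this]
    exact Submodule.smul_mem _ _ (wave_mem (h x hx))
  | zero => exact zero_mem _
  | add f g _ _ hf hg => exact add_mem hf hg
  | smul c f _ hf => exact Submodule.smul_mem _ c hf

theorem freqs_add {L : ℕ} {D D' x y : ℝ} (hx : x ∈ freqs L D) (hy : y ∈ freqs L D') :
    x + y ∈ freqs L (D + D') := by
  obtain ⟨hx, k, hk⟩ := hx
  obtain ⟨hy, l, hl⟩ := hy
  exact ⟨(abs_add_le _ _).trans (add_le_add hx hy), k + l, by push_cast; linarith⟩

theorem freqs_mono (L : ℕ) {D D' : ℝ} (h : D ≤ D') : freqs L D ⊆ freqs L D' :=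
  fun _ hx => ⟨hx.1.trans h, hx.2⟩

theorem mul_mem_trigSpan_freqs {L : ℕ} {D D' : ℝ} {f g : ℝ → ℂ} (hf : f ∈ trigSpan (freqs L D))
    (hg : g ∈ trigSpan (freqs L D')) : f * g ∈ trigSpan (freqs L (D + D')) :=
  trigSpan_mul (fun _ hx _ hy => freqs_add hx hy) hf hg

theorem const_mem_trigSpan_freqs (L : ℕ) {D : ℝ} (hD : 0 ≤ D) (c : ℂ) :
    (fun _ => c) ∈ trigSpan (freqs L D) := by
  have : (fun _ => c) = c • wave 0 := by funext t; simp [wave_zero_freq]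
  rw [this]
  exact Submodule.smul_mem _ _ (wave_mem ⟨by simpa, 0, by simp⟩)

theorem prod_mem_trigSpan_freqs {ι : Type*} (S : Finset ι) {L : ℕ} {D : ℝ} {f : ι → ℝ → ℂ}
    (hf : ∀ i ∈ S, f i ∈ trigSpan (freqs L D)) :
    (fun t => ∏ i ∈ S, f i t) ∈ trigSpan (freqs L (S.card * D)) := by
  classical
  induction S using Finset.induction_on with
  | empty => simpa using const_mem_trigSpan_freqs L le_rfl 1
  | insert a S ha ih =>
    have h1 := mul_mem_trigSpan_freqs (hf a (by simp)) (ih fun i hi => hf i (by simp [hi]))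
    have : (fun t => ∏ i ∈ insert a S, f i t) = f a * fun t => ∏ i ∈ S, f i t := by
      funext t; simp [Finset.prod_insert ha]
    rw [this, Finset.card_insert_of_notMem ha]
    convert h1 using 3
    push_cast; ring

theorem intCast_mem_freqs_one {d : ℕ} {k : ℤ} (hk : k ∈ Finset.Icc (-(d : ℤ)) d) :
    (k : ℝ) ∈ freqs 1 d := by
  rw [Finset.mem_Icc, ← abs_le] at hk
  exact ⟨by exact_mod_cast hk, k, by simp⟩

theorem trigDegLE_iff {d : ℕ} {h : ℝ → ℂ} : TrigDegLE d h ↔ h ∈ trigSpan (freqs 1 d) := by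
  constructor
  · rintro ⟨c, hc⟩
    have : h = ∑ k ∈ Finset.Icc (-(d : ℤ)) d, c k • wave k := by
      funext t; simp [hc, wave, Finset.sum_apply]
    rw [this]
    exact Submodule.sum_mem _ fun k hk =>
      Submodule.smul_mem _ _ (wave_mem (intCast_mem_freqs_one hk))
  · intro hh
    induction hh using Submodule.span_induction with
    | mem f hf =>
      obtain ⟨x, ⟨hx, k, hk⟩, rfl⟩ := hf
      obtain rfl : x = k := by simpa using hk
      refine ⟨Pi.single k 1, fun t => ?_⟩
      have hk' : k ∈ Finset.Icc (-(d : ℤ)) d := by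
        rw [Finset.mem_Icc, ← abs_le]; exact_mod_cast hx
      rw [Finset.sum_eq_single k]
      · simp [wave]
      · intro b _ hb; simp [hb]
      · exact fun h => absurd hk' h
    | zero => exact ⟨0, by simp⟩
    | add f g _ _ hf hg =>
      obtain ⟨a, ha⟩ := hf
      obtain ⟨b, hb⟩ := hg
      exact ⟨a + b, fun t => by simp [ha, hb, add_mul, Finset.sum_add_distrib]⟩
    | smul c f _ hf =>
      obtain ⟨a, ha⟩ := hf
      exact ⟨c • a, fun t => by simp [ha, mul_assoc, Finset.mul_sum]⟩

theorem cos_mem_trigSpan (k : ℝ) {s : Set ℝ} (h1 : k ∈ s) (h2 : -k ∈ s) :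
    (fun t : ℝ => (Real.cos (k * t) : ℂ)) ∈ trigSpan s := by
  have : (fun t : ℝ => (Real.cos (k * t) : ℂ)) = (1 / 2 : ℂ) • (wave k + wave (-k)) := by
    funext t
    simp only [wave, Pi.smul_apply, Pi.add_apply, smul_eq_mul]
    push_cast
    rw [Complex.cos]; ring_nf
  rw [this]
  exact Submodule.smul_mem _ _ (add_mem (wave_mem h1) (wave_mem h2))

theorem sin_mem_trigSpan (k : ℝ) {s : Set ℝ} (h1 : k ∈ s) (h2 : -k ∈ s) :
    (fun t : ℝ => (Real.sin (k * t) : ℂ)) ∈ trigSpan s := by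
  have : (fun t : ℝ => (Real.sin (k * t) : ℂ)) =
      (Complex.I / 2 : ℂ) • (wave (-k) - wave k) := by
    funext t
    simp only [wave, Pi.smul_apply, Pi.sub_apply, smul_eq_mul]
    push_cast
    rw [Complex.sin]; ring_nf
  rw [this]
  exact Submodule.smul_mem _ _ (sub_mem (wave_mem h2) (wave_mem h1))

theorem natCast_mem_freqs_one {d k : ℕ} (hk : k ≤ d) :
    (k : ℝ) ∈ freqs 1 d ∧ (-k : ℝ) ∈ freqs 1 d :=
  ⟨⟨by simpa, k, by simp⟩, ⟨by simpa, -k, by simp⟩⟩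

theorem RealTrigDegLE.mem_trigSpan {d : ℕ} {F : ℝ → ℝ} (hF : RealTrigDegLE d F) :
    (fun t => (F t : ℂ)) ∈ trigSpan (freqs 1 d) := by
  obtain ⟨a, b, h⟩ := hF
  have : (fun t => (F t : ℂ)) = ∑ k ∈ Finset.range (d + 1),
      ((a k : ℂ) • (fun t : ℝ => (Real.cos (k * t) : ℂ)) +
        (b k : ℂ) • (fun t : ℝ => (Real.sin (k * t) : ℂ))) := by
    funext t; simp [h, Finset.sum_apply]
  rw [this]
  refine Submodule.sum_mem _ fun k hk => ?_
  have := natCast_mem_freqs_one (Finset.mem_range_succ_iff.mp hk)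
  exact add_mem (Submodule.smul_mem _ _ (cos_mem_trigSpan _ this.1 this.2))
    (Submodule.smul_mem _ _ (sin_mem_trigSpan _ this.1 this.2))

theorem RealTrigDegLE.analyticAt {d : ℕ} {F : ℝ → ℝ} (hF : RealTrigDegLE d F) (t : ℝ) :
    AnalyticAt ℝ F t := by
  obtain ⟨a, b, h⟩ := hF
  rw [funext h]
  refine Finset.analyticAt_fun_sum _ fun k _ => ?_
  have h1 : AnalyticAt ℝ (fun t : ℝ => (k : ℝ) * t) t := by fun_prop
  exact (analyticAt_const.mul (Real.analyticAt_cos.fun_comp h1)).add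
    (analyticAt_const.mul (Real.analyticAt_sin.fun_comp h1))

theorem RealTrigDegLE.periodic {d : ℕ} {F : ℝ → ℝ} (hF : RealTrigDegLE d F) (t : ℝ) :
    F (t + 2 * Real.pi) = F t := by
  obtain ⟨a, b, h⟩ := hF
  rw [h, h]
  refine Finset.sum_congr rfl fun k _ => ?_
  rw [mul_add, Real.cos_add_nat_mul_two_pi, Real.sin_add_nat_mul_two_pi]

/-- The average of the translates of a function by the first `L` multiples of `2π`. -/
noncomputable def translateAverage (L : ℕ) (f : ℝ → ℂ) (t : ℝ) : ℂ :=
  (1 / L : ℂ) * ∑ m ∈ Finset.range L, f (t + m * (2 * Real.pi))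

/-- On a wave of frequency `x = k/L` the average is multiplication by the mean of the powers of the
`L`-th root of unity `exp(2πix)`. This mean vanishes unless the root is `1`, that is, unless `x` is
an integer. -/
theorem translateAverage_mem {L : ℕ} {D : ℝ} {f : ℝ → ℂ}
    (hf : f ∈ trigSpan (freqs L D)) : translateAverage L f ∈ trigSpan (freqs 1 D) := by
  induction hf using Submodule.span_induction with
  | mem f hf =>
    obtain ⟨x, ⟨hx, k, hk⟩, rfl⟩ := hf
    set ζ := wave x (2 * Real.pi) with hζ
    have hpow : ∀ m : ℕ, wave x (m * (2 * Real.pi)) = ζ ^ m := by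
      intro m
      rw [hζ, wave, wave, ← Complex.exp_nat_mul]; congr 1; push_cast; ring
    have h1 : translateAverage L (wave x) = ((1 / L : ℂ) * ∑ m ∈ Finset.range L, ζ ^ m) • wave x := by
      funext t
      simp only [translateAverage, wave_add, hpow, Pi.smul_apply, smul_eq_mul, ← Finset.sum_mul]
      ring
    have hζL : ζ ^ L = 1 := by
      rw [← hpow, wave, Complex.exp_eq_one_iff]
      refine ⟨k, ?_⟩
      rw [← Complex.ofReal_intCast, ← hk]; push_cast; ring
    rw [h1]
    by_cases h : ζ = 1
    · obtain ⟨j, hj⟩ := Complex.exp_eq_one_iff.mp h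
      have hxj : x = j := by
        have h2 : ((x : ℂ) - j) * (2 * Real.pi * Complex.I) = 0 := by
          push_cast at hj; linear_combination hj
        have h3 : (2 * Real.pi * Complex.I : ℂ) ≠ 0 := by
          simp [Real.pi_ne_zero]
        have h4 := (mul_eq_zero.mp h2).resolve_right h3
        exact_mod_cast sub_eq_zero.mp h4
      exact Submodule.smul_mem _ _ (wave_mem ⟨hx, j, by simp [hxj]⟩)
    · rw [geom_sum_eq h, hζL]; simp
  | zero =>
    have : translateAverage L 0 = 0 := by funext t; simp [translateAverage]
    rw [this]; exact zero_mem _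
  | add f g _ _ hf hg =>
    have : translateAverage L (f + g) = translateAverage L f + translateAverage L g := by
      funext t; simp [translateAverage, Finset.sum_add_distrib, mul_add]
    rw [this]; exact add_mem hf hg
  | smul c f _ hf =>
    have : translateAverage L (c • f) = c • translateAverage L f := by
      funext t; simp only [translateAverage, Pi.smul_apply, smul_eq_mul, ← Finset.mul_sum]; ring
    rw [this]; exact Submodule.smul_mem _ c hf

theorem translateAverage_of_periodic {L : ℕ} (hL : 0 < L) {f : ℝ → ℂ}
    (hf : Function.Periodic f (2 * Real.pi)) : translateAverage L f = f := by
  funext t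
  simp only [translateAverage, hf.nat_mul _ _]
  simp [hL.ne']

/-- Translation by `π` multiplies the wave of integer frequency `k` by `(-1)^k`, so the difference
kills the even frequencies. -/
theorem sub_translate_pi_mem {D : ℝ} {f : ℝ → ℂ} (hf : f ∈ trigSpan (freqs 1 D)) :
    (fun t => f t - f (t + Real.pi)) ∈ trigSpan {x | |x| ≤ D ∧ ∃ k : ℤ, Odd k ∧ x = k} := by
  induction hf using Submodule.span_induction with
  | mem f hf =>
    obtain ⟨x, ⟨hx, k, hk⟩, rfl⟩ := hf
    obtain rfl : x = k := by simpa using hk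
    have : (fun t => wave k t - wave k (t + Real.pi)) = (1 - (-1) ^ k : ℂ) • wave k := by
      funext t; rw [wave_add, wave_intCast_pi]; simp; ring
    rw [this]
    rcases Int.even_or_odd k with h | h
    · simp [h.neg_one_zpow]
    · exact Submodule.smul_mem _ _ (wave_mem ⟨hx, k, h, rfl⟩)
  | zero => simp only [Pi.zero_apply, sub_self]; exact zero_mem _
  | add f g _ _ hf hg =>
    convert add_mem hf hg using 1
    funext t; simp; ring
  | smul c f _ hf =>
    convert Submodule.smul_mem _ c hf using 1
    funext t; simp; ring

theorem mem_trigSpan_odd {D : ℝ} {f : ℝ → ℂ} (hf : f ∈ trigSpan (freqs 1 D))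
    (h : ∀ t, f (t + Real.pi) = -f t) : f ∈ trigSpan {x | |x| ≤ D ∧ ∃ k : ℤ, Odd k ∧ x = k} := by
  have := Submodule.smul_mem _ (1 / 2 : ℂ) (sub_translate_pi_mem hf)
  convert this using 1
  funext t; simp [h]; ring

/-! ### Zeros of trigonometric polynomials and interpolation by them -/

theorem exists_polynomial_of_trigDegLE {d : ℕ} {f : ℝ → ℂ} (hf : TrigDegLE d f) :
    ∃ P : Polynomial ℂ, P.natDegree ≤ 2 * d ∧ ∀ t, P.eval (wave 1 t) = wave d t * f t := by
  rw [trigDegLE_iff] at hf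
  induction hf using Submodule.span_induction with
  | mem f hf =>
    obtain ⟨x, ⟨hx, k, hk⟩, rfl⟩ := hf
    obtain rfl : x = k := by simpa using hk
    have hk' : |k| ≤ d := by exact_mod_cast hx
    rw [abs_le] at hk'
    refine ⟨Polynomial.X ^ (k + d).toNat, ?_, fun t => ?_⟩
    · rw [Polynomial.natDegree_X_pow]; omega
    · rw [Polynomial.eval_pow, Polynomial.eval_X, ← wave_add_freq, wave, wave, ← Complex.exp_nat_mul]
      congr 1
      have : (((k + d).toNat : ℕ) : ℂ) = k + d := by
        have : (((k + d).toNat : ℕ) : ℤ) = k + d := by omega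
        exact_mod_cast this
      rw [this]; push_cast; ring
  | zero => exact ⟨0, by simp⟩
  | add f g _ _ hf hg =>
    obtain ⟨P, hP, hP'⟩ := hf
    obtain ⟨Q, hQ, hQ'⟩ := hg
    exact ⟨P + Q, (Polynomial.natDegree_add_le _ _).trans (max_le hP hQ), fun t => by
      simp [hP', hQ', mul_add]⟩
  | smul c f _ hf =>
    obtain ⟨P, hP, hP'⟩ := hf
    exact ⟨Polynomial.C c * P, (Polynomial.natDegree_C_mul_le _ _).trans hP, fun t => by
      simp [hP']; ring⟩

theorem wave_one_injOn : Set.InjOn (wave 1) (Set.Ico 0 (2 * Real.pi)) := by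
  intro x hx y hy h
  obtain ⟨n, hn⟩ := Complex.exp_eq_exp_iff_exists_int.mp h
  have h1 : (x : ℂ) = y + n * (2 * Real.pi) := by
    have : ((x : ℂ) - (y + n * (2 * Real.pi))) * Complex.I = 0 := by
      push_cast at hn; linear_combination hn
    exact sub_eq_zero.mp ((mul_eq_zero.mp this).resolve_right Complex.I_ne_zero)
  have h2 : x = y + n * (2 * Real.pi) := by exact_mod_cast h1
  have hpi := Real.pi_pos
  have h3 : (n : ℝ) < 1 := by
    by_contra hc; push Not at hc
    nlinarith [hx.1, hx.2, hy.1, hy.2]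
  have h4 : (-1 : ℝ) < n := by
    by_contra hc; push Not at hc
    nlinarith [hx.1, hx.2, hy.1, hy.2]
  have : n = 0 := by
    have a : n < 1 := by exact_mod_cast h3
    have b : -1 < n := by exact_mod_cast h4
    omega
  simpa [this] using h2

/-- Multiplying by `exp(idt)` clears the negative exponents, so zeros in one period become distinct
roots on the unit circle of a polynomial of degree at most `2d`. -/
theorem card_zeros_le {d : ℕ} {f : ℝ → ℂ} (hf : TrigDegLE d f) {t₀ : ℝ} (h₀ : f t₀ ≠ 0)
    (Z : Finset ℝ) (hZ : ∀ t ∈ Z, t ∈ Set.Ico 0 (2 * Real.pi) ∧ f t = 0) : Z.card ≤ 2 * d := by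
  classical
  obtain ⟨P, hP, hP'⟩ := exists_polynomial_of_trigDegLE hf
  have hne : P ≠ 0 := by
    rintro rfl
    have := hP' t₀
    simp [h₀, wave] at this
  have hinj : Set.InjOn (wave 1) Z := wave_one_injOn.mono fun t ht => (hZ t ht).1
  rw [← Finset.card_image_of_injOn hinj]
  calc (Z.image (wave 1)).card ≤ P.roots.toFinset.card := by
        refine Finset.card_le_card fun z hz => ?_
        obtain ⟨t, ht, rfl⟩ := Finset.mem_image.mp hz
        rw [Multiset.mem_toFinset, Polynomial.mem_roots hne, Polynomial.IsRoot, hP', (hZ t ht).2,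
          mul_zero]
    _ ≤ P.roots.card := Multiset.toFinset_card_le _
    _ ≤ P.natDegree := Polynomial.card_roots' P
    _ ≤ 2 * d := hP

/-- Interpolation by real trigonometric polynomials. -/
theorem exists_realTrigDegLE_interpolate {ι : Type*} [Fintype ι] (θ : ι → ℝ) (y : ι → ℝ)
    (hθ : Function.Injective θ) (hmem : ∀ i, θ i ∈ Set.Ico 0 (2 * Real.pi)) :
    ∃ F, RealTrigDegLE (Fintype.card ι / 2) F ∧ ∀ i, F (θ i) = y i := by
  classical
  set d := Fintype.card ι / 2 with hd
  have hinj : Set.InjOn (fun i => wave 1 (θ i)) (Finset.univ : Finset ι) := fun i _ j _ h =>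
    hθ (wave_one_injOn (hmem i) (hmem j) h)
  -- The data are multiplied by `z^d` because the spectrum will be shifted down by `d`. Both
  -- parities are covered: `P` has fewer than `Fintype.card ι ≤ 2d + 1` coefficients in degree
  -- order, so the shifted frequencies lie in `[-d, d]`.
  set P := Lagrange.interpolate Finset.univ (fun i => wave 1 (θ i))
    (fun i => wave d (θ i) * y i) with hPdef
  have hdeg : P.natDegree < 2 * d + 1 := by
    rcases isEmpty_or_nonempty ι with hι | hι
    · have : P = 0 := by simp [hPdef]
      simp [this]
    · have h1 := Lagrange.degree_interpolate_lt (fun i => wave d (θ i) * y i) hinj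
      have hc : 0 < Fintype.card ι := Fintype.card_pos
      have h2 : P.natDegree < Fintype.card ι := by
        by_cases hP0 : P = 0
        · simpa [hP0] using hc
        · rw [Polynomial.natDegree_lt_iff_degree_lt hP0]
          rw [← Finset.card_univ]; exact h1
      omega
  have heval : ∀ i, P.eval (wave 1 (θ i)) = wave d (θ i) * y i := fun i =>
    Lagrange.eval_interpolate_at_node _ hinj (Finset.mem_univ i)
  set h : ℝ → ℂ := fun t => ∑ k ∈ Finset.range (2 * d + 1), P.coeff k * wave ((k : ℝ) - d) t with hh
  have hwave : ∀ (k : ℕ) (t : ℝ), wave k t = wave 1 t ^ k := by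
    intro k t; rw [wave, wave, ← Complex.exp_nat_mul]; congr 1; push_cast; ring
  have hh' : ∀ t, wave d t * h t = P.eval (wave 1 t) := by
    intro t
    rw [Polynomial.eval_eq_sum_range' hdeg, hh, Finset.mul_sum]
    refine Finset.sum_congr rfl fun k _ => ?_
    rw [← hwave, mul_left_comm, ← wave_add_freq]; congr 2; ring
  have hcs : ∀ (c : ℂ) (x t : ℝ), (c * wave x t).re =
      c.re * Real.cos (x * t) + -c.im * Real.sin (x * t) := by
    intro c x t
    have : wave x t = Complex.exp (((x * t : ℝ) : ℂ) * Complex.I) := by simp [wave]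
    rw [Complex.mul_re, this, Complex.exp_ofReal_mul_I_re, Complex.exp_ofReal_mul_I_im]; ring
  -- The data are real, so the real part still interpolates.
  refine ⟨fun t => (h t).re, ?_, fun i => ?_⟩
  -- Frequencies `k` and `-k` are merged; frequency `0` would otherwise be counted twice.
  · refine ⟨fun k => (P.coeff (d + k)).re + if k = 0 then 0 else (P.coeff (d - k)).re,
      fun k => -(P.coeff (d + k)).im + (P.coeff (d - k)).im, fun t => ?_⟩
    have h1 : 2 * d + 1 = d + (d + 1) := by ring
    simp only [hh, Complex.re_sum, hcs]
    rw [h1, Finset.sum_range_add, ← Finset.sum_range_reflect (n := d),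
      Finset.sum_range_succ' (n := d) , Finset.sum_range_succ' (n := d), ← add_assoc,
      ← Finset.sum_add_distrib]
    congr 1
    · refine Finset.sum_congr rfl fun k hk => ?_
      have hk' := Finset.mem_range.mp hk
      have e1 : d - 1 - k = d - (k + 1) := by omega
      have e2 : ((d - (k + 1) : ℕ) : ℝ) = d - (k + 1) := by
        rw [Nat.cast_sub (by omega)]; push_cast; ring
      rw [e1, e2]
      have e3 : ((d : ℝ) - (k + 1) - d) * t = -(((k + 1 : ℕ) : ℝ) * t) := by push_cast; ring
      have e4 : (((d + (k + 1) : ℕ) : ℝ) - d) * t = ((k + 1 : ℕ) : ℝ) * t := by push_cast; ring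
      rw [e3, e4, Real.cos_neg, Real.sin_neg]
      simp; ring
    · simp
  · have h1 := hh' (θ i)
    rw [heval] at h1
    have h2 : h (θ i) = y i := mul_left_cancel₀ (Complex.exp_ne_zero _) h1
    simp [h2]

/-! ### Polynomials in `u`, `v` and the conjugate of `v` -/

/-- `r^m exp(ikt)` is the monomial of degree `a` in `v` and `b` in its conjugate, with `a + b = m`
and `a - b = k`. The conditions on size and parity of `k` say exactly that such natural numbers
exist. -/
theorem exists_mvPolynomial_of_mem_trigSpan (m : ℕ) {f : ℝ → ℂ}
    (hf : f ∈ trigSpan {x | ∃ k : ℤ, x = k ∧ |k| ≤ m ∧ Even ((m : ℤ) - k)}) :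
    ∃ Q : MvPolynomial (Fin 3) ℂ, Q.totalDegree ≤ m ∧
      Represents Q fun _ r t => (r : ℂ) ^ m * f t := by
  induction hf using Submodule.span_induction with
  | mem f hf =>
    obtain ⟨x, ⟨k, rfl, hk, j, hj⟩, rfl⟩ := hf
    rw [abs_le] at hk
    obtain ⟨a, ha⟩ : ∃ a : ℕ, (a : ℤ) = m - j := ⟨(m - j).toNat, by omega⟩
    obtain ⟨b, hb⟩ : ∃ b : ℕ, (b : ℤ) = j := ⟨j.toNat, by omega⟩
    have hab : a + b = m := by omega
    have hk' : k = a - b := by omega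
    refine ⟨MvPolynomial.X 1 ^ a * MvPolynomial.X 2 ^ b, ?_, fun u r t _ => ?_⟩
    · refine (MvPolynomial.totalDegree_mul _ _).trans ?_
      rw [MvPolynomial.totalDegree_X_pow, MvPolynomial.totalDegree_X_pow, hab]
    · simp only [map_mul, map_pow, MvPolynomial.eval_X, Matrix.cons_val_one, Matrix.cons_val,
        Complex.conj_ofReal, ← Complex.exp_conj, Complex.conj_I, mul_pow, ← Complex.exp_nat_mul]
      rw [← hab, pow_add, wave, hk']
      have : Complex.exp (((((a : ℤ) - (b : ℤ) : ℤ) : ℝ) : ℂ) * t * Complex.I) =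
          Complex.exp (a * (t * Complex.I)) * Complex.exp (b * (t * -Complex.I)) := by
        rw [← Complex.exp_add]; congr 1; push_cast; ring
      rw [this]; ring
  | zero => exact ⟨0, by simp, fun u r t _ => by simp⟩
  | add f g _ _ hf hg =>
    obtain ⟨P, hP, hP'⟩ := hf
    obtain ⟨Q, hQ, hQ'⟩ := hg
    exact ⟨P + Q, (MvPolynomial.totalDegree_add _ _).trans (max_le hP hQ), fun u r t hr => by
      rw [map_add, hP' u r t hr, hQ' u r t hr]; simp only [Pi.add_apply, mul_add]⟩
  | smul c f _ hf =>
    obtain ⟨P, hP, hP'⟩ := hf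
    refine ⟨MvPolynomial.C c * P, (MvPolynomial.totalDegree_mul _ _).trans (by simpa),
      fun u r t hr => ?_⟩
    rw [map_mul, MvPolynomial.eval_C, hP' u r t hr]; simp only [Pi.smul_apply, smul_eq_mul]; ring

/-! ### Lifting permutations to the braid group -/

/-- The relations of the braid group for the elements `σ j`, `j < n`, of a group. -/
structure BraidRelations {G : Type*} [Group G] (n : ℕ) (σ : ℕ → G) : Prop where
  comm : ∀ i j, i + 1 < j → j < n → σ i * σ j = σ j * σ i
  braid : ∀ i, i + 1 < n → σ i * σ (i + 1) * σ i = σ (i + 1) * σ i * σ (i + 1)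

/-- The product `σ m * σ (m - 1) * ⋯` with `d` factors. -/
def descendingProd {G : Type*} [Group G] (σ : ℕ → G) (m : ℕ) : ℕ → G
  | 0 => 1
  | d + 1 => descendingProd σ m d * σ (m - d)

section
variable {G : Type*} [Group G] {n : ℕ} {σ : ℕ → G}

theorem BraidRelations.descendingProd_comm (hσ : BraidRelations n σ) {m : ℕ} (hm : m < n) (d j : ℕ)
    (hd : d ≤ m + 1) (hj : j + 1 < m + 1 - d) :
    descendingProd σ m d * σ j = σ j * descendingProd σ m d := by
  induction d with
  | zero => simp [descendingProd]
  | succ d ih =>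
    rw [descendingProd, mul_assoc, ← hσ.comm j (m - d) (by omega) (by omega), ← mul_assoc,
      ih (by omega) (by omega), mul_assoc]

/-- The factor `σ (j + 1)` moves left past the distant generators until it meets `σ (j + 1) * σ j`;
the braid relation turns it into `σ j` on the other side, which commutes with the remaining larger
generators. -/
theorem BraidRelations.descendingProd_braid (hσ : BraidRelations n σ) {m : ℕ} (hm : m < n)
    (d j : ℕ) (hd : d ≤ m + 1) (hj : m + 1 - d < j + 1) (hjm : j + 1 ≤ m) :
    descendingProd σ m d * σ (j + 1) = σ j * descendingProd σ m d := by
  induction d with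
  | zero => omega
  | succ d ih =>
    rcases Nat.lt_or_ge (m + 1 - d) (j + 1) with h | h
    · have := hσ.comm (m - d) (j + 1) (by omega) (by omega)
      rw [descendingProd, mul_assoc, this, ← mul_assoc, ih (by omega) h, mul_assoc]
    · obtain ⟨e, rfl⟩ : ∃ e, d = e + 1 := ⟨d - 1, by omega⟩
      have h1 : m - (e + 1) = j := by omega
      have h2 : m - e = j + 1 := by omega
      have h3 := hσ.descendingProd_comm hm e j (by omega) (by omega)
      have h4 := hσ.braid j (by omega)
      rw [descendingProd, descendingProd, h1, h2]
      calc _ = descendingProd σ m e * (σ (j + 1) * σ j * σ (j + 1)) := by simp only [mul_assoc]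
        _ = descendingProd σ m e * σ j * (σ (j + 1) * σ j) := by rw [← h4]; simp only [mul_assoc]
        _ = _ := by rw [h3]; simp only [mul_assoc]

theorem zpow_units_comm {a b c : G} (h : c * a = b * c) (ε : ℤˣ) :
    c * a ^ (ε : ℤ) = b ^ (ε : ℤ) * c := by
  rcases Int.units_eq_one_or ε with rfl | rfl
  · simpa using h
  · simp only [Units.val_neg, Units.val_one, zpow_neg, zpow_one]
    rw [eq_inv_mul_iff_mul_eq, ← mul_assoc, ← h, mul_assoc, mul_inv_cancel, mul_one]

end

theorem swap_braidRelations (n : ℕ) : BraidRelations n fun j => Equiv.swap j (j + 1) where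
  comm i j hij _ := by
    refine (Equiv.Perm.Disjoint.commute ?_).eq
    intro x
    by_cases h : x = i ∨ x = i + 1
    · right; exact Equiv.swap_apply_of_ne_of_ne (by omega) (by omega)
    · left; exact Equiv.swap_apply_of_ne_of_ne (by omega) (by omega)
  braid i _ := by
    ext x
    simp only [Equiv.Perm.mul_apply, Equiv.swap_apply_def]
    split_ifs <;> omega

/-- This is the cycle that brings the image of the top position back to the top, reducing a
permutation to one of fewer positions. -/
theorem descendingProd_swap_apply (m d : ℕ) (hd : d ≤ m + 1) :
    descendingProd (fun j => Equiv.swap j (j + 1)) m d (m + 1 - d) = m + 1 ∧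
    ∀ x, m + 1 < x → descendingProd (fun j => Equiv.swap j (j + 1)) m d x = x := by
  induction d with
  | zero => simp [descendingProd]
  | succ d ih =>
    obtain ⟨h1, h2⟩ := ih (by omega)
    refine ⟨?_, fun x hx => ?_⟩
    · have e : m + 1 - (d + 1) = m - d := by omega
      have e' : m + 1 - d = m - d + 1 := by omega
      rw [descendingProd, Equiv.Perm.mul_apply, e, Equiv.swap_apply_left, ← e', h1]
    · rw [descendingProd, Equiv.Perm.mul_apply, Equiv.swap_apply_of_ne_of_ne (by omega) (by omega),
        h2 x hx]

/-- There is a section of permutations in a group with the braid relations, such that the values at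
permutations that differ by a simple transposition differ by a generator or its inverse. -/
theorem exists_perm_section {G : Type*} [Group G] {n : ℕ} {σ : ℕ → G} (hσ : BraidRelations n σ)
    (m : ℕ) (hm : m ≤ n) :
    ∃ T : Equiv.Perm ℕ → G, T 1 = 1 ∧ ∀ π : Equiv.Perm ℕ, (∀ x, m < x → π x = x) → ∀ j < m,
      ∃ ε : ℤˣ, T (Equiv.swap j (j + 1) * π) = T π * σ j ^ (ε : ℤ) := by
  induction m with
  | zero => exact ⟨fun _ => 1, rfl, fun _ _ j hj => absurd hj (by omega)⟩
  | succ m ih =>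
    obtain ⟨T, hT1, hT⟩ := ih (by omega)
    set s : ℕ → Equiv.Perm ℕ := fun j => Equiv.swap j (j + 1) with hs
    have hsr := swap_braidRelations n
    -- The positive permutation braid of `π`: first braid the lower strands, then bring the top
    -- strand down to its target `k = π (m + 1)` by `σ m ⋯ σ k`. Words are read left to right while
    -- permutations compose right to left.
    refine ⟨fun π => T (descendingProd s m (m + 1 - π (m + 1)) * π) *
      descendingProd σ m (m + 1 - π (m + 1)), by simp [descendingProd, hT1], fun π hπ j hj => ?_⟩
    set k := π (m + 1) with hk
    have hkm : k ≤ m + 1 := by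
      by_contra hc
      have h1 := hπ k (by omega)
      have : k = m + 1 := π.injective (by rw [h1])
      omega
    have hfix : ∀ x, m < x → (descendingProd s m (m + 1 - k) * π) x = x := by
      intro x hx
      obtain ⟨h1, h2⟩ := descendingProd_swap_apply m (m + 1 - k) (by omega)
      rcases Nat.eq_or_lt_of_le hx with h | h
      · have e : m + 1 - (m + 1 - k) = k := by omega
        rw [e] at h1
        rw [← h, Equiv.Perm.mul_apply]; exact h1
      · rw [Equiv.Perm.mul_apply, hπ x h]; exact h2 x h
    have hk' : (Equiv.swap j (j + 1) * π) (m + 1) = Equiv.swap j (j + 1) k := rfl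
    simp only [hk', ← hk]
    -- Four positions of `j` relative to `k`: for `j + 1 < k` the generator commutes with the
    -- descending product; for `j + 1 = k` it lengthens it; for `j = k` it cancels the last factor,
    -- whence the sign `-1`; for `j > k` it passes through with its index lowered by one.
    rcases Nat.lt_trichotomy (j + 1) k with h | h | h
    · rw [Equiv.swap_apply_of_ne_of_ne (by omega) (by omega), ← mul_assoc]
      have h1 := hsr.descendingProd_comm (m := m) (by omega) (m + 1 - k) j (by omega) (by omega)
      have h2 := hσ.descendingProd_comm (m := m) (by omega) (m + 1 - k) j (by omega) (by omega)
      obtain ⟨ε, hε⟩ := hT _ hfix j (by omega)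
      refine ⟨ε, ?_⟩
      rw [h1, mul_assoc (Equiv.swap _ _), hε, mul_assoc, mul_assoc, zpow_units_comm h2]
    · refine ⟨1, ?_⟩
      have e : m + 1 - j = (m + 1 - k) + 1 := by omega
      have e' : m - (m + 1 - k) = j := by omega
      rw [← h, Equiv.swap_apply_right, h, e, descendingProd, descendingProd, e']
      have : descendingProd s m (m + 1 - k) * s j * (Equiv.swap j (j + 1) * π) =
          descendingProd s m (m + 1 - k) * π := by
        rw [mul_assoc, ← mul_assoc (s j)]
        simp [hs]
      rw [← h] at this ⊢
      rw [this]
      simp [mul_assoc]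
    · rcases Nat.eq_or_lt_of_le (Nat.le_of_lt_succ h) with h' | h'
      · refine ⟨-1, ?_⟩
        have e : m + 1 - j = (m + 1 - (j + 1)) + 1 := by omega
        have e' : m - (m + 1 - (j + 1)) = j := by omega
        rw [h', Equiv.swap_apply_left, e, descendingProd, descendingProd, e', ← mul_assoc]
        simp [mul_assoc, hs]
      · obtain ⟨i, rfl⟩ : ∃ i, j = i + 1 := ⟨j - 1, by omega⟩
        rw [Equiv.swap_apply_of_ne_of_ne (by omega) (by omega), ← mul_assoc]
        have h1 := hsr.descendingProd_braid (m := m) (by omega) (m + 1 - k) i (by omega) (by omega)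
          (by omega)
        have h2 := hσ.descendingProd_braid (m := m) (by omega) (m + 1 - k) i (by omega) (by omega)
          (by omega)
        obtain ⟨ε, hε⟩ := hT _ hfix i (by omega)
        refine ⟨ε, ?_⟩
        rw [h1, mul_assoc (Equiv.swap _ _), hε, mul_assoc, mul_assoc, zpow_units_comm h2]

/-- The permutation of the natural numbers that is induced by a list of indices of generators. -/
def indexPerm {n : ℕ} : List (Fin n) → Equiv.Perm ℕ
  | [] => 1
  | i :: l => indexPerm l * Equiv.swap (i : ℕ) (i + 1)

theorem indexPerm_append {n : ℕ} (l l' : List (Fin n)) :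
    indexPerm (l ++ l') = indexPerm l' * indexPerm l := by
  induction l with
  | nil => simp [indexPerm]
  | cons i l ih => simp [indexPerm, ih, mul_assoc]

theorem indexPerm_apply_of_lt {n : ℕ} (l : List (Fin n)) {x : ℕ} (hx : n < x) :
    indexPerm l x = x := by
  induction l with
  | nil => rfl
  | cons i l ih =>
    rw [indexPerm, Equiv.Perm.mul_apply, Equiv.swap_apply_of_ne_of_ne (by omega) (by omega), ih]

theorem BraidWord.toGroup_append {n : ℕ} (w w' : BraidWord n) :
    BraidWord.toGroup (w ++ w') = w.toGroup * w'.toGroup := by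
  simp [BraidWord.toGroup]

/-- The generators of the braid group, indexed by natural numbers. -/
noncomputable def generator (n j : ℕ) : BraidGroup n :=
  if h : j < n then PresentedGroup.of ⟨j, h⟩ else 1

theorem generator_braidRelations (n : ℕ) : BraidRelations n (generator n) where
  comm i j hij hj := by
    have hi : i < n := by omega
    have : PresentedGroup.mk (braidRels n) (FreeGroup.of ⟨i, hi⟩ * FreeGroup.of ⟨j, hj⟩ *
        (FreeGroup.of ⟨j, hj⟩ * FreeGroup.of ⟨i, hi⟩)⁻¹) = 1 :=
      PresentedGroup.one_of_mem (Or.inl ⟨⟨i, hi⟩, ⟨j, hj⟩, hij, rfl⟩)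
    rw [map_mul, map_inv, mul_inv_eq_one, map_mul, map_mul] at this
    simp only [generator, hi, hj, dif_pos]
    exact this
  braid i hi1 := by
    have hi : i < n := by omega
    have : PresentedGroup.mk (braidRels n) (FreeGroup.of ⟨i, hi⟩ * FreeGroup.of ⟨i + 1, hi1⟩ *
        FreeGroup.of ⟨i, hi⟩ * (FreeGroup.of ⟨i + 1, hi1⟩ * FreeGroup.of ⟨i, hi⟩ *
          FreeGroup.of ⟨i + 1, hi1⟩)⁻¹) = 1 :=
      PresentedGroup.one_of_mem (Or.inr ⟨⟨i, hi⟩, ⟨i + 1, hi1⟩, rfl, rfl⟩)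
    rw [map_mul, map_inv, mul_inv_eq_one] at this
    simp only [map_mul] at this
    simp only [generator, hi, hi1, dif_pos]
    exact this

/-- The automorphism of the braid group that changes the signs of all crossings. -/
noncomputable def mirror (n : ℕ) : BraidGroup n →* BraidGroup n :=
  PresentedGroup.toGroup (f := fun i : Fin n => (PresentedGroup.of i : BraidGroup n)⁻¹) (by
    have hg := generator_braidRelations n
    rintro r (⟨i, j, hij, rfl⟩ | ⟨i, j, hij, rfl⟩)
    · have h := hg.comm i j hij j.2
      simp only [generator, i.2, j.2, dif_pos, Fin.eta] at h
      simp only [map_mul, map_inv, FreeGroup.lift_apply_of, mul_inv_eq_one]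
      rw [← mul_inv_rev, ← mul_inv_rev, h]
    · have hi1 : (i : ℕ) + 1 < n := hij ▸ j.2
      have hj : j = ⟨(i : ℕ) + 1, hi1⟩ := Fin.ext hij.symm
      have h := hg.braid i hi1
      simp only [generator, i.2, hi1, dif_pos, Fin.eta, ← hj] at h
      simp only [map_mul, map_inv, FreeGroup.lift_apply_of, mul_inv_eq_one]
      rw [← mul_inv_rev, ← mul_inv_rev, ← mul_inv_rev, ← mul_inv_rev, ← mul_assoc, ← mul_assoc, h])

theorem mirror_of {n : ℕ} (i : Fin n) :
    mirror n (PresentedGroup.of i) = (PresentedGroup.of i : BraidGroup n)⁻¹ :=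
  PresentedGroup.toGroup.of _

theorem mirror_toGroup {n : ℕ} (w : BraidWord n) :
    mirror n w.toGroup = BraidWord.toGroup (w.map fun a => (a.1, -a.2)) := by
  simp only [BraidWord.toGroup, map_list_prod, List.map_map]
  congr 2
  funext a
  simp [mirror_of]

/-- Append the crossings one by one; each sign is dictated by the section, so the resulting braid
depends only on the permutation of the sequence. -/
theorem exists_signs_section (n : ℕ) : ∃ T : Equiv.Perm ℕ → BraidGroup n,
    ∀ l : List (Fin n), ∃ w : BraidWord n, w.map Prod.fst = l ∧ w.toGroup = T (indexPerm l) := by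
  obtain ⟨T, hT1, hT⟩ := exists_perm_section (generator_braidRelations n) n le_rfl
  refine ⟨T, fun l => ?_⟩
  induction l using List.reverseRecOn with
  | nil => exact ⟨[], rfl, by simp [BraidWord.toGroup, indexPerm, hT1]⟩
  | append_singleton l i ih =>
    obtain ⟨w, rfl, hw⟩ := ih
    obtain ⟨ε, hε⟩ := hT (indexPerm (w.map Prod.fst)) (fun x hx => indexPerm_apply_of_lt _ hx) i i.2
    refine ⟨w ++ [(i, ε)], by simp, ?_⟩
    have h1 : indexPerm [i] = Equiv.swap (i : ℕ) (i + 1) := by simp [indexPerm]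
    rw [indexPerm_append, h1, hε, BraidWord.toGroup_append, hw]
    simp [BraidWord.toGroup, generator]

/-- A sequence of crossings whose permutation is a simple transposition can be given signs such that
it becomes isotopic to a given single crossing. -/
theorem exists_signs_of_indexPerm_eq_swap {n : ℕ} (l : List (Fin n)) (a : Fin n × ℤˣ)
    (h : indexPerm l = Equiv.swap (a.1 : ℕ) (a.1 + 1)) :
    ∃ w : BraidWord n, w.map Prod.fst = l ∧ w.toGroup = BraidWord.toGroup [a] := by
  obtain ⟨T, hT⟩ := exists_signs_section n
  obtain ⟨w, hwl, hw⟩ := hT l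
  obtain ⟨w', hwl', hw'⟩ := hT [a.1]
  have h1 : indexPerm [a.1] = Equiv.swap (a.1 : ℕ) (a.1 + 1) := by simp [indexPerm]
  rw [h1, ← h, ← hw] at hw'
  obtain ⟨b, rfl⟩ : ∃ b, w' = [b] := by
    rw [List.map_eq_singleton_iff] at hwl'
    obtain ⟨b, hb, _⟩ := hwl'
    exact ⟨b, hb⟩
  obtain ⟨i, ε⟩ := a
  obtain ⟨j, ε'⟩ := b
  obtain rfl : j = i := by simpa using hwl'
  by_cases hε : ε' = ε
  · exact ⟨w, hwl, by rw [← hw', hε]⟩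
  -- If the section takes the opposite sign on this transposition, mirroring both words repairs it
  -- and leaves the indices unchanged.
  · refine ⟨w.map fun a => (a.1, -a.2), by simpa [Function.comp_def] using hwl, ?_⟩
    have : ε = -ε' := by
      rcases Int.units_eq_one_or ε with rfl | rfl <;>
        rcases Int.units_eq_one_or ε' with rfl | rfl <;> simp_all
    rw [← mirror_toGroup, ← hw', mirror_toGroup, this]; rfl

/-! ### Families of trigonometric polynomials -/

theorem RealTrigDegLE.add {d : ℕ} {F G : ℝ → ℝ} (hF : RealTrigDegLE d F) (hG : RealTrigDegLE d G) :
    RealTrigDegLE d fun t => F t + G t := by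
  obtain ⟨a, b, h⟩ := hF
  obtain ⟨a', b', h'⟩ := hG
  refine ⟨a + a', b + b', fun t => ?_⟩
  change F t + G t = _
  rw [h, h', ← Finset.sum_add_distrib]
  exact Finset.sum_congr rfl fun k _ => by simp only [Pi.add_apply]; ring

theorem RealTrigDegLE.translate {d : ℕ} {F : ℝ → ℝ} (hF : RealTrigDegLE d F) (x : ℝ) :
    RealTrigDegLE d fun t => F (t + x) := by
  obtain ⟨a, b, h⟩ := hF
  refine ⟨fun k => a k * Real.cos (k * x) + b k * Real.sin (k * x),
    fun k => b k * Real.cos (k * x) - a k * Real.sin (k * x), fun t => ?_⟩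
  change F (t + x) = _
  rw [h]
  refine Finset.sum_congr rfl fun k _ => ?_
  rw [mul_add, Real.cos_add, Real.sin_add]; ring

theorem RealTrigDegLE.const (d : ℕ) (c : ℝ) : RealTrigDegLE d fun _ => c :=
  ⟨Pi.single 0 c, 0, fun t => by
    rw [Finset.sum_eq_single 0]
    · simp
    · intro k _ hk; simp [hk]
    · simp⟩

theorem RealTrigDegLE.cos_sub {d : ℕ} (hd : 1 ≤ d) (c φ : ℝ) :
    RealTrigDegLE d fun θ => c * Real.cos (θ - φ) :=
  ⟨Pi.single 1 (c * Real.cos φ), Pi.single 1 (c * Real.sin φ), fun t => by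
    rw [Finset.sum_eq_single 1]
    · simp [Real.cos_sub]; ring
    · intro k _ hk; simp [hk]
    · intro h; simp at h; omega⟩

/-! ### Strands of the closed braid and their monodromy -/

section
variable {n : ℕ} {B : BraidWord n}

theorem strandCount_pos (C : Component B) : 0 < strandCount C :=
  Nat.card_pos_iff.mpr ⟨⟨⟨C.out, Quotient.out_eq C⟩⟩, inferInstance⟩

/-- The iterates of a representative list the cycle without repetition up to its period. This makes
the numbering `(C, j)` of the strands a bijection with the positions. -/
theorem strandCount_eq_minimalPeriod (C : Component B) :
    strandCount C = Function.minimalPeriod B.perm C.out := by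
  have hper : C.out ∈ Function.periodicPts B.perm :=
    Function.mem_periodicPts.mpr ⟨orderOf B.perm, orderOf_pos _, by
      rw [Function.IsPeriodicPt, Function.IsFixedPt, ← Equiv.Perm.coe_pow, pow_orderOf_eq_one]; rfl⟩
  let f : Fin (Function.minimalPeriod B.perm C.out) → {p // (Quotient.mk _ p : Component B) = C} :=
    fun j => ⟨(B.perm ^ (j : ℕ)) C.out, by
      conv_rhs => rw [← Quotient.out_eq C]
      exact Quotient.sound (Equiv.Perm.SameCycle.symm ⟨j, by simp⟩)⟩
  have hf : Function.Bijective f := by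
    constructor
    · intro i j h
      have h1 : (B.perm ^ (i : ℕ)) C.out = (B.perm ^ (j : ℕ)) C.out := congrArg Subtype.val h
      rw [Equiv.Perm.coe_pow, Equiv.Perm.coe_pow] at h1
      exact Fin.ext (Function.iterate_injOn_Iio_minimalPeriod i.2 j.2 h1)
    · rintro ⟨p, hp⟩
      have h1 : Equiv.Perm.SameCycle B.perm C.out p := by
        rw [← Quotient.out_eq C] at hp
        exact (Quotient.exact hp).symm
      obtain ⟨i, hi⟩ := h1.exists_nat_pow_eq
      refine ⟨⟨i % Function.minimalPeriod B.perm C.out,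
        Nat.mod_lt _ (Function.minimalPeriod_pos_of_mem_periodicPts hper)⟩, Subtype.ext ?_⟩
      simp only [f]
      rw [Equiv.Perm.coe_pow, Function.iterate_mod_minimalPeriod_eq, ← Equiv.Perm.coe_pow, hi]
  rw [strandCount, ← Nat.card_congr (Equiv.ofBijective f hf), Nat.card_eq_fintype_card,
    Fintype.card_fin]

/-- The position of a strand at height `0`. -/
noncomputable def startPosition (a : Strand B) : Fin (n + 1) := (B.perm ^ (a.2 : ℕ)) a.1.out

theorem startPosition_mk (a : Strand B) : (Quotient.mk _ (startPosition a) : Component B) = a.1 := by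
  conv_rhs => rw [← Quotient.out_eq a.1]
  exact Quotient.sound (Equiv.Perm.SameCycle.symm ⟨(a.2 : ℕ), by simp [startPosition]⟩)

theorem startPosition_injective : Function.Injective (startPosition (B := B)) := by
  rintro ⟨C, i⟩ ⟨D, j⟩ h
  obtain rfl : C = D := by
    have h1 := startPosition_mk ⟨C, i⟩
    rw [h] at h1
    exact h1.symm.trans (startPosition_mk ⟨D, j⟩)
  have h1 : (B.perm ^ (i : ℕ)) C.out = (B.perm ^ (j : ℕ)) C.out := h
  rw [Equiv.Perm.coe_pow, Equiv.Perm.coe_pow] at h1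
  have hi := i.2.trans_eq (strandCount_eq_minimalPeriod C)
  have hj := j.2.trans_eq (strandCount_eq_minimalPeriod C)
  have := Function.iterate_injOn_Iio_minimalPeriod hi hj h1
  rw [Fin.ext this]

theorem startPosition_surjective : Function.Surjective (startPosition (B := B)) := by
  intro p
  set C : Component B := Quotient.mk _ p with hC
  have h1 : Equiv.Perm.SameCycle B.perm C.out p := Quotient.exact (Quotient.out_eq C)
  obtain ⟨i, hi⟩ := h1.exists_nat_pow_eq
  refine ⟨⟨C, ⟨i % strandCount C, Nat.mod_lt _ (strandCount_pos C)⟩⟩, ?_⟩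
  simp only [startPosition]
  rw [Equiv.Perm.coe_pow, strandCount_eq_minimalPeriod, Function.iterate_mod_minimalPeriod_eq,
    ← Equiv.Perm.coe_pow, hi]

variable (B) in
/-- The strands correspond to the positions at height `0`. -/
noncomputable def strandEquiv : Strand B ≃ Fin (n + 1) :=
  Equiv.ofBijective startPosition ⟨startPosition_injective, startPosition_surjective⟩

theorem card_strand : Fintype.card (Strand B) = n + 1 := by
  rw [Fintype.card_congr (strandEquiv B), Fintype.card_fin]

theorem finRotate_mk_of_lt {s j : ℕ} (hj : j + 1 < s) :
    finRotate s ⟨j, by omega⟩ = ⟨j + 1, hj⟩ := by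
  obtain ⟨s, rfl⟩ : ∃ s', s = s' + 1 := ⟨s - 1, by omega⟩
  exact finRotate_of_lt (by omega)

theorem finRotate_mk_of_eq {s j : ℕ} (hj : j + 1 = s) :
    finRotate s ⟨j, by omega⟩ = ⟨0, by omega⟩ := by
  subst hj
  exact finRotate_last'

variable (B) in
/-- The strand that continues a given strand after one period. -/
noncomputable def strandShift : Equiv.Perm (Strand B) :=
  Equiv.sigmaCongrRight fun C => finRotate (strandCount C)

theorem strandShift_of_lt {C : Component B} {j : ℕ} (hj : j + 1 < strandCount C) :
    strandShift B ⟨C, ⟨j, by omega⟩⟩ = ⟨C, ⟨j + 1, hj⟩⟩ := by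
  simp only [strandShift, Equiv.sigmaCongrRight_apply, finRotate_mk_of_lt hj]

theorem strandShift_of_eq {C : Component B} {j : ℕ} (hj : j + 1 = strandCount C) :
    strandShift B ⟨C, ⟨j, by omega⟩⟩ = ⟨C, ⟨0, by omega⟩⟩ := by
  simp only [strandShift, Equiv.sigmaCongrRight_apply, finRotate_mk_of_eq hj]

theorem strandShift_fst (a : Strand B) : (strandShift B a).1 = a.1 := rfl

theorem startPosition_strandShift (a : Strand B) :
    startPosition (strandShift B a) = B.perm (startPosition a) := by
  obtain ⟨C, j, hj⟩ := a
  rcases Nat.lt_or_ge (j + 1) (strandCount C) with h | h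
  · rw [strandShift_of_lt h]
    simp [startPosition, pow_succ']
  · have h' : j + 1 = strandCount C := by omega
    rw [strandShift_of_eq h']
    simp only [startPosition, pow_zero, Equiv.Perm.coe_one, id]
    rw [← Equiv.Perm.mul_apply, ← pow_succ', h', strandCount_eq_minimalPeriod, Equiv.Perm.coe_pow,
      Function.iterate_minimalPeriod]

/-- Advancing the height by `2π` raises the index `j` by one inside the argument of `F_C`; only the
wrap-around from `s_C - 1` to `0` needs the period of `F_C`. -/
theorem strand_add_two_pi {F : Component B → ℝ → ℝ} (hF : ∀ C θ, F C (θ + 2 * Real.pi) = F C θ)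
    (a : Strand B) (t : ℝ) : strand F a (t + 2 * Real.pi) = strand F (strandShift B a) t := by
  obtain ⟨C, j, hj⟩ := a
  have hpos : (strandCount C : ℝ) ≠ 0 := by exact_mod_cast (strandCount_pos C).ne'
  rcases Nat.lt_or_ge (j + 1) (strandCount C) with h | h
  · rw [strandShift_of_lt h]
    simp only [strand]
    congr 2; push_cast; ring
  · have h' : j + 1 = strandCount C := by omega
    rw [strandShift_of_eq h']
    simp only [strand]
    symm
    rw [← hF]
    congr 1
    have : (strandCount C : ℝ) = j + 1 := by exact_mod_cast h'.symm
    rw [this] at hpos ⊢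
    field_simp; push_cast; ring

theorem strand_add_nat_mul_two_pi {F : Component B → ℝ → ℝ}
    (hF : ∀ C θ, F C (θ + 2 * Real.pi) = F C θ) (a : Strand B) (t : ℝ) (m : ℕ) :
    strand F a (t + m * (2 * Real.pi)) = strand F ((strandShift B ^ m) a) t := by
  induction m generalizing a with
  | zero => simp
  | succ m ih =>
    have : t + ((m + 1 : ℕ) : ℝ) * (2 * Real.pi) = t + m * (2 * Real.pi) + 2 * Real.pi := by
      push_cast; ring
    rw [this, strand_add_two_pi hF, ih, pow_succ, Equiv.Perm.mul_apply]

/-! ### Ranks -/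

theorem rank_eq_card_filter (F : Component B → ℝ → ℝ) (a : Strand B) (t : ℝ) :
    rank F a t = (Finset.univ.filter fun c => strand F c t < strand F a t).card := by
  rw [rank, Nat.card_eq_fintype_card, Fintype.card_subtype]

theorem rank_lt_rank_iff (F : Component B → ℝ → ℝ) (a b : Strand B) (t : ℝ) :
    rank F a t < rank F b t ↔ strand F a t < strand F b t := by
  rw [rank_eq_card_filter, rank_eq_card_filter]
  constructor
  · intro h
    by_contra hc
    push Not at hc
    refine absurd h (not_lt.mpr (Finset.card_le_card fun c hc' => ?_))
    rw [Finset.mem_filter] at hc' ⊢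
    exact ⟨hc'.1, hc'.2.trans_le hc⟩
  · intro h
    refine Finset.card_lt_card (Finset.ssubset_iff_subset_ne.mpr ⟨fun c hc => ?_, fun he => ?_⟩)
    · rw [Finset.mem_filter] at hc ⊢
      exact ⟨hc.1, hc.2.trans h⟩
    · have : a ∈ Finset.univ.filter fun c => strand F c t < strand F b t := by simpa
      rw [← he] at this
      simp at this

theorem rank_eq_rank_iff (F : Component B → ℝ → ℝ) (a b : Strand B) (t : ℝ) :
    rank F a t = rank F b t ↔ strand F a t = strand F b t := by
  have h1 := rank_lt_rank_iff F a b t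
  have h2 := rank_lt_rank_iff F b a t
  constructor
  · intro h
    rw [h] at h1 h2
    exact le_antisymm (not_lt.mp fun h' => absurd (h2.mpr h') (lt_irrefl _))
      (not_lt.mp fun h' => absurd (h1.mpr h') (lt_irrefl _))
  · intro h
    rw [h] at h1 h2
    have := h1.not.mpr (lt_irrefl _)
    have := h2.not.mpr (lt_irrefl _)
    omega

theorem rank_lt (F : Component B → ℝ → ℝ) (a : Strand B) (t : ℝ) : rank F a t < n + 1 := by
  rw [rank_eq_card_filter, ← card_strand (B := B), ← Finset.card_univ]
  refine Finset.card_lt_card (Finset.ssubset_iff_subset_ne.mpr ⟨Finset.subset_univ _, fun he => ?_⟩)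
  have : a ∈ Finset.univ.filter fun c => strand F c t < strand F a t := by rw [he]; simp
  simp at this

theorem rank_eq_of_strictMono {F : Component B → ℝ → ℝ} {t : ℝ} {x : Fin (n + 1) → ℝ}
    (hx : StrictMono x) (e : Strand B ≃ Fin (n + 1)) (h : ∀ a, strand F a t = x (e a))
    (a : Strand B) : rank F a t = e a := by
  simp only [rank, h, hx.lt_iff_lt]
  rw [Nat.card_congr (e.subtypeEquiv (q := fun q => q < e a) fun c => Iff.rfl),
    Nat.card_eq_fintype_card, Fintype.card_subtype]
  simp [Finset.filter_gt_eq_Iio]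

/-! ### The interpolation step -/

/-- The nodes `(τ_k + 2πj)/s_C` are distinct points of one period because `0 ≤ τ_k < 2π`, so the
`s_C ℓ` data can be interpolated. The abscissae are taken to be `0, 1, …, n`. -/
theorem exists_stepOne (B : BraidWord n) (τ : Fin (B.length + 1) → ℝ) (hτ : IsSubdivision B τ) :
    ∃ F, StepOne B τ F := by
  obtain ⟨hmono, h0, hlast⟩ := hτ
  have hpi := Real.pi_pos
  have key : ∀ C : Component B, ∃ G : ℝ → ℝ, RealTrigDegLE (strandCount C * B.length / 2) G ∧
      ∀ p : Fin (strandCount C) × Fin B.length,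
        G ((τ p.2.castSucc + 2 * Real.pi * (p.1 : ℕ)) / strandCount C) =
          (BraidWord.perm (B.take p.2) ((B.perm ^ (p.1 : ℕ)) C.out) : ℕ) := by
    intro C
    have hs : (0 : ℝ) < strandCount C := by exact_mod_cast strandCount_pos C
    have hτ0 : ∀ k : Fin B.length, 0 ≤ τ k.castSucc := fun k => by
      rw [← h0]; exact hmono.monotone (Fin.zero_le _)
    have hτ1 : ∀ k : Fin B.length, τ k.castSucc < 2 * Real.pi := fun k => by
      rw [← hlast]; exact hmono (Fin.castSucc_lt_last k)
    have := exists_realTrigDegLE_interpolate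
      (fun p : Fin (strandCount C) × Fin B.length =>
        (τ p.2.castSucc + 2 * Real.pi * (p.1 : ℕ)) / strandCount C)
      (fun p => (BraidWord.perm (B.take p.2) ((B.perm ^ (p.1 : ℕ)) C.out) : ℕ)) ?_ ?_
    · simpa only [Fintype.card_prod, Fintype.card_fin] using this
    · rintro ⟨j, k⟩ ⟨j', k'⟩ h
      simp only at h
      rw [div_left_inj' hs.ne'] at h
      have hj : (j : ℕ) = j' := by
        have a1 := hτ0 k; have a2 := hτ1 k; have a3 := hτ0 k'; have a4 := hτ1 k'
        rcases lt_trichotomy (j : ℕ) j' with hlt | heq | hlt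
        · have : ((j : ℕ) : ℝ) + 1 ≤ (j' : ℕ) := by exact_mod_cast hlt
          nlinarith
        · exact heq
        · have : ((j' : ℕ) : ℝ) + 1 ≤ (j : ℕ) := by exact_mod_cast hlt
          nlinarith
      rw [hj] at h
      have hk := Fin.castSucc_injective _ (hmono.injective (add_right_cancel h))
      rw [hk, Fin.ext hj]
    · rintro ⟨j, k⟩
      have a1 := hτ0 k; have a2 := hτ1 k
      refine ⟨by positivity, ?_⟩
      rw [div_lt_iff₀ hs]
      have : ((j : ℕ) : ℝ) + 1 ≤ strandCount C := by exact_mod_cast j.2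
      simp only
      nlinarith
  choose G hG hG' using key
  refine ⟨G, fun p => ((p : ℕ) : ℝ), fun p q h => Nat.cast_lt.mpr h, fun C => ⟨hG C, fun j k => ?_⟩⟩
  exact hG' C (j, k)

theorem perm_take_succ (B : BraidWord n) (k : Fin B.length) :
    BraidWord.perm (B.take (k + 1)) =
      Equiv.swap (B.get k).1.castSucc (B.get k).1.succ * BraidWord.perm (B.take k) := by
  rw [BraidWord.perm, List.take_add_one, List.foldl_append]
  simp [BraidWord.perm]

/-- The data omit the last height `2π`. There the strand agrees with its successor at height `0`,
whose starting position is the end position of the strand under `B.perm`. -/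
theorem StepOne.strand_eq {τ : Fin (B.length + 1) → ℝ} (hτ : IsSubdivision B τ)
    {F : Component B → ℝ → ℝ} {x : Fin (n + 1) → ℝ}
    (hF : ∀ C : Component B, RealTrigDegLE (strandCount C * B.length / 2) (F C) ∧
      ∀ (j : Fin (strandCount C)) (k : Fin B.length), strand F ⟨C, j⟩ (τ k.castSucc) =
        x (BraidWord.perm (B.take k) ((B.perm ^ (j : ℕ)) C.out)))
    (hB : 1 ≤ B.length) (k : Fin (B.length + 1)) (a : Strand B) :
    strand F a (τ k) = x (BraidWord.perm (B.take k) (startPosition a)) := by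
  induction k using Fin.lastCases with
  | cast k => exact (hF a.1).2 a.2 k
  | last =>
    rw [hτ.2.2, ← zero_add (2 * Real.pi), strand_add_two_pi (fun C θ => (hF C).1.periodic θ)]
    have h := (hF a.1).2 (strandShift B a).2 ⟨0, hB⟩
    have h0 : (⟨0, hB⟩ : Fin B.length).castSucc = 0 := rfl
    rw [h0, hτ.2.1] at h
    have h1 := startPosition_strandShift a
    rw [startPosition] at h1
    change strand F (strandShift B a) 0 = _ at h
    rw [h]
    simp only [Fin.val_last, List.take_length]
    rw [← h1]
    simp [BraidWord.perm, strandShift_fst]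

theorem val_swap_castSucc_succ (i : Fin n) (p : Fin (n + 1)) :
    ((Equiv.swap i.castSucc i.succ p : Fin (n + 1)) : ℕ) = Equiv.swap (i : ℕ) (i + 1) p := by
  simp only [Equiv.swap_apply_def, Fin.ext_iff, Fin.val_castSucc, Fin.val_succ]
  split_ifs <;> simp

theorem StepOne.realizesPermutations {τ : Fin (B.length + 1) → ℝ} (hτ : IsSubdivision B τ)
    {F : Component B → ℝ → ℝ} (hF : StepOne B τ F) (hB : 1 ≤ B.length) :
    RealizesPermutations B τ F := by
  obtain ⟨x, hx, hF⟩ := hF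
  have h := StepOne.strand_eq hτ hF hB
  have hr : ∀ k a, rank F a (τ k) = BraidWord.perm (B.take k) (startPosition a) := fun k a =>
    rank_eq_of_strictMono hx ((strandEquiv B).trans (BraidWord.perm (B.take k))) (h k) a
  refine ⟨fun j a b hab he => hab ?_, fun j a => ?_⟩
  · rw [h, h] at he
    exact startPosition_injective ((BraidWord.perm _).injective (hx.injective he))
  · rw [hr, hr, Fin.val_succ, perm_take_succ, Equiv.Perm.mul_apply, val_swap_castSucc_succ]
    rfl

end

/-! ### Real analytic functions on a compact interval -/

theorem finite_zeros_of_analytic {h : ℝ → ℝ} (hh : ∀ t, AnalyticAt ℝ h t) {t₀ : ℝ} (h₀ : h t₀ ≠ 0)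
    {K : Set ℝ} (hK : IsCompact K) : {t | t ∈ K ∧ h t = 0}.Finite := by
  by_contra hinf
  obtain ⟨x, _, hx⟩ :=
    Set.Infinite.exists_accPt_of_subset_isCompact hinf hK fun t ht => ht.1
  have hfr : ∃ᶠ z in 𝓝[≠] x, h z = 0 :=
    (accPt_iff_frequently_nhdsNE.mp hx).mono fun z hz => hz.2
  have := AnalyticOnNhd.eqOn_zero_of_preconnected_of_frequently_eq_zero (f := h)
    (fun t _ => hh t) isPreconnected_univ (Set.mem_univ x) hfr
  exact h₀ (this (Set.mem_univ t₀))

/-- Near `t` the quotient `H/α` has derivative zero and vanishes at `t`, so `H` vanishes locally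
and, being analytic, everywhere. -/
theorem eq_zero_of_wronskian {H α : ℝ → ℝ} (hH : ∀ t, AnalyticAt ℝ H t)
    (hα : ∀ t, AnalyticAt ℝ α t) (hW : ∀ t, deriv H t * α t - H t * deriv α t = 0) {t : ℝ}
    (ht : H t = 0) (hαt : α t ≠ 0) (x : ℝ) : H x = 0 := by
  obtain ⟨δ, hδ, hball⟩ := Metric.eventually_nhds_iff_ball.mp
    ((hα t).continuousAt.eventually_ne hαt)
  have hdiff : ∀ y ∈ Metric.ball t δ, HasDerivAt (fun y => H y / α y) 0 y := by
    intro y hy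
    have h := (hH y).differentiableAt.hasDerivAt.div (hα y).differentiableAt.hasDerivAt
      (hball y hy)
    rwa [hW, zero_div] at h
  have hconst : ∀ y ∈ Metric.ball t δ, H y = 0 := by
    intro y hy
    have h := (convex_ball t δ).is_const_of_fderivWithin_eq_zero (𝕜 := ℝ)
      (f := fun y => H y / α y)
      (fun z hz => (hdiff z hz).differentiableAt.differentiableWithinAt) (fun z hz => by
        rw [fderivWithin_of_isOpen Metric.isOpen_ball hz]
        ext; simp [(hdiff z hz).deriv]) hy (Metric.mem_ball_self hδ)
    simp only [ht, zero_div] at h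
    exact (div_eq_zero_iff.mp h).resolve_right (hball y hy)
  have hev : H =ᶠ[𝓝 t] 0 := Filter.eventually_of_mem (Metric.ball_mem_nhds t hδ) hconst
  exact AnalyticOnNhd.eqOn_zero_of_preconnected_of_eventuallyEq_zero (f := H)
    (fun t _ => hH t) isPreconnected_univ (Set.mem_univ t) hev (Set.mem_univ x)

/-- At a double zero the Wronskian of `G` and `α` vanishes and `ε = -G/α` is determined by the
height. If the Wronskian is not identically zero, there are finitely many heights. If it is, a bad
`ε` makes `G + εα` identically zero, and there is at most one such `ε`. -/
theorem finite_setOf_double_zero {G α : ℝ → ℝ} (hG : ∀ t, AnalyticAt ℝ G t)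
    (hα : ∀ t, AnalyticAt ℝ α t) {K : Set ℝ} (hK : IsCompact K)
    (h : ∀ t ∈ K, G t = 0 → α t ≠ 0) :
    {ε : ℝ | ∃ t ∈ K, G t + ε * α t = 0 ∧ deriv G t + ε * deriv α t = 0}.Finite := by
  have hne : ∀ ε : ℝ, ∀ t ∈ K, G t + ε * α t = 0 → α t ≠ 0 := by
    intro ε t ht h1 h2
    rw [h2, mul_zero, add_zero] at h1
    exact h t ht h1 h2
  by_cases hW : ∀ t, deriv G t * α t - G t * deriv α t = 0
  · refine Set.Subsingleton.finite ?_
    have key : ∀ ε : ℝ, (∃ t ∈ K, G t + ε * α t = 0 ∧ deriv G t + ε * deriv α t = 0) →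
        ∀ x, G x + ε * α x = 0 := by
      rintro ε ⟨t, ht, h1, -⟩
      refine eq_zero_of_wronskian (H := fun x => G x + ε * α x)
        (fun x => (hG x).add (analyticAt_const.mul (hα x))) hα (fun x => ?_) h1 (hne ε t ht h1)
      have hd : deriv (fun x => G x + ε * α x) x = deriv G x + ε * deriv α x :=
        ((hG x).differentiableAt.hasDerivAt.add
          ((hα x).differentiableAt.hasDerivAt.const_mul ε)).deriv
      rw [hd]
      linear_combination hW x
    rintro ε hε ε' hε'
    obtain ⟨t, ht, h1, -⟩ := id hε
    have h2 := key ε' hε' t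
    exact mul_right_cancel₀ (hne ε t ht h1) (by linarith)
  · push Not at hW
    obtain ⟨t₀, ht₀⟩ := hW
    have hfin := finite_zeros_of_analytic (h := fun t => deriv G t * α t - G t * deriv α t)
      (fun t => ((hG t).deriv.mul (hα t)).sub ((hG t).mul (hα t).deriv)) ht₀ hK
    refine (hfin.image fun t => -G t / α t).subset ?_
    rintro ε ⟨t, ht, h1, h2⟩
    have hα0 := hne ε t ht h1
    refine ⟨t, ⟨ht, ?_⟩, ?_⟩
    · linear_combination h2 * α t - h1 * deriv α t
    · field_simp; linarith

/-- Eliminating `ε` shows that a common zero is a zero of `G α' - G' α`, and `ε = -G/α` there. -/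
theorem finite_setOf_common_zero {G α G' α' : ℝ → ℝ} (hG : ∀ t, AnalyticAt ℝ G t)
    (hα : ∀ t, AnalyticAt ℝ α t) (hG' : ∀ t, AnalyticAt ℝ G' t) (hα' : ∀ t, AnalyticAt ℝ α' t)
    {K : Set ℝ} (hK : IsCompact K) (h : ∀ t ∈ K, G t = 0 → α t ≠ 0) {t₀ : ℝ}
    (h₀ : G t₀ * α' t₀ - G' t₀ * α t₀ ≠ 0) :
    {ε : ℝ | ∃ t ∈ K, G t + ε * α t = 0 ∧ G' t + ε * α' t = 0}.Finite := by
  have hfin := finite_zeros_of_analytic (h := fun t => G t * α' t - G' t * α t)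
    (fun t => ((hG t).mul (hα' t)).sub ((hG' t).mul (hα t))) h₀ hK
  refine (hfin.image fun t => -G t / α t).subset ?_
  rintro ε ⟨t, ht, h1, h2⟩
  have hα0 : α t ≠ 0 := by
    intro h3
    rw [h3, mul_zero, add_zero] at h1
    exact h t ht h1 h3
  refine ⟨t, ⟨ht, ?_⟩, ?_⟩
  · linear_combination h1 * α' t - h2 * α t
  · field_simp; linarith

/-! ### The generic perturbation -/

section
variable {n : ℕ} {B : BraidWord n}

theorem strand_analyticAt {F : Component B → ℝ → ℝ} (hF : ∀ C t, AnalyticAt ℝ (F C) t)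
    (a : Strand B) (t : ℝ) : AnalyticAt ℝ (strand F a) t := by
  have h : AnalyticAt ℝ (fun t : ℝ => (t + 2 * Real.pi * (a.2 : ℕ)) / strandCount a.1) t := by
    fun_prop
  exact (hF a.1 _).fun_comp h

variable (B) in
/-- The parameters of the perturbation: the constant terms and the coefficients of the cosine and
the sine for every component. -/
abbrev PerturbationSpace : Type :=
  (Component B → ℝ) × (Component B → ℝ) × (Component B → ℝ)

/-- The trigonometric polynomials of degree at most `1` that are added to the functions `F_C`. -/
noncomputable def perturbation (v : PerturbationSpace B) (C : Component B) (θ : ℝ) : ℝ :=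
  v.1 C + if strandCount C = 1 then 0 else v.2.1 C * Real.cos θ + v.2.2 C * Real.sin θ

theorem perturbation_analyticAt (v : PerturbationSpace B) (C : Component B) (t : ℝ) :
    AnalyticAt ℝ (perturbation v C) t := by
  unfold perturbation
  split_ifs
  · exact analyticAt_const.add analyticAt_const
  · exact analyticAt_const.add ((analyticAt_const.mul Real.analyticAt_cos).add
      (analyticAt_const.mul Real.analyticAt_sin))

/-- The difference of the perturbations of two strands at a fixed height, as a linear functional. -/
noncomputable def perturbationDiff (a b : Strand B) (t : ℝ) :
    Module.Dual ℝ (PerturbationSpace B) where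
  toFun v := strand (perturbation v) a t - strand (perturbation v) b t
  map_add' v w := by simp only [strand, perturbation, Prod.fst_add, Prod.snd_add, Pi.add_apply]
                     split_ifs <;> ring
  map_smul' c v := by
    simp only [strand, perturbation, Prod.smul_fst, Prod.smul_snd, Pi.smul_apply, smul_eq_mul,
      RingHom.id_apply]
    split_ifs <;> ring

/-- The argument of the function `F_C` that belongs to a strand. -/
noncomputable def angle (a : Strand B) (t : ℝ) : ℝ :=
  (t + 2 * Real.pi * (a.2 : ℕ)) / strandCount a.1

/-- The angles of one component at a fixed height are equally spaced by `2π/s_C` on the circle.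
Hence the first harmonic separates strands of the same component. -/
theorem angle_inj {C : Component B} {i j : Fin (strandCount C)} {t : ℝ}
    (hc : Real.cos (angle ⟨C, i⟩ t) = Real.cos (angle ⟨C, j⟩ t))
    (hs : Real.sin (angle ⟨C, i⟩ t) = Real.sin (angle ⟨C, j⟩ t)) : i = j := by
  have h1 : Real.cos (angle ⟨C, i⟩ t - angle ⟨C, j⟩ t) = 1 := by
    rw [Real.cos_sub, hc, hs, ← sq, ← sq, Real.cos_sq_add_sin_sq]
  obtain ⟨k, hk⟩ := (Real.cos_eq_one_iff _).mp h1
  have hpos : (0 : ℝ) < strandCount C := by exact_mod_cast strandCount_pos C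
  have h2 : (k : ℝ) * strandCount C = (i : ℕ) - (j : ℕ) := by
    simp only [angle] at hk
    field_simp at hk
    have := Real.pi_pos
    have h3 : 2 * Real.pi * ((k : ℝ) * strandCount C) = 2 * Real.pi * ((i : ℕ) - (j : ℕ)) := by
      linarith
    exact mul_left_cancel₀ (by positivity) h3
  have h4 : k * (strandCount C : ℤ) = (i : ℕ) - (j : ℕ) := by exact_mod_cast h2
  have hi := i.2
  have hj := j.2
  have hk0 : k = 0 := by
    by_contra hne
    rcases lt_or_gt_of_ne hne with h | h
    · nlinarith
    · nlinarith
  rw [hk0, zero_mul] at h4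
  exact Fin.ext (by omega)

open Classical in
theorem perturbationDiff_const (a b : Strand B) (t : ℝ) (C : Component B) :
    perturbationDiff a b t (Pi.single C 1, 0, 0) =
      (if a.1 = C then 1 else 0) - (if b.1 = C then 1 else 0) := by
  simp [perturbationDiff, strand, perturbation, Pi.single_apply]

open Classical in
theorem perturbationDiff_cos (a b : Strand B) (t : ℝ) {C : Component B} (hC : strandCount C ≠ 1) :
    perturbationDiff a b t (0, Pi.single C 1, 0) =
      (if a.1 = C then Real.cos (angle a t) else 0) -
        (if b.1 = C then Real.cos (angle b t) else 0) := by
  simp only [perturbationDiff, strand, perturbation, Pi.single_apply, LinearMap.coe_mk,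
    AddHom.coe_mk, Pi.zero_apply, zero_mul, add_zero, zero_add, angle]
  congr 1
  · by_cases h : a.1 = C
    · simp [h, hC]
    · simp [h]
  · by_cases h : b.1 = C
    · simp [h, hC]
    · simp [h]

open Classical in
theorem perturbationDiff_sin (a b : Strand B) (t : ℝ) {C : Component B} (hC : strandCount C ≠ 1) :
    perturbationDiff a b t (0, 0, Pi.single C 1) =
      (if a.1 = C then Real.sin (angle a t) else 0) -
        (if b.1 = C then Real.sin (angle b t) else 0) := by
  simp only [perturbationDiff, strand, perturbation, Pi.single_apply, LinearMap.coe_mk,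
    AddHom.coe_mk, Pi.zero_apply, zero_mul, zero_add, angle]
  congr 1
  · by_cases h : a.1 = C
    · simp [h, hC]
    · simp [h]
  · by_cases h : b.1 = C
    · simp [h, hC]
    · simp [h]

theorem strandCount_ne_one {C : Component B} {i j : Fin (strandCount C)} (h : i ≠ j) :
    strandCount C ≠ 1 := by
  intro h1
  have hi := i.2
  have hj := j.2
  exact h (Fin.ext (by omega))

/-- A constant separates strands of different components; the cosine and sine together separate
strands of the same one. -/
theorem exists_perturbationDiff_ne_zero {a b : Strand B} (hab : a ≠ b) (t : ℝ) :
    ∃ v, perturbationDiff a b t v ≠ 0 := by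
  classical
  by_contra hc
  push Not at hc
  obtain ⟨C, i⟩ := a
  obtain ⟨D, j⟩ := b
  have h1 := hc (Pi.single C 1, 0, 0)
  rw [perturbationDiff_const] at h1
  obtain rfl : D = C := by
    by_contra h
    simp [h] at h1
  have hij : i ≠ j := fun h => hab (by rw [h])
  have hs := strandCount_ne_one hij
  have h2 := hc (0, Pi.single D 1, 0)
  have h3 := hc (0, 0, Pi.single D 1)
  rw [perturbationDiff_cos _ _ _ hs] at h2
  rw [perturbationDiff_sin _ _ _ hs] at h3
  simp only [if_true] at h2 h3
  exact hij (angle_inj (t := t) (by linarith) (by linarith))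

/-- If the perturbations of two pairs of strands are proportional, then the pairs are equal or all
four strands belong to one component and the perturbations are proportional at all heights. -/
theorem perturbationDiff_proportional {a b c d : Strand B} (hab : a ≠ b) (hcd : c ≠ d) {r : ℝ}
    (hr : r ≠ 0) (h : ∀ v, perturbationDiff c d 0 v = r * perturbationDiff a b 0 v) :
    s(a, b) = s(c, d) ∨ (a.1 = b.1 ∧
      ∀ v t, perturbationDiff c d t v = r * perturbationDiff a b t v) := by
  classical
  obtain ⟨Ca, a⟩ := a
  obtain ⟨Cb, b⟩ := b
  obtain ⟨Cc, c⟩ := c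
  obtain ⟨Cd, d⟩ := d
  have h0 : ∀ C, ((if Cc = C then 1 else 0) - (if Cd = C then 1 else 0) : ℝ) =
      r * ((if Ca = C then 1 else 0) - (if Cb = C then 1 else 0)) := fun C => by
    have := h (Pi.single C 1, 0, 0)
    rwa [perturbationDiff_const, perturbationDiff_const] at this
  have h1 : ∀ C, strandCount C ≠ 1 → ((if Cc = C then Real.cos (angle ⟨Cc, c⟩ 0) else 0) -
      (if Cd = C then Real.cos (angle ⟨Cd, d⟩ 0) else 0) : ℝ) =
      r * ((if Ca = C then Real.cos (angle ⟨Ca, a⟩ 0) else 0) -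
        (if Cb = C then Real.cos (angle ⟨Cb, b⟩ 0) else 0)) := fun C hC => by
    have := h (0, Pi.single C 1, 0)
    rwa [perturbationDiff_cos _ _ _ hC, perturbationDiff_cos _ _ _ hC] at this
  have h2 : ∀ C, strandCount C ≠ 1 → ((if Cc = C then Real.sin (angle ⟨Cc, c⟩ 0) else 0) -
      (if Cd = C then Real.sin (angle ⟨Cd, d⟩ 0) else 0) : ℝ) =
      r * ((if Ca = C then Real.sin (angle ⟨Ca, a⟩ 0) else 0) -
        (if Cb = C then Real.sin (angle ⟨Cb, b⟩ 0) else 0)) := fun C hC => by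
    have := h (0, 0, Pi.single C 1)
    rwa [perturbationDiff_sin _ _ _ hC, perturbationDiff_sin _ _ _ hC] at this
  -- A component with a single strand has no cosine or sine to test with, but there the indices
  -- agree automatically.
  have heq : ∀ (C : Component B) (i j : Fin (strandCount C)), (strandCount C ≠ 1 →
      Real.cos (angle ⟨C, i⟩ 0) = Real.cos (angle ⟨C, j⟩ 0) ∧
      Real.sin (angle ⟨C, i⟩ 0) = Real.sin (angle ⟨C, j⟩ 0)) → i = j := by
    intro C i j hC
    by_contra hne
    obtain ⟨p, q⟩ := hC (strandCount_ne_one hne)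
    exact hne (angle_inj p q)
  -- Within one component the constants cancel, and the addition formulas carry the proportionality
  -- of the first harmonics from height `0` to every height. For different components the constants
  -- force `r = ±1` and the same two components; the first harmonics then identify the strands.
  by_cases hCab : Ca = Cb
  · right
    refine ⟨hCab, ?_⟩
    subst hCab
    have hCcd : Cc = Cd := by
      have := h0 Cc
      by_contra hne
      simp [Ne.symm hne] at this
    subst hCcd
    have hcd' : c ≠ d := fun h => hcd (by rw [h])
    have hsc := strandCount_ne_one hcd'
    have hCac : Ca = Cc := by
      by_contra hne
      have e1 := h1 Cc hsc
      have e2 := h2 Cc hsc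
      simp only [if_true, hne, if_false, sub_self, mul_zero] at e1 e2
      exact hcd' (angle_inj (t := 0) (by linarith) (by linarith))
    subst hCac
    have e1 := h1 Ca hsc
    have e2 := h2 Ca hsc
    simp only [if_true] at e1 e2
    have hang : ∀ (i : Fin (strandCount Ca)) (t : ℝ),
        angle ⟨Ca, i⟩ t = t / strandCount Ca + angle ⟨Ca, i⟩ 0 := by
      intro i t; simp only [angle]; ring
    intro v t
    change (strand _ _ _ - strand _ _ _ : ℝ) = r * (strand _ _ _ - strand _ _ _)
    have hst : ∀ i : Fin (strandCount Ca), strand (perturbation v) ⟨Ca, i⟩ t =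
        v.1 Ca + (v.2.1 Ca * Real.cos (t / strandCount Ca + angle ⟨Ca, i⟩ 0) +
          v.2.2 Ca * Real.sin (t / strandCount Ca + angle ⟨Ca, i⟩ 0)) := by
      intro i
      rw [← hang]
      simp only [strand, perturbation, if_neg hsc, angle]
    simp only [hst, Real.cos_add, Real.sin_add]
    linear_combination
      (v.2.1 Ca * Real.cos (t / strandCount Ca) + v.2.2 Ca * Real.sin (t / strandCount Ca)) * e1 +
      (-v.2.1 Ca * Real.sin (t / strandCount Ca) + v.2.2 Ca * Real.cos (t / strandCount Ca)) * e2
  · left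
    have ha0 := h0 Ca
    have hb0 := h0 Cb
    simp only [if_true, hCab, Ne.symm hCab, if_false] at ha0 hb0
    by_cases hc1 : Cc = Ca
    · subst hc1
      have hd1 : Cd = Cb := by
        by_contra hne
        simp only [hne, hCab, if_false] at hb0
        simp at hb0
        exact hr hb0
      subst hd1
      simp [Ne.symm hCab] at ha0
      subst ha0
      have : c = a := heq _ _ _ fun hs => by
        have e1 := h1 _ hs
        have e2 := h2 _ hs
        simp only [if_true, Ne.symm hCab, if_false, sub_zero, one_mul] at e1 e2
        exact ⟨e1, e2⟩
      have : d = b := heq _ _ _ fun hs => by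
        have e1 := h1 _ hs
        have e2 := h2 _ hs
        simp only [if_true, hCab, if_false, zero_sub, one_mul, neg_inj] at e1 e2
        exact ⟨e1, e2⟩
      subst_vars
      rfl
    · have hd1 : Cd = Ca := by
        by_contra hne
        simp only [hne, hc1, if_false] at ha0
        simp at ha0
        exact hr ha0.symm
      subst hd1
      simp [hc1] at ha0
      subst ha0
      have hc2 : Cc = Cb := by
        by_contra hne
        simp [hne, hCab] at hb0
      subst hc2
      have : c = b := heq _ _ _ fun hs => by
        have e1 := h1 _ hs
        have e2 := h2 _ hs
        simp only [if_true, hCab, if_false, sub_zero, zero_sub, neg_mul_neg, one_mul] at e1 e2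
        exact ⟨e1, e2⟩
      have : d = a := heq _ _ _ fun hs => by
        have e1 := h1 _ hs
        have e2 := h2 _ hs
        simp only [if_true, hc1, if_false, sub_zero, zero_sub, neg_mul, one_mul, neg_inj] at e1 e2
        exact ⟨e1, e2⟩
      subst_vars
      exact Sym2.eq_swap

/-- An adjacent transposition reverses the order of exactly one pair, `{i, i + 1}`. -/
theorem eq_of_swap_changes_order {i x y z w : ℕ} (hxy : x ≠ y) (hzw : z ≠ w)
    (h : z < w ↔ x < y)
    (h' : Equiv.swap i (i + 1) z < Equiv.swap i (i + 1) w ↔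
      Equiv.swap i (i + 1) x < Equiv.swap i (i + 1) y)
    (hflip : ¬(Equiv.swap i (i + 1) x < Equiv.swap i (i + 1) y ↔ x < y)) : x = z ∧ y = w := by
  have key : ∀ x y : ℕ, x ≠ y →
      ¬((Equiv.swap i (i + 1) x < Equiv.swap i (i + 1) y) ↔ x < y) →
      (x = i ∧ y = i + 1) ∨ (x = i + 1 ∧ y = i) := by
    intro x y hxy hh
    simp only [Equiv.swap_apply_def] at hh
    split_ifs at hh <;> omega
  have h1 := key x y hxy hflip
  have h2 := key z w hzw (by rwa [h, h'])
  omega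

/-- Two different pairs that are always ordered alike would have to be reversed by the same letter,
which reverses only one pair; so no letter reverses them. -/
theorem order_eq_of_iff {τ : Fin (B.length + 1) → ℝ} {F : Component B → ℝ → ℝ}
    (hF : RealizesPermutations B τ F) {a b c d : Strand B} (hab : a ≠ b) (hcd : c ≠ d)
    (hne : s(a, b) ≠ s(c, d)) (h : ∀ t, strand F c t < strand F d t ↔ strand F a t < strand F b t)
    (k : Fin (B.length + 1)) :
    strand F a (τ k) < strand F b (τ k) ↔ strand F a (τ 0) < strand F b (τ 0) := by
  induction k using Fin.induction with
  | zero => rfl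
  | succ j ih =>
    rw [← ih]
    obtain ⟨hdisj, hperm⟩ := hF
    have inj : ∀ x y : Strand B, rank F x (τ j.castSucc) = rank F y (τ j.castSucc) → x = y := by
      intro x y hxy
      by_contra hne
      exact hdisj _ _ _ hne ((rank_eq_rank_iff _ _ _ _).mp hxy)
    have h0 := h (τ j.castSucc)
    have h1 := h (τ j.succ)
    by_contra hflip
    simp only [← rank_lt_rank_iff] at h0 h1 hflip
    rw [hperm, hperm] at hflip
    rw [hperm, hperm, hperm, hperm] at h1
    obtain ⟨e1, e2⟩ := eq_of_swap_changes_order (fun he => hab (inj _ _ he))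
      (fun he => hcd (inj _ _ he)) h0 h1 hflip
    exact hne (by rw [inj _ _ e1, inj _ _ e2])

theorem order_eq_of_proportional {τ : Fin (B.length + 1) → ℝ} {F : Component B → ℝ → ℝ}
    (hF : RealizesPermutations B τ F) {a b c d : Strand B} (hab : a ≠ b) (hcd : c ≠ d)
    (hne : s(a, b) ≠ s(c, d)) {r : ℝ} (hr : r ≠ 0)
    (h : ∀ t, strand F c t - strand F d t = r * (strand F a t - strand F b t))
    (k : Fin (B.length + 1)) :
    strand F a (τ k) < strand F b (τ k) ↔ strand F a (τ 0) < strand F b (τ 0) := by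
  rcases lt_or_gt_of_ne hr with hr | hr
  · refine order_eq_of_iff hF hab hcd.symm (by rwa [Sym2.eq_swap (a := d)]) (fun t => ?_) k
    have := h t
    constructor
    · intro hl; by_contra hc; push Not at hc; nlinarith
    · intro hl; nlinarith
  · refine order_eq_of_iff hF hab hcd hne (fun t => ?_) k
    have := h t
    constructor
    · intro hl; by_contra hc; push Not at hc; nlinarith
    · intro hl; nlinarith

/-- Two different pairs of strands of one component cannot be proportional. -/
theorem not_proportional {τ : Fin (B.length + 1) → ℝ} (hτ : IsSubdivision B τ)
    {F : Component B → ℝ → ℝ} (hper : ∀ C θ, F C (θ + 2 * Real.pi) = F C θ)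
    (hF : RealizesPermutations B τ F) {a b c d : Strand B} (hab : a ≠ b) (hcd : c ≠ d)
    (hne : s(a, b) ≠ s(c, d)) (hC : a.1 = b.1) {r : ℝ} (hr : r ≠ 0)
    (h : ∀ t, strand F c t - strand F d t = r * (strand F a t - strand F b t)) : False := by
  wlog hlt : strand F a 0 < strand F b 0 generalizing a b r
  · have hne0 := hF.1 0 a b hab
    rw [hτ.2.1] at hne0
    exact this hab.symm (by rwa [Sym2.eq_swap (a := b)]) hC.symm (neg_ne_zero.mpr hr)
      (fun t => by rw [h t]; ring) (lt_of_le_of_ne (not_lt.mp hlt) hne0.symm)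
  -- The order at `2π` equals the order at `0`, and height `2π` is height `0` of the next strands;
  -- the shifted pairs satisfy the same hypotheses.
  have hall : ∀ m : ℕ, strand F ((strandShift B ^ m) a) 0 < strand F ((strandShift B ^ m) b) 0 := by
    intro m
    induction m with
    | zero => exact hlt
    | succ m ih =>
      have h1 := order_eq_of_proportional hF (a := (strandShift B ^ m) a)
        (b := (strandShift B ^ m) b) (c := (strandShift B ^ m) c) (d := (strandShift B ^ m) d)
        (fun he => hab (Equiv.injective _ he)) (fun he => hcd (Equiv.injective _ he))
        (fun he => hne (Sym2.map.injective (strandShift B ^ m).injective (by simpa using he))) hr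
        (fun t => by
          rw [← strand_add_nat_mul_two_pi hper, ← strand_add_nat_mul_two_pi hper,
            ← strand_add_nat_mul_two_pi hper, ← strand_add_nat_mul_two_pi hper, h])
        (Fin.last _)
      rw [hτ.2.1, hτ.2.2, ← zero_add (2 * Real.pi), strand_add_two_pi hper,
        strand_add_two_pi hper] at h1
      rw [pow_succ', Equiv.Perm.mul_apply, Equiv.Perm.mul_apply]
      exact h1.mpr ih
  obtain ⟨q, hq⟩ : ∃ q : ℕ, (strandShift B ^ q) a = b := by
    have hsc : Equiv.Perm.SameCycle B.perm (startPosition a) (startPosition b) :=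
      Quotient.exact ((startPosition_mk a).trans (hC.trans (startPosition_mk b).symm))
    obtain ⟨q, hq⟩ := hsc.exists_nat_pow_eq
    have hpow : ∀ m : ℕ, startPosition ((strandShift B ^ m) a) =
        (B.perm ^ m) (startPosition a) := by
      intro m
      induction m with
      | zero => rfl
      | succ m ih =>
        rw [pow_succ', pow_succ', Equiv.Perm.mul_apply, Equiv.Perm.mul_apply,
          startPosition_strandShift, ih]
    exact ⟨q, startPosition_injective (by rw [hpow, hq])⟩
  -- Since `b` is the `q`-th shift of `a`, iterating gives an infinite increasing sequence of
  -- positions, impossible for a shift of finite order.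
  have hmono : StrictMono fun m : ℕ => strand F ((strandShift B ^ (q * m)) a) 0 := by
    refine strictMono_nat_of_lt_succ fun m => ?_
    have h1 := hall (q * m)
    rw [← hq, ← Equiv.Perm.mul_apply, ← pow_add] at h1
    exact h1
  have h1 := hmono (orderOf_pos (strandShift B))
  simp only [pow_zero, mul_comm q, pow_mul, pow_orderOf_eq_one, one_pow] at h1
  exact lt_irrefl _ h1

/-- Each requirement is that a nonzero linear functional does not vanish at `v`: one functional for
every crossing of a pair (`I₁`), one for every two different pairs (`I₂`). There are finitely many,
so some vector avoids all the hyperplanes. -/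
theorem exists_generic_direction {τ : Fin (B.length + 1) → ℝ} (hτ : IsSubdivision B τ)
    {F : Component B → ℝ → ℝ} (han : ∀ C t, AnalyticAt ℝ (F C) t)
    (hper : ∀ C θ, F C (θ + 2 * Real.pi) = F C θ) (hF : RealizesPermutations B τ F) :
    ∃ v : PerturbationSpace B,
      (∀ a b, a ≠ b → ∀ t ∈ Set.Icc 0 (2 * Real.pi), strand F a t - strand F b t = 0 →
        perturbationDiff a b t v ≠ 0) ∧
      ∀ a b c d, a ≠ b → c ≠ d → s(a, b) ≠ s(c, d) →
        ∃ t, (strand F a t - strand F b t) * perturbationDiff c d t v -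
          (strand F c t - strand F d t) * perturbationDiff a b t v ≠ 0 := by
  have hne0 : ∀ a b : Strand B, a ≠ b → strand F a 0 - strand F b 0 ≠ 0 := by
    intro a b hab h
    have h1 := hF.1 0 a b hab
    rw [hτ.2.1] at h1
    exact h1 (sub_eq_zero.mp h)
  have hfin : ∀ a b : Strand B, a ≠ b →
      {t | t ∈ Set.Icc 0 (2 * Real.pi) ∧ strand F a t - strand F b t = 0}.Finite := fun a b hab =>
    finite_zeros_of_analytic (h := fun t => strand F a t - strand F b t)
      (fun t => (strand_analyticAt han a t).sub (strand_analyticAt han b t)) (hne0 a b hab)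
      isCompact_Icc
  let I₁ := Σ p : {p : Strand B × Strand B // p.1 ≠ p.2},
    {t // t ∈ Set.Icc 0 (2 * Real.pi) ∧ strand F p.1.1 t - strand F p.1.2 t = 0}
  let I₂ := {p : (Strand B × Strand B) × (Strand B × Strand B) //
    p.1.1 ≠ p.1.2 ∧ p.2.1 ≠ p.2.2 ∧ s(p.1.1, p.1.2) ≠ s(p.2.1, p.2.2)}
  -- If the functional vanished at every height, height `0` would make the perturbations of the two
  -- pairs proportional with ratio `r`; then they are so at every height, and the strand differences
  -- have the same ratio, which `not_proportional` excludes.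
  have key : ∀ p : I₂, ∃ t v, ((strand F p.1.1.1 t - strand F p.1.1.2 t) •
      perturbationDiff p.1.2.1 p.1.2.2 t - (strand F p.1.2.1 t - strand F p.1.2.2 t) •
        perturbationDiff p.1.1.1 p.1.1.2 t) v ≠ 0 := by
    rintro ⟨⟨⟨a, b⟩, c, d⟩, hab, hcd, hne⟩
    by_contra hc
    push Not at hc
    simp only [LinearMap.sub_apply, LinearMap.smul_apply, smul_eq_mul] at hc hab hcd hne
    have h1 := hne0 a b hab
    have h2 := hne0 c d hcd
    set r := (strand F c 0 - strand F d 0) / (strand F a 0 - strand F b 0) with hr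
    have hr0 : r ≠ 0 := div_ne_zero h2 h1
    rcases perturbationDiff_proportional hab hcd hr0 (fun v => by
      have := hc 0 v
      rw [hr]; field_simp; linarith) with h | ⟨hC, h⟩
    · exact hne h
    · refine not_proportional hτ hper hF hab hcd hne hC hr0 fun t => ?_
      obtain ⟨v, hv⟩ := exists_perturbationDiff_ne_zero hab t
      have h3 := hc t v
      rw [h v t] at h3
      exact mul_right_cancel₀ hv (by linarith)
  choose T hT using key
  have : ∀ p : {p : Strand B × Strand B // p.1 ≠ p.2}, Finite
    {t // t ∈ Set.Icc 0 (2 * Real.pi) ∧ strand F p.1.1 t - strand F p.1.2 t = 0} := fun p =>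
      (hfin _ _ p.2).to_subtype
  obtain ⟨v, hv⟩ := Module.Dual.exists_forall_ne_zero_of_forall_exists (K := ℝ) (ι := I₁ ⊕ I₂)
    (Sum.elim (fun p => perturbationDiff p.1.1.1 p.1.1.2 p.2.1) fun p =>
      (strand F p.1.1.1 (T p) - strand F p.1.1.2 (T p)) • perturbationDiff p.1.2.1 p.1.2.2 (T p) -
        (strand F p.1.2.1 (T p) - strand F p.1.2.2 (T p)) •
          perturbationDiff p.1.1.1 p.1.1.2 (T p)) (by
      rintro (⟨⟨p, hp⟩, t⟩ | p)
      · exact exists_perturbationDiff_ne_zero hp t.1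
      · exact hT p)
  refine ⟨v, fun a b hab t ht h0 => hv (Sum.inl ⟨⟨(a, b), hab⟩, ⟨t, ht, h0⟩⟩),
    fun a b c d hab hcd hne => ⟨_, hv (Sum.inr ⟨((a, b), (c, d)), hab, hcd, hne⟩)⟩⟩

end

/-! ### Small perturbations keep the permutations and are generic for almost all parameters -/

section
variable {n : ℕ} {B : BraidWord n}

theorem strand_add_smul (F G : Component B → ℝ → ℝ) (ε : ℝ) (a : Strand B) :
    strand (fun C θ => F C θ + ε * G C θ) a = fun t => strand F a t + ε * strand G a t := rfl

theorem realizesPermutations_of_order_eq {τ : Fin (B.length + 1) → ℝ} {F G : Component B → ℝ → ℝ}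
    (hF : RealizesPermutations B τ F)
    (h : ∀ j a b, strand F a (τ j) < strand F b (τ j) → strand G a (τ j) < strand G b (τ j)) :
    RealizesPermutations B τ G := by
  have hiff : ∀ j a b, strand F a (τ j) < strand F b (τ j) ↔
      strand G a (τ j) < strand G b (τ j) := by
    intro j a b
    refine ⟨h j a b, fun hG => ?_⟩
    by_contra hc
    rcases (not_lt.mp hc).lt_or_eq with h1 | h1
    · exact lt_asymm hG (h j b a h1)
    · by_cases hab : a = b
      · rw [hab] at hG; exact lt_irrefl _ hG
      · exact hF.1 j a b hab h1.symm
  refine ⟨fun j a b hab he => ?_, fun j a => ?_⟩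
  · rcases lt_or_gt_of_ne (hF.1 j a b hab) with h1 | h1
    · exact (h j a b h1).ne he
    · exact (h j b a h1).ne he.symm
  · have hr : ∀ j, rank G a (τ j) = rank F a (τ j) := fun j => by simp only [rank, hiff]
    rw [hr, hr, hF.2]

theorem eventually_realizesPermutations {τ : Fin (B.length + 1) → ℝ} {F : Component B → ℝ → ℝ}
    (hF : RealizesPermutations B τ F) (G : Component B → ℝ → ℝ) :
    ∀ᶠ ε : ℝ in 𝓝 0, RealizesPermutations B τ fun C θ => F C θ + ε * G C θ := by
  have : ∀ᶠ ε : ℝ in 𝓝 0, ∀ j a b, strand F a (τ j) < strand F b (τ j) →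
      strand (fun C θ => F C θ + ε * G C θ) a (τ j) <
        strand (fun C θ => F C θ + ε * G C θ) b (τ j) := by
    simp only [eventually_all]
    intro j a b hlt
    simp only [strand_add_smul]
    have h1 : ∀ c : Strand B, Tendsto (fun ε : ℝ => strand F c (τ j) + ε * strand G c (τ j)) (𝓝 0)
        (𝓝 (strand F c (τ j))) := fun c => by
      have : Continuous fun ε : ℝ => strand F c (τ j) + ε * strand G c (τ j) := by fun_prop
      simpa using this.tendsto 0
    exact (h1 a).eventually_lt (h1 b) hlt
  exact this.mono fun ε h => realizesPermutations_of_order_eq hF h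

/-- Genericity fails through a double zero of one difference, a common zero of two differences, or a
zero at height `π`. Each allows finitely many `ε` per pair or per two pairs. -/
theorem finite_not_isGeneric {F : Component B → ℝ → ℝ} (han : ∀ C t, AnalyticAt ℝ (F C) t)
    {v : PerturbationSpace B}
    (hv : ∀ a b, a ≠ b → ∀ t ∈ Set.Icc 0 (2 * Real.pi), strand F a t - strand F b t = 0 →
      perturbationDiff a b t v ≠ 0)
    (hv' : ∀ a b c d, a ≠ b → c ≠ d → s(a, b) ≠ s(c, d) →
      ∃ t, (strand F a t - strand F b t) * perturbationDiff c d t v -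
        (strand F c t - strand F d t) * perturbationDiff a b t v ≠ 0) :
    {ε : ℝ | ¬ IsGeneric fun C θ => F C θ + ε * perturbation v C θ}.Finite := by
  have hpi := Real.pi_pos
  have hG : ∀ a b : Strand B, ∀ t, AnalyticAt ℝ (fun t => strand F a t - strand F b t) t :=
    fun a b t => (strand_analyticAt han a t).sub (strand_analyticAt han b t)
  have hα : ∀ a b : Strand B, ∀ t, AnalyticAt ℝ (fun t => perturbationDiff a b t v) t :=
    fun a b t => (strand_analyticAt (fun C t => perturbation_analyticAt v C t) a t).sub
      (strand_analyticAt (fun C t => perturbation_analyticAt v C t) b t)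
  have fin₁ : (⋃ p : {p : Strand B × Strand B // p.1 ≠ p.2}, {ε : ℝ | ∃ t ∈ Set.Icc 0 (2 * Real.pi),
      (strand F p.1.1 t - strand F p.1.2 t) + ε * perturbationDiff p.1.1 p.1.2 t v = 0 ∧
      deriv (fun t => strand F p.1.1 t - strand F p.1.2 t) t +
        ε * deriv (fun t => perturbationDiff p.1.1 p.1.2 t v) t = 0}).Finite :=
    Set.finite_iUnion fun p =>
      finite_setOf_double_zero (hG _ _) (hα _ _) isCompact_Icc (hv _ _ p.2)
  have fin₂ : (⋃ p : {p : (Strand B × Strand B) × (Strand B × Strand B) //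
      p.1.1 ≠ p.1.2 ∧ p.2.1 ≠ p.2.2 ∧ s(p.1.1, p.1.2) ≠ s(p.2.1, p.2.2)},
      {ε : ℝ | ∃ t ∈ Set.Icc 0 (2 * Real.pi),
      (strand F p.1.1.1 t - strand F p.1.1.2 t) + ε * perturbationDiff p.1.1.1 p.1.1.2 t v = 0 ∧
      (strand F p.1.2.1 t - strand F p.1.2.2 t) +
        ε * perturbationDiff p.1.2.1 p.1.2.2 t v = 0}).Finite :=
    Set.finite_iUnion fun p => by
      obtain ⟨⟨⟨a, b⟩, c, d⟩, hab, hcd, hne⟩ := p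
      obtain ⟨t, ht⟩ := hv' a b c d hab hcd hne
      exact finite_setOf_common_zero (hG _ _) (hα _ _) (hG _ _) (hα _ _) isCompact_Icc
        (hv _ _ hab) ht
  have fin₃ : (⋃ p : {p : Strand B × Strand B // p.1 ≠ p.2},
      {ε : ℝ | (strand F p.1.1 Real.pi - strand F p.1.2 Real.pi) +
        ε * perturbationDiff p.1.1 p.1.2 Real.pi v = 0}).Finite :=
    Set.finite_iUnion fun p => by
      refine Set.Subsingleton.finite ?_
      rintro ε hε ε' hε'
      have hne : perturbationDiff p.1.1 p.1.2 Real.pi v ≠ 0 := by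
        intro h0
        refine hv _ _ p.2 Real.pi ⟨hpi.le, by linarith⟩ ?_ h0
        simpa [h0] using hε
      simp only [Set.mem_ofPred_eq] at hε hε'
      exact mul_right_cancel₀ hne (by linarith)
  refine ((fin₁.union fin₂).union fin₃).subset fun ε hε => ?_
  by_contra hc
  simp only [Set.mem_union, Set.mem_iUnion, Set.mem_ofPred_eq, not_or, not_exists, not_and] at hc
  obtain ⟨⟨h1, h2⟩, h3⟩ := hc
  have hdiff : ∀ a b : Strand B, ∀ t, strand F a t + ε * strand (perturbation v) a t =
      strand F b t + ε * strand (perturbation v) b t →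
      (strand F a t - strand F b t) + ε * perturbationDiff a b t v = 0 := by
    intro a b t h
    change _ + ε * (strand (perturbation v) a t - strand (perturbation v) b t) = 0
    linarith
  refine hε ⟨fun t ht a b hab he hd => ?_, fun t ht a b c d hab hcd he he' => ?_, ?_⟩
  · simp only [strand_add_smul] at he hd
    refine h1 ⟨(a, b), hab⟩ t ht (hdiff a b t he) ?_
    have dF : ∀ c : Strand B, DifferentiableAt ℝ (strand F c) t := fun c =>
      (strand_analyticAt han c t).differentiableAt
    have dP : ∀ c : Strand B, DifferentiableAt ℝ (strand (perturbation v) c) t := fun c =>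
      (strand_analyticAt (fun C t => perturbation_analyticAt v C t) c t).differentiableAt
    have e : ∀ c : Strand B, deriv (fun t => strand F c t + ε * strand (perturbation v) c t) t =
        deriv (strand F c) t + ε * deriv (strand (perturbation v) c) t := fun c =>
      ((dF c).hasDerivAt.add ((dP c).hasDerivAt.const_mul ε)).deriv
    have e1 : deriv (fun t => strand F a t - strand F b t) t =
        deriv (strand F a) t - deriv (strand F b) t :=
      ((dF a).hasDerivAt.sub (dF b).hasDerivAt).deriv
    have e2 : deriv (fun t => perturbationDiff a b t v) t =
        deriv (strand (perturbation v) a) t - deriv (strand (perturbation v) b) t :=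
      ((dP a).hasDerivAt.sub (dP b).hasDerivAt).deriv
    rw [e, e] at hd
    simp only [e1, e2]
    linarith
  · by_contra hne
    exact h2 ⟨((a, b), (c, d)), hab, hcd, hne⟩ t ht (hdiff a b t he) (hdiff c d t he')
  · rintro ⟨_, a, b, hab, he⟩
    exact h3 ⟨(a, b), hab⟩ (hdiff a b _ he)

theorem exists_isGenericParametrization (B : BraidWord n) (hB : 1 ≤ B.length) :
    ∃ F : Component B → ℝ → ℝ, IsGenericParametrization B F := by
  have hpi := Real.pi_pos
  have hL : (0 : ℝ) < B.length := by exact_mod_cast hB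
  have hτ : IsSubdivision B fun k => 2 * Real.pi * ((k : ℕ) : ℝ) / B.length := by
    refine ⟨fun j k hjk => ?_, by simp, by simp [hL.ne']⟩
    have : ((j : ℕ) : ℝ) < (k : ℕ) := by exact_mod_cast hjk
    exact div_lt_div_of_pos_right (by nlinarith) hL
  obtain ⟨F, hF⟩ := exists_stepOne B _ hτ
  have hR := hF.realizesPermutations hτ hB
  obtain ⟨x, -, hF'⟩ := id hF
  have han : ∀ C t, AnalyticAt ℝ (F C) t := fun C t => (hF' C).1.analyticAt t
  obtain ⟨v, hv, hv'⟩ := exists_generic_direction hτ han (fun C θ => (hF' C).1.periodic θ) hR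
  obtain ⟨ε, hε, hε'⟩ := ((infinite_of_mem_nhds (0 : ℝ)
    (eventually_realizesPermutations hR (perturbation v))).sdiff
      (finite_not_isGeneric han hv hv')).nonempty
  refine ⟨_, _, F, hτ, hF, ?_, hε, not_not.mp hε'⟩
  -- The combination of cosine and sine is a single cosine with amplitude `‖w C‖` and phase `(w
  -- C).arg`. No translation of the variable is needed.
  let w : Component B → ℂ := fun C => ⟨v.2.1 C, v.2.2 C⟩
  refine ⟨0, fun C => ε * v.1 C, fun C => if strandCount C = 1 then 0 else ε * ‖w C‖,
    fun C => (w C).arg, fun C hC => by simp [hC], fun C θ => ?_⟩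
  simp only [perturbation, Pi.zero_apply, add_zero]
  split_ifs
  · ring
  · have h1 := Complex.norm_mul_cos_arg (w C)
    have h2 := Complex.norm_mul_sin_arg (w C)
    simp only [w] at h1 h2 ⊢
    rw [Real.cos_sub]
    linear_combination (-ε * Real.cos θ) * h1 - ε * Real.sin θ * h2

/-- The added cosine occurs only for `s_C ≥ 2`, when `⌊s_C ℓ/2⌋ ≥ 1`; so Step 2 does not raise the
degree bound. -/
theorem IsGenericParametrization.realTrigDegLE {F : Component B → ℝ → ℝ} (hB : 1 ≤ B.length)
    (hF : IsGenericParametrization B F) (C : Component B) :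
    RealTrigDegLE (strandCount C * B.length / 2) (F C) := by
  obtain ⟨τ, F₀, -, ⟨x, -, h₀⟩, ⟨a, b, c, φ, hc, h⟩, -⟩ := hF
  have e : F C = fun θ => F₀ C (θ + a C) + b C + c C * Real.cos (θ - φ C) := funext (h C)
  rw [e]
  refine (((h₀ C).1.translate (a C)).add (RealTrigDegLE.const _ _)).add ?_
  by_cases hs : strandCount C = 1
  · simp only [hc C hs, zero_mul]
    exact RealTrigDegLE.const _ _
  · refine RealTrigDegLE.cos_sub ?_ _ _
    have := strandCount_pos C
    have : 2 ≤ strandCount C := by omega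
    have : 2 * 1 ≤ strandCount C * B.length := Nat.mul_le_mul this hB
    omega

end

/-! ### Ranks and crossings -/

theorem lt_iff_lt_of_forall_ne {f g : ℝ → ℝ} (hf : Continuous f) (hg : Continuous g) {p q : ℝ}
    (hpq : p ≤ q) (h : ∀ t ∈ Set.Icc p q, f t ≠ g t) : f p < g p ↔ f q < g q := by
  have hc : ContinuousOn (fun t => f t - g t) (Set.Icc p q) := (hf.sub hg).continuousOn
  have hp := h p (Set.left_mem_Icc.mpr hpq)
  have hq := h q (Set.right_mem_Icc.mpr hpq)
  constructor
  · intro h1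
    by_contra h2
    have h3 : g q < f q := lt_of_le_of_ne (not_lt.mp h2) hq.symm
    obtain ⟨t, ht, h0⟩ := intermediate_value_Icc hpq hc
      (show (0 : ℝ) ∈ Set.Icc (f p - g p) (f q - g q) from ⟨by linarith, by linarith⟩)
    exact h t ht (sub_eq_zero.mp h0)
  · intro h1
    by_contra h2
    have h3 : g p < f p := lt_of_le_of_ne (not_lt.mp h2) hp.symm
    obtain ⟨t, ht, h0⟩ := intermediate_value_Icc' hpq hc
      (show (0 : ℝ) ∈ Set.Icc (f q - g q) (f p - g p) from ⟨by linarith, by linarith⟩)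
    exact h t ht (sub_eq_zero.mp h0)

theorem sign_change_of_deriv_pos {f : ℝ → ℝ} {p t q : ℝ} (hpt : p < t) (htq : t < q) (h0 : f t = 0)
    (hd : 0 < deriv f t) :
    (∃ r, p < r ∧ r < t ∧ f r < 0) ∧ ∃ r, t < r ∧ r < q ∧ 0 < f r := by
  have hev := eventually_nhdsWithin_sign_eq_of_deriv_pos hd h0
  constructor
  · obtain ⟨r, hr, hr1, hr2⟩ := ((hev.filter_mono nhdsWithin_le_nhds).and
      (Ioo_mem_nhdsLT hpt)).exists
    refine ⟨r, hr1, hr2, ?_⟩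
    rw [sign_neg (sub_neg.mpr hr2)] at hr
    exact sign_eq_neg_one_iff.mp hr
  · obtain ⟨r, hr, hr1, hr2⟩ := ((hev.filter_mono nhdsWithin_le_nhds).and
      (Ioo_mem_nhdsGT htq)).exists
    refine ⟨r, hr1, hr2, ?_⟩
    rw [sign_pos (sub_pos.mpr hr1)] at hr
    exact sign_eq_one_iff.mp hr

theorem exists_gt_forall_mem_lt {t : ℝ} (l : List ℝ) (h : ∀ x ∈ l, t < x) :
    ∃ r, t < r ∧ ∀ x ∈ l, r < x := by
  induction l with
  | nil => exact ⟨t + 1, by linarith, by simp⟩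
  | cons y l ih =>
    obtain ⟨r, hr, hr'⟩ := ih fun x hx => h x (by simp [hx])
    obtain ⟨r', h1, h2⟩ := exists_between (lt_min hr (h y (by simp)))
    refine ⟨r', h1, fun x hx => ?_⟩
    rcases List.mem_cons.mp hx with rfl | hx
    · exact h2.trans_le (min_le_right _ _)
    · exact (h2.trans_le (min_le_left _ _)).trans (hr' x hx)

theorem filter_lt_eq_append {l : List ℝ} (hl : l.Pairwise (· < ·)) {a b : ℝ} (hab : a ≤ b) :
    l.filter (fun t => decide (t < b)) =
      l.filter (fun t => decide (t < a)) ++ l.filter (fun t => decide (a ≤ t ∧ t < b)) := by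
  induction l with
  | nil => rfl
  | cons x l ih =>
    rw [List.pairwise_cons] at hl
    by_cases hx : x < a
    · have h1 : x < b := hx.trans_le hab
      rw [List.filter_cons_of_pos (by simpa), List.filter_cons_of_pos (by simpa),
        List.filter_cons_of_neg (by simp [hx]), ih hl.2, List.cons_append]
    · have h1 : (x :: l).filter (fun t => decide (t < a)) = [] := by
        rw [List.filter_eq_nil_iff]
        intro y hy
        rcases List.mem_cons.mp hy with rfl | hy
        · simpa using hx
        · simpa using (not_lt.mp hx).trans (hl.1 y hy).le
      rw [h1, List.nil_append]
      refine List.filter_congr fun y hy => ?_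
      have : a ≤ y := by
        rcases List.mem_cons.mp hy with rfl | hy
        · exact not_lt.mp hx
        · exact (not_lt.mp hx).trans (hl.1 y hy).le
      simp [this]

section
variable {n : ℕ} {B : BraidWord n} {F : Component B → ℝ → ℝ}

theorem crossingTimes_finite (han : ∀ C t, AnalyticAt ℝ (F C) t)
    (h0 : ∀ a b : Strand B, a ≠ b → strand F a 0 ≠ strand F b 0) : (crossingTimes F).Finite := by
  have : (⋃ p : {p : Strand B × Strand B // p.1 ≠ p.2},
      {t | t ∈ Set.Icc 0 (2 * Real.pi) ∧ strand F p.1.1 t - strand F p.1.2 t = 0}).Finite :=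
    Set.finite_iUnion fun p =>
      finite_zeros_of_analytic (h := fun t => strand F p.1.1 t - strand F p.1.2 t)
        (fun t => (strand_analyticAt han _ t).sub (strand_analyticAt han _ t))
        (sub_ne_zero.mpr (h0 _ _ p.2)) isCompact_Icc
  refine this.subset ?_
  rintro t ⟨ht, a, b, hab, he⟩
  exact Set.mem_iUnion.mpr ⟨⟨(a, b), hab⟩, ht, sub_eq_zero.mpr he⟩

theorem rank_add_one_lt_of_eq {a b : Strand B} (hab : a ≠ b) {t : ℝ}
    (h : strand F a t = strand F b t) : rank F a t < n := by
  classical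
  rw [rank_eq_card_filter]
  have h1 : insert a (insert b (Finset.univ.filter fun c => strand F c t < strand F a t)) ⊆
      Finset.univ := Finset.subset_univ _
  have h2 := Finset.card_le_card h1
  rw [Finset.card_insert_of_notMem (by simp [hab]), Finset.card_insert_of_notMem (by simp [h]),
    Finset.card_univ, card_strand] at h2
  omega

theorem exists_crossing_index (hgen : IsGeneric F) {t : ℝ} (ht : t ∈ crossingTimes F) :
    ∃ i : Fin n, ∀ a b : Strand B, a ≠ b → strand F a t = strand F b t → rank F a t = i := by
  obtain ⟨ht, a, b, hab, he⟩ := ht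
  refine ⟨⟨rank F a t, rank_add_one_lt_of_eq hab he⟩, fun c d hcd he' => ?_⟩
  have hs := hgen.2.1 t ht a b c d hab hcd he he'
  rcases Sym2.eq_iff.mp hs with ⟨rfl, rfl⟩ | ⟨rfl, rfl⟩
  · rfl
  · exact (rank_eq_rank_iff _ _ _ _).mpr he'

theorem rank_eq_of_lt_iff {a : Strand B} {s t : ℝ}
    (h : ∀ d, d ≠ a → (strand F d s < strand F a s ↔ strand F d t < strand F a t)) :
    rank F a s = rank F a t := by
  have : ∀ d, (strand F d s < strand F a s ↔ strand F d t < strand F a t) := by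
    intro d
    by_cases hd : d = a
    · rw [hd]; simp
    · exact h d hd
  simp only [rank, this]

open Classical in
theorem rank_near_crossing {x y : Strand B} {s t : ℝ} (hxy : strand F x t = strand F y t)
    (h : ∀ d, d ≠ x → d ≠ y → (strand F d s < strand F x s ↔ strand F d t < strand F x t)) :
    rank F x s = rank F x t + if strand F y s < strand F x s then 1 else 0 := by
  split_ifs with hlt
  · rw [rank_eq_card_filter, rank_eq_card_filter, ← Finset.card_insert_of_notMem (a := y) (by
      simp [hxy])]
    congr 1
    ext d
    simp only [Finset.mem_filter, Finset.mem_univ, true_and, Finset.mem_insert]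
    by_cases hd : d = y
    · simp [hd, hlt]
    · by_cases hd' : d = x
      · simp only [hd', lt_irrefl, false_iff, not_or]
        exact ⟨fun he => by rw [he] at hlt; exact lt_irrefl _ hlt, not_false⟩
      · simp [hd, h d hd' hd]
  · rw [add_zero]
    refine rank_eq_of_lt_iff fun d hd => ?_
    by_cases hd' : d = y
    · simp [hd', hlt, hxy]
    · exact h d hd hd'

theorem rank_eq_of_no_crossing (hc : ∀ a : Strand B, Continuous (strand F a)) {p q : ℝ}
    (hpq : p ≤ q) (hp : 0 ≤ p) (hq : q ≤ 2 * Real.pi)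
    (h : ∀ t ∈ Set.Icc p q, t ∉ crossingTimes F) (a : Strand B) : rank F a q = rank F a p :=
  rank_eq_of_lt_iff fun d hd => (lt_iff_lt_of_forall_ne (hc d) (hc a) hpq fun t ht he =>
    h t ht ⟨⟨hp.trans ht.1, ht.2.trans hq⟩, d, a, hd, he⟩).symm

/-- Between `p` and `q` only the colliding pair can change order, and transversality makes it do so.
At the crossing both strands have rank `i`, so nearby they occupy ranks `i` and `i + 1`, in opposite
orders on the two sides. -/
theorem rank_after_crossing (hdiff : ∀ a : Strand B, Differentiable ℝ (strand F a))
    (hgen : IsGeneric F) {p t₀ q : ℝ} (hpt : p < t₀) (htq : t₀ < q) (hp : 0 ≤ p)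
    (hq : q ≤ 2 * Real.pi) (ht₀ : t₀ ∈ crossingTimes F)
    (h : ∀ t ∈ Set.Icc p q, t ∈ crossingTimes F → t = t₀) {i : ℕ}
    (hi : ∀ a b : Strand B, a ≠ b → strand F a t₀ = strand F b t₀ → rank F a t₀ = i)
    (c : Strand B) : rank F c q = Equiv.swap i (i + 1) (rank F c p) := by
  classical
  have hc : ∀ a : Strand B, Continuous (strand F a) := fun a => (hdiff a).continuous
  obtain ⟨htI, a, b, hab, he⟩ := ht₀
  -- Name the strands so that `b` passes from below `a` to above it.
  wlog hd : 0 < deriv (strand F b) t₀ - deriv (strand F a) t₀ generalizing a b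
  · have hne := hgen.1 t₀ htI a b hab he
    refine this b a hab.symm he.symm ?_
    rcases lt_or_gt_of_ne hne with h1 | h1
    · exact absurd (sub_pos.mpr h1) hd
    · linarith
  have hmem : ∀ t ∈ Set.Icc p q, t ∈ Set.Icc 0 (2 * Real.pi) := fun t ht =>
    ⟨hp.trans ht.1, ht.2.trans hq⟩
  have hab_ne : ∀ t ∈ Set.Icc p q, t ≠ t₀ → ∀ x y : Strand B, x ≠ y →
      strand F x t ≠ strand F y t := fun t ht hne x y hxy he' =>
    hne (h t ht ⟨hmem t ht, x, y, hxy, he'⟩)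
  have hother : ∀ x y : Strand B, x ≠ y → s(x, y) ≠ s(a, b) → ∀ t ∈ Set.Icc p q,
      strand F x t ≠ strand F y t := by
    intro x y hxy hne t ht he'
    by_cases htt : t = t₀
    · subst htt
      exact hne (hgen.2.1 t htI x y a b hxy hab he' he)
    · exact hab_ne t ht htt x y hxy he'
  have hiff : ∀ x y : Strand B, x ≠ y → s(x, y) ≠ s(a, b) → ∀ r s, p ≤ r → r ≤ s → s ≤ q →
      (strand F x r < strand F y r ↔ strand F x s < strand F y s) := fun x y hxy hne r s h1 h2 h3 =>
    lt_iff_lt_of_forall_ne (hc x) (hc y) h2 fun t ht =>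
      hother x y hxy hne t ⟨h1.trans ht.1, ht.2.trans h3⟩
  have hda : deriv (fun t => strand F b t - strand F a t) t₀ =
      deriv (strand F b) t₀ - deriv (strand F a) t₀ :=
    ((hdiff b _).hasDerivAt.sub (hdiff a _).hasDerivAt).deriv
  obtain ⟨⟨r, hr1, hr2, hr3⟩, r', hr1', hr2', hr3'⟩ := sign_change_of_deriv_pos
    (f := fun t => strand F b t - strand F a t) hpt htq (by rw [he, sub_self]) (by rw [hda]; exact hd)
  have hbp : strand F b p < strand F a p :=
    (lt_iff_lt_of_forall_ne (hc b) (hc a) hr1.le fun t ht =>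
      hab_ne t ⟨ht.1, by linarith [ht.2]⟩ (by linarith [ht.2]) b a hab.symm).mpr (by linarith)
  have haq : strand F a q < strand F b q :=
    (lt_iff_lt_of_forall_ne (hc a) (hc b) hr2'.le fun t ht =>
      hab_ne t ⟨by linarith [ht.1], ht.2⟩ (by linarith [ht.1]) a b hab).mp (by linarith)
  have nepair : ∀ x d : Strand B, (x = a ∨ x = b) → d ≠ a → d ≠ b → s(d, x) ≠ s(a, b) := by
    intro x d hx h1 h2 h3
    rcases Sym2.eq_iff.mp h3 with ⟨h4, -⟩ | ⟨h4, -⟩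
    · exact h1 h4
    · exact h2 h4
  have e1 : rank F a p = i + 1 := by
    rw [rank_near_crossing he fun d h1 h2 => hiff d a h1 (nepair a d (Or.inl rfl) h1 h2) p t₀ le_rfl
      hpt.le htq.le, if_pos hbp, hi a b hab he]
  have e2 : rank F b p = i := by
    rw [rank_near_crossing he.symm fun d h1 h2 => hiff d b h1 (nepair b d (Or.inr rfl) h2 h1) p t₀
      le_rfl hpt.le htq.le, if_neg (lt_asymm hbp), add_zero, hi b a hab.symm he.symm]
  have e3 : rank F a q = i := by
    rw [rank_near_crossing he fun d h1 h2 => (hiff d a h1 (nepair a d (Or.inl rfl) h1 h2) t₀ q hpt.le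
      htq.le le_rfl).symm, if_neg (lt_asymm haq), add_zero, hi a b hab he]
  have e4 : rank F b q = i + 1 := by
    rw [rank_near_crossing he.symm fun d h1 h2 => (hiff d b h1 (nepair b d (Or.inr rfl) h2 h1) t₀ q
      hpt.le htq.le le_rfl).symm, if_pos haq, hi b a hab.symm he.symm]
  by_cases hca : c = a
  · rw [hca, e1, e3, Equiv.swap_apply_right]
  by_cases hcb : c = b
  · rw [hcb, e2, e4, Equiv.swap_apply_left]
  have e5 : rank F c q = rank F c p := rank_eq_of_lt_iff fun d hdc =>
    (hiff d c hdc (fun h3 => by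
      rcases Sym2.eq_iff.mp h3 with ⟨-, h4⟩ | ⟨-, h4⟩
      · exact hcb h4
      · exact hca h4) p q le_rfl (hpt.trans htq).le le_rfl).symm
  have hpp : p ∈ Set.Icc p q := ⟨le_rfl, (hpt.trans htq).le⟩
  rw [e5, Equiv.swap_apply_of_ne_of_ne]
  · rw [← e2]
    exact fun h1 => hab_ne p hpp hpt.ne c b hcb ((rank_eq_rank_iff _ _ _ _).mp h1)
  · rw [← e1]
    exact fun h1 => hab_ne p hpp hpt.ne c a hca ((rank_eq_rank_iff _ _ _ _).mp h1)

theorem rank_eq_indexPerm (hdiff : ∀ a : Strand B, Differentiable ℝ (strand F a))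
    (hgen : IsGeneric F) {idx : ℝ → Fin n}
    (hidx : ∀ t ∈ crossingTimes F, ∀ a b : Strand B, a ≠ b → strand F a t = strand F b t →
      rank F a t = idx t) (a : Strand B) {q : ℝ} (hq : q ≤ 2 * Real.pi) (l : List ℝ)
    (hl : l.Pairwise (· < ·)) (p : ℝ) (hp : 0 ≤ p) (hpq : p ≤ q) (hpS : p ∉ crossingTimes F)
    (hqS : q ∉ crossingTimes F) (hmem : ∀ t, t ∈ l ↔ t ∈ crossingTimes F ∧ p < t ∧ t < q) :
    rank F a q = indexPerm (l.map idx) (rank F a p) := by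
  induction l generalizing p with
  | nil =>
    refine rank_eq_of_no_crossing (fun a => (hdiff a).continuous) hpq hp hq (fun t ht htS => ?_) a
    have h1 : t ≠ p := fun h => hpS (h ▸ htS)
    have h2 : t ≠ q := fun h => hqS (h ▸ htS)
    have := (hmem t).mpr ⟨htS, lt_of_le_of_ne ht.1 h1.symm, lt_of_le_of_ne ht.2 h2⟩
    simp at this
  | cons t₀ l ih =>
    rw [List.pairwise_cons] at hl
    obtain ⟨ht₀, hpt, htq⟩ := (hmem t₀).mp (by simp)
    -- A height `r` after the first crossing and before all others isolates that crossing.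
    obtain ⟨r, htr, hr⟩ := exists_gt_forall_mem_lt (q :: l) (t := t₀) (by
      intro x hx
      rcases List.mem_cons.mp hx with rfl | hx
      · exact htq
      · exact hl.1 x hx)
    have hrq : r < q := hr q (by simp)
    have hrl : ∀ x ∈ l, r < x := fun x hx => hr x (by simp [hx])
    have hrS : ∀ t, p < t → t ≤ r → t ∈ crossingTimes F → t = t₀ := by
      intro t h1 h2 h3
      rcases List.mem_cons.mp ((hmem t).mpr ⟨h3, h1, by linarith⟩) with h4 | h4
      · exact h4
      · exact absurd (hrl t h4) (not_lt.mpr h2)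
    have h1 := rank_after_crossing hdiff hgen hpt htr hp (hrq.le.trans hq) ht₀ (fun t ht htS =>
      hrS t (lt_of_le_of_ne ht.1 fun h => hpS (h ▸ htS)) ht.2 htS) (hidx t₀ ht₀) a
    have h2 := ih hl.2 r (hp.trans (hpt.trans htr).le) hrq.le
      (fun h => htr.ne' (hrS r (hpt.trans htr) le_rfl h)) (fun t => by
        constructor
        · intro ht
          obtain ⟨h3, h4, h5⟩ := (hmem t).mp (by simp [ht])
          exact ⟨h3, hrl t ht, h5⟩
        · rintro ⟨h3, h4, h5⟩
          rcases List.mem_cons.mp ((hmem t).mpr ⟨h3, hpt.trans (htr.trans h4), h5⟩) with h6 | h6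
          · rw [h6] at h4; exact absurd h4 (lt_asymm htr)
          · exact h6)
    rw [h2, h1]
    simp [indexPerm]

theorem exists_rank_eq {t : ℝ} (h : ∀ a b : Strand B, a ≠ b → strand F a t ≠ strand F b t) {x : ℕ}
    (hx : x ≤ n) : ∃ a, rank F a t = x := by
  have hinj : Function.Injective fun a : Strand B => (⟨rank F a t, rank_lt F a t⟩ : Fin (n + 1)) := by
    intro a b hab
    by_contra hne
    exact h a b hne ((rank_eq_rank_iff _ _ _ _).mp (congrArg Fin.val hab))
  have hbij := (Fintype.bijective_iff_injective_and_card _).mpr ⟨hinj, by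
    rw [card_strand, Fintype.card_fin]⟩
  obtain ⟨a, ha⟩ := hbij.2 ⟨x, by omega⟩
  exact ⟨a, congrArg Fin.val ha⟩

/-- Signs of the singular crossings for which the resolved braid is isotopic to `B`. -/
theorem exists_signs {τ : Fin (B.length + 1) → ℝ} (hτ : IsSubdivision B τ)
    (hdiff : ∀ a : Strand B, Differentiable ℝ (strand F a)) (hF : RealizesPermutations B τ F)
    (hgen : IsGeneric F) {idx : ℝ → Fin n}
    (hidx : ∀ t ∈ crossingTimes F, ∀ a b : Strand B, a ≠ b → strand F a t = strand F b t →
      rank F a t = idx t) (l : List ℝ) (hl : l.Pairwise (· < ·))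
    (hmem : ∀ t, t ∈ l ↔ t ∈ crossingTimes F) :
    ∃ w : BraidWord n, w.map Prod.fst = l.map idx ∧ w.toGroup = B.toGroup := by
  have hτS : ∀ k, τ k ∉ crossingTimes F := by
    rintro k ⟨_, a, b, hab, he⟩
    exact hF.1 k a b hab he
  have hτ0 : ∀ k, 0 ≤ τ k := fun k => by rw [← hτ.2.1]; exact hτ.1.monotone (Fin.zero_le k)
  have hτ1 : ∀ k, τ k ≤ 2 * Real.pi := fun k => by rw [← hτ.2.2]; exact hτ.1.monotone (Fin.le_last k)
  -- The signs are chosen interval by interval: the crossings below `τ k` must represent the prefix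
  -- of length `k`.
  have key : ∀ k : Fin (B.length + 1), ∃ w : BraidWord n,
      w.map Prod.fst = (l.filter fun t => decide (t < τ k)).map idx ∧
        w.toGroup = BraidWord.toGroup (B.take k) := by
    intro k
    induction k using Fin.induction with
    | zero =>
      refine ⟨[], ?_, by simp [BraidWord.toGroup]⟩
      have : l.filter (fun t => decide (t < τ 0)) = [] := by
        rw [List.filter_eq_nil_iff]
        intro t ht
        rw [hτ.2.1]
        simpa using ((hmem t).mp ht).1.1
      rw [this]; rfl
    | succ j ih =>
      obtain ⟨w, hw, hw'⟩ := ih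
      have hlt : τ j.castSucc < τ j.succ := hτ.1 (Fin.castSucc_lt_succ)
      set l' := l.filter fun t => decide (τ j.castSucc ≤ t ∧ t < τ j.succ) with hl'
      have hr := fun a => rank_eq_indexPerm hdiff hgen hidx a (hτ1 j.succ) l' (hl.filter _)
        (τ j.castSucc) (hτ0 _) hlt.le (hτS _) (hτS _) (fun t => by
          rw [hl', List.mem_filter, hmem, decide_eq_true_iff]
          refine and_congr_right fun htS => and_congr_left fun _ => ?_
          exact ⟨fun h => lt_of_le_of_ne h fun h' => hτS _ (h' ▸ htS), le_of_lt⟩)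
      -- At `τ j` the strands are disjoint and take all ranks `0, …, n`, so the ranks determine the
      -- permutation.
      have hperm : indexPerm (l'.map idx) =
          Equiv.swap ((B.get j).1 : ℕ) ((B.get j).1 + 1) := by
        ext x
        rcases Nat.lt_or_ge n x with hx | hx
        · have := (B.get j).1.2
          rw [indexPerm_apply_of_lt _ hx, Equiv.swap_apply_of_ne_of_ne (by omega) (by omega)]
        · obtain ⟨a, rfl⟩ := exists_rank_eq (hF.1 j.castSucc) hx
          rw [← hr, hF.2]
      obtain ⟨w', hv, hv'⟩ := exists_signs_of_indexPerm_eq_swap _ (B.get j) hperm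
      refine ⟨w ++ w', ?_, ?_⟩
      · rw [filter_lt_eq_append hl hlt.le, List.map_append, List.map_append, hw, hv]
      · rw [BraidWord.toGroup_append, hw', hv', ← BraidWord.toGroup_append, Fin.val_succ,
          List.take_add_one]
        simp
  obtain ⟨w, hw, hw'⟩ := key (Fin.last _)
  refine ⟨w, ?_, by simpa using hw'⟩
  rw [hw, List.filter_eq_self.mpr]
  intro t ht
  rw [decide_eq_true_iff, hτ.2.2]
  have htS := (hmem t).mp ht
  exact lt_of_le_of_ne htS.1.2 fun h => hτS (Fin.last _) (by rw [hτ.2.2, ← h]; exact htS)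

end

/-! ### Hermite interpolation by trigonometric polynomials -/

theorem one_sub_cos_ne_zero {s t : ℝ} (hs : s ∈ Set.Ico 0 (2 * Real.pi))
    (ht : t ∈ Set.Ico 0 (2 * Real.pi)) (hst : t ≠ s) : 1 - Real.cos (t - s) ≠ 0 := by
  intro h
  obtain ⟨k, hk⟩ := (Real.cos_eq_one_iff _).mp (show Real.cos (t - s) = 1 by linarith)
  have hpi := Real.pi_pos
  have h3 : (k : ℝ) < 1 := by
    by_contra hc; push Not at hc
    nlinarith [hs.1, hs.2, ht.1, ht.2]
  have h4 : (-1 : ℝ) < k := by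
    by_contra hc; push Not at hc
    nlinarith [hs.1, hs.2, ht.1, ht.2]
  have : k = 0 := by
    have a : k < 1 := by exact_mod_cast h3
    have b : -1 < k := by exact_mod_cast h4
    omega
  rw [this] at hk
  simp only [Int.cast_zero, zero_mul] at hk
  exact hst (by linarith)

/-- A trigonometric polynomial with double zeros at the points of `S`. -/
noncomputable def doubleZeros (S : Finset ℝ) (t : ℝ) : ℂ := ∏ s ∈ S, (1 - Real.cos (t - s) : ℂ)

theorem one_sub_cos_mem (s : ℝ) : (fun t : ℝ => (1 - Real.cos (t - s) : ℂ)) ∈ trigSpan (freqs 1 1) := by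
  have h1 := natCast_mem_freqs_one (d := 1) (k := 1) le_rfl
  simp only [Nat.cast_one] at h1
  have h2 := trigSpan_affine 1 (-s) (u := freqs 1 1) (fun x hx => by rwa [one_mul])
    (cos_mem_trigSpan 1 h1.1 h1.2)
  have h3 := sub_mem (const_mem_trigSpan_freqs 1 zero_le_one 1) h2
  convert h3 using 1
  funext t
  simp [sub_eq_add_neg]

theorem const_add_sin_mem (x y : ℂ) (s : ℝ) :
    (fun t : ℝ => (x + y * Real.sin (t - s) : ℂ)) ∈ trigSpan (freqs 1 1) := by
  have h1 := natCast_mem_freqs_one (d := 1) (k := 1) le_rfl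
  simp only [Nat.cast_one] at h1
  have h2 := trigSpan_affine 1 (-s) (u := freqs 1 1) (fun x hx => by rwa [one_mul])
    (sin_mem_trigSpan 1 h1.1 h1.2)
  have h3 := add_mem (const_mem_trigSpan_freqs 1 zero_le_one x) (Submodule.smul_mem _ y h2)
  convert h3 using 1
  funext t
  simp [sub_eq_add_neg]

theorem doubleZeros_mem (S : Finset ℝ) : doubleZeros S ∈ trigSpan (freqs 1 S.card) := by
  have := prod_mem_trigSpan_freqs S (L := 1) (D := 1) (f := fun s t => (1 - Real.cos (t - s) : ℂ))
    fun s _ => one_sub_cos_mem s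
  rwa [mul_one] at this

theorem hasDerivAt_one_sub_cos (s t : ℝ) :
    HasDerivAt (fun t : ℝ => (1 - Real.cos (t - s) : ℂ)) (Real.sin (t - s) : ℂ) t := by
  have h := ((Real.hasDerivAt_cos (t - s)).comp_sub_const t s).ofReal_comp.const_sub 1
  exact h.congr_deriv (by simp)

theorem differentiableAt_doubleZeros (S : Finset ℝ) (t : ℝ) :
    DifferentiableAt ℝ (doubleZeros S) t :=
  DifferentiableAt.fun_finsetProd fun s _ => (hasDerivAt_one_sub_cos s t).differentiableAt

theorem doubleZeros_of_mem {S : Finset ℝ} {s : ℝ} (hs : s ∈ S) :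
    doubleZeros S s = 0 ∧ HasDerivAt (doubleZeros S) 0 s := by
  have h1 : doubleZeros S = fun t => (1 - Real.cos (t - s) : ℂ) * doubleZeros (S.erase s) t := by
    funext t
    exact (Finset.mul_prod_erase S (fun s => (1 - Real.cos (t - s) : ℂ)) hs).symm
  rw [h1]
  refine ⟨by simp, ?_⟩
  have := (hasDerivAt_one_sub_cos s s).mul (differentiableAt_doubleZeros (S.erase s) s).hasDerivAt
  exact this.congr_deriv (by simp)

/-- As in Newton interpolation, nodes are added one at a time. A correction divisible by the double
zeros at the old nodes leaves the values and derivatives there unchanged, and it costs one degree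
per node. -/
theorem exists_hermite_interpolation (S : Finset ℝ) (hS : ∀ s ∈ S, s ∈ Set.Ico 0 (2 * Real.pi))
    (α β : ℝ → ℂ) : ∃ A : ℝ → ℂ, A ∈ trigSpan (freqs 1 S.card) ∧
      ∀ s ∈ S, A s = α s ∧ HasDerivAt A (β s) s := by
  classical
  induction S using Finset.induction_on with
  | empty => exact ⟨0, zero_mem _, by simp⟩
  | insert a S ha ih =>
    obtain ⟨A, hA, hA'⟩ := ih fun s hs => hS s (by simp [hs])
    have hdA : DifferentiableAt ℝ A a := by
      clear hA'
      induction hA using Submodule.span_induction with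
      | mem f hf =>
        obtain ⟨x, -, rfl⟩ := hf
        have h1 : HasDerivAt (fun t : ℝ => ((x * t : ℝ) : ℂ) * Complex.I)
            (((x * 1 : ℝ) : ℂ) * Complex.I) a :=
          (((hasDerivAt_id a).const_mul x).ofReal_comp).mul_const Complex.I
        have h2 := h1.cexp.differentiableAt
        have h3 : (fun t : ℝ => Complex.exp (((x * t : ℝ) : ℂ) * Complex.I)) = wave x := by
          funext t; simp [wave]
        rwa [h3] at h2
      | zero => exact differentiableAt_const _
      | add f g _ _ hf hg => exact hf.add hg
      | smul c f _ hf => exact hf.const_smul c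
    set P := doubleZeros S with hP
    have hPa : P a ≠ 0 := by
      rw [hP, doubleZeros, Finset.prod_ne_zero_iff]
      intro s hs
      have hne : a ≠ s := fun h => ha (h ▸ hs)
      have := one_sub_cos_ne_zero (hS s (by simp [hs])) (hS a (by simp)) hne
      exact_mod_cast this
    -- At `a` the factor `x + y sin(t - a)` has value `x` and derivative `y`, so the two conditions
    -- at the new node form a triangular system.
    set x := (α a - A a) / P a with hx
    set y := (β a - deriv A a - x * deriv P a) / P a with hy
    refine ⟨A + (fun t : ℝ => (x + y * Real.sin (t - a) : ℂ)) * P, ?_, fun s hs => ?_⟩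
    · rw [Finset.card_insert_of_notMem ha]
      refine add_mem (trigSpan_mono (freqs_mono 1 (by push_cast; linarith)) hA) ?_
      have := mul_mem_trigSpan_freqs (const_add_sin_mem x y a) (doubleZeros_mem S)
      convert this using 3
      push_cast; ring
    · have hsin : ∀ t : ℝ, HasDerivAt (fun t : ℝ => (x + y * Real.sin (t - a) : ℂ))
          (y * Real.cos (t - a)) t := fun t =>
        (((Real.hasDerivAt_sin (t - a)).comp_sub_const t a).ofReal_comp.const_mul y).const_add x
      rcases Finset.mem_insert.mp hs with rfl | hs'
      · constructor
        · simp only [Pi.add_apply, Pi.mul_apply, sub_self, Real.sin_zero, Complex.ofReal_zero,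
            mul_zero, add_zero]
          rw [hx, div_mul_cancel₀ _ hPa]; ring
        · have := hdA.hasDerivAt.add ((hsin s).mul (differentiableAt_doubleZeros S s).hasDerivAt)
          refine this.congr_deriv ?_
          simp only [sub_self, Real.sin_zero, Real.cos_zero, Complex.ofReal_zero, Complex.ofReal_one,
            mul_zero, add_zero, mul_one]
          rw [← hP, hy, div_mul_cancel₀ _ hPa]; ring
      · obtain ⟨h1, h2⟩ := doubleZeros_of_mem hs'
        obtain ⟨h3, h4⟩ := hA' s hs'
        constructor
        · simp [hP, h1, h3]
        · have := h4.add ((hsin s).mul h2)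
          exact this.congr_deriv (by simp [h1])

section
variable {n : ℕ} {B : BraidWord n} {F : Component B → ℝ → ℝ}

/-! ### Critical points between colliding roots -/

theorem gFun_eq_prod_strand (F : Component B → ℝ → ℝ) (u : ℂ) (t : ℝ) :
    gFun F u t = ∏ a : Strand B, (u - (strand F a (2 * t) : ℂ)) := by
  rw [gFun, Fintype.prod_sigma]
  rfl

/-- The polynomial with the values of the strands at height `t` as its roots. -/
noncomputable def strandPoly (F : Component B → ℝ → ℝ) (t : ℝ) : Polynomial ℝ :=
  ∏ a : Strand B, (Polynomial.X - Polynomial.C (strand F a t))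

theorem gFun_eq_eval (F : Component B → ℝ → ℝ) (u : ℂ) (t : ℝ) :
    gFun F u (t / 2) = ((strandPoly F t).map (algebraMap ℝ ℂ)).eval u := by
  rw [gFun_eq_prod_strand, strandPoly, Polynomial.map_prod, Polynomial.eval_prod]
  simp [mul_div_cancel₀]

theorem strandPoly_eval (F : Component B → ℝ → ℝ) (t c : ℝ) :
    (strandPoly F t).eval c = ∏ a : Strand B, (c - strand F a t) := by
  rw [strandPoly, Polynomial.eval_prod]; simp

theorem deriv_gFun (F : Component B → ℝ → ℝ) (t c : ℝ) :
    deriv (fun u : ℂ => gFun F u (t / 2)) c = ((strandPoly F t).derivative.eval c : ℝ) := by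
  simp only [gFun_eq_eval]
  rw [Polynomial.deriv, Polynomial.derivative_map]
  exact Polynomial.eval_map_algebraMap _ _ |>.trans (Polynomial.aeval_algebraMap_apply_eq_algebraMap_eval _ _)

theorem gFun_ofReal (F : Component B → ℝ → ℝ) (t c : ℝ) :
    gFun F c (t / 2) = ((strandPoly F t).eval c : ℝ) := by
  rw [gFun_eq_eval]
  exact Polynomial.eval_map_algebraMap _ _ |>.trans (Polynomial.aeval_algebraMap_apply_eq_algebraMap_eval _ _)

open Classical in
/-- A number with the sign of the critical point between the roots `a` and `b` that collide at
height `t`. -/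
noncomputable def criticalSign (F : Component B → ℝ → ℝ) (a b : Strand B) (t : ℝ) : ℝ :=
  -∏ d ∈ Finset.univ \ {a, b}, (strand F a t - strand F d t)

theorem criticalSign_comm {a b : Strand B} {t : ℝ} (h : strand F a t = strand F b t) :
    criticalSign F a b t = criticalSign F b a t := by
  classical
  rw [criticalSign, criticalSign, h, Finset.pair_comm]

theorem IsGeneric.criticalSign_ne_zero (hgen : IsGeneric F) {a b : Strand B} (hab : a ≠ b) {t : ℝ}
    (ht : t ∈ Set.Icc 0 (2 * Real.pi)) (h : strand F a t = strand F b t) :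
    criticalSign F a b t ≠ 0 := by
  classical
  rw [criticalSign, neg_ne_zero, Finset.prod_ne_zero_iff]
  intro d hd h0
  simp only [Finset.mem_sdiff, Finset.mem_univ, true_and, Finset.mem_insert, Finset.mem_singleton,
    not_or] at hd
  have := hgen.2.1 t ht a b a d hab (Ne.symm hd.1) h (sub_eq_zero.mp h0)
  rcases Sym2.eq_iff.mp this with ⟨-, h1⟩ | ⟨h1, -⟩
  · exact hd.2 h1.symm
  · exact hd.1 h1.symm

/-- Rolle's theorem gives a critical point between the two roots. There the two colliding factors
have negative product, which is the minus sign in `criticalSign`; the other factors are close to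
their nonzero values at the crossing. -/
theorem IsGeneric.exists_criticalPoint (hgen : IsGeneric F)
    (hdiff : ∀ a : Strand B, Differentiable ℝ (strand F a)) {a b : Strand B} (hab : a ≠ b) {t : ℝ}
    (ht : t ∈ Set.Icc 0 (2 * Real.pi)) (h : strand F a t = strand F b t) :
    ∀ᶠ t' in 𝓝[≠] t, ∃ c : ℝ,
      min (strand F a t') (strand F b t') < c ∧ c < max (strand F a t') (strand F b t') ∧
      deriv (fun u : ℂ => gFun F u (t' / 2)) c = 0 ∧
      SignType.sign (criticalSign F a b t) = SignType.sign (gFun F c (t' / 2)).re := by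
  classical
  have hc : ∀ a : Strand B, Continuous (strand F a) := fun a => (hdiff a).continuous
  have hne : ∀ᶠ t' in 𝓝[≠] t, strand F a t' ≠ strand F b t' := by
    have h1 : HasDerivAt (fun t => strand F a t - strand F b t)
        (deriv (strand F a) t - deriv (strand F b) t) t :=
      (hdiff a t).hasDerivAt.sub (hdiff b t).hasDerivAt
    have h2 := h1.eventually_ne (c := 0) (sub_ne_zero.mpr (hgen.1 t ht a b hab h))
    exact h2.mono fun t' h3 => sub_ne_zero.mp h3
  have hq := hgen.criticalSign_ne_zero hab ht h
  set T := (Finset.univ : Finset (Strand B)) \ {a, b} with hT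
  -- At the crossing `R` is a nonzero square, so by continuity the signs of its two factors agree
  -- nearby.
  set R : ℝ × ℝ → ℝ := fun p => criticalSign F a b t * -∏ d ∈ T, (p.2 - strand F d p.1) with hR
  have hRc : Continuous R := by
    refine continuous_const.mul (continuous_finsetProd _ fun d _ => ?_).neg
    exact continuous_snd.sub ((hc d).comp continuous_fst)
  have hR0 : 0 < R (t, strand F a t) := by
    have : R (t, strand F a t) = criticalSign F a b t * criticalSign F a b t := rfl
    rw [this]
    exact mul_self_pos.mpr hq
  obtain ⟨U, hU, V, hV, hUV⟩ := mem_nhds_prod_iff.mp (hRc.continuousAt.eventually_const_lt hR0)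
  obtain ⟨δ, hδ, hVδ⟩ := Metric.mem_nhds_iff.mp hV
  have hba : ∀ d : Strand B, strand F d t = strand F a t →
      ∀ᶠ t' in 𝓝[≠] t, strand F d t' ∈ Metric.ball (strand F a t) δ := by
    intro d hd
    refine ((hc d).continuousAt.eventually ?_).filter_mono nhdsWithin_le_nhds
    rw [hd]
    exact Metric.ball_mem_nhds _ hδ
  filter_upwards [hne, hba a rfl, hba b h.symm, nhdsWithin_le_nhds hU] with t' h1 h2 h3 h4
  have hmm : min (strand F a t') (strand F b t') < max (strand F a t') (strand F b t') :=
    min_lt_max.mpr h1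
  have hroot : ∀ d : Strand B, (strandPoly F t').eval (strand F d t') = 0 := by
    intro d
    rw [strandPoly_eval]
    exact Finset.prod_eq_zero (Finset.mem_univ d) (sub_self _)
  obtain ⟨c, ⟨hc1, hc2⟩, hc3⟩ := exists_deriv_eq_zero (f := fun x => (strandPoly F t').eval x) hmm
    (strandPoly F t').continuous.continuousOn (by
      rcases le_total (strand F a t') (strand F b t') with hle | hle
      · rw [min_eq_left hle, max_eq_right hle, hroot, hroot]
      · rw [min_eq_right hle, max_eq_left hle, hroot, hroot])
  refine ⟨c, hc1, hc2, ?_, ?_⟩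
  · rw [deriv_gFun, ← Polynomial.deriv, hc3, Complex.ofReal_zero]
  · have hcV : c ∈ Metric.ball (strand F a t) δ := by
      rw [Real.ball_eq_Ioo] at h2 h3 ⊢
      exact ⟨(lt_min h2.1 h3.1).trans hc1, hc2.trans (max_lt h2.2 h3.2)⟩
    have hpos : 0 < R (t', c) := hUV ⟨h4, hVδ hcV⟩
    rw [gFun_ofReal, Complex.ofReal_re, strandPoly_eval, ← Finset.prod_sdiff
      (Finset.subset_univ ({a, b} : Finset (Strand B))), Finset.prod_pair hab, ← hT]
    have hneg : (c - strand F a t') * (c - strand F b t') < 0 := by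
      rcases le_total (strand F a t') (strand F b t') with hle | hle
      · rw [min_eq_left hle] at hc1
        rw [max_eq_right hle] at hc2
        exact mul_neg_of_pos_of_neg (sub_pos.mpr hc1) (sub_neg.mpr hc2)
      · rw [min_eq_right hle] at hc1
        rw [max_eq_left hle] at hc2
        exact mul_neg_of_neg_of_pos (sub_neg.mpr hc2) (sub_pos.mpr hc1)
    simp only [hR] at hpos
    rw [sign_mul, sign_neg hneg, mul_neg_one, ← Left.sign_neg]
    rcases pos_and_pos_or_neg_and_neg_of_mul_pos hpos with ⟨p, q⟩ | ⟨p, q⟩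
    · rw [sign_pos p, sign_pos q]
    · rw [sign_neg p, sign_neg q]

end

/-! ### Existence of the function `A` of Step 5 -/

section
variable {n : ℕ} {B : BraidWord n} {F : Component B → ℝ → ℝ}

theorem IsGenericParametrization.analyticAt (hB : 1 ≤ B.length)
    (hF : IsGenericParametrization B F) (C : Component B) (t : ℝ) : AnalyticAt ℝ (F C) t :=
  (hF.realTrigDegLE hB C).analyticAt t

theorem IsGenericParametrization.strand_ne (hF : IsGenericParametrization B F) {a b : Strand B}
    (hab : a ≠ b) {t : ℝ} (ht : t = 0 ∨ t = 2 * Real.pi) : strand F a t ≠ strand F b t := by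
  obtain ⟨τ, F₀, hτ, -, -, hR, -⟩ := hF
  rcases ht with rfl | rfl
  · rw [← hτ.2.1]; exact hR.1 _ a b hab
  · rw [← hτ.2.2]; exact hR.1 _ a b hab

theorem IsGenericParametrization.crossingTimes_subset (hF : IsGenericParametrization B F) :
    crossingTimes F ⊆ Set.Ioo 0 (2 * Real.pi) := by
  rintro t ⟨ht, a, b, hab, he⟩
  refine ⟨lt_of_le_of_ne ht.1 fun h => ?_, lt_of_le_of_ne ht.2 fun h => ?_⟩
  · exact hF.strand_ne hab (Or.inl h.symm) he
  · exact hF.strand_ne hab (Or.inr h) he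

theorem cos_half_ne_zero {t : ℝ} (ht : t ∈ Set.Ioo 0 (2 * Real.pi)) (hpi : t ≠ Real.pi) :
    Real.cos (t / 2) ≠ 0 := by
  obtain ⟨h0, h1⟩ := ht
  have hp := Real.pi_pos
  intro h
  have h2 : t / 2 = Real.pi / 2 := by
    refine Real.injOn_cos ⟨by linarith, by linarith⟩ ⟨by linarith, by linarith⟩ ?_
    rw [h, Real.cos_pi_div_two]
  exact hpi (by linarith)

theorem exists_stepFive (hB : 1 ≤ B.length) (hF : IsGenericParametrization B F) :
    ∃ A : ℝ → ℂ, StepFive B F A := by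
  classical
  have han := hF.analyticAt hB
  have hdiff : ∀ a : Strand B, Differentiable ℝ (strand F a) := fun a t =>
    (strand_analyticAt han a t).differentiableAt
  have hfin : (crossingTimes F).Finite := crossingTimes_finite han fun a b hab =>
    hF.strand_ne hab (Or.inl rfl)
  have hsub := hF.crossingTimes_subset
  obtain ⟨τ, F₀, hτ, -, -, hR, hgen⟩ := id hF
  have hidx : ∀ t : ℝ, ∃ i : Fin n, t ∈ crossingTimes F → ∀ a b : Strand B, a ≠ b →
      strand F a t = strand F b t → rank F a t = i := by
    intro t
    by_cases ht : t ∈ crossingTimes F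
    · obtain ⟨i, hi⟩ := exists_crossing_index hgen ht
      exact ⟨i, fun _ => hi⟩
    · exact ⟨(B.get ⟨0, hB⟩).1, fun h => absurd h ht⟩
  choose idx hidx using hidx
  have hq : ∀ t : ℝ, ∃ q : ℝ, t ∈ crossingTimes F → q ≠ 0 ∧ ∀ a b : Strand B, a ≠ b →
      strand F a t = strand F b t → criticalSign F a b t = q := by
    intro t
    by_cases ht : t ∈ crossingTimes F
    · obtain ⟨htI, a, b, hab, he⟩ := ht
      refine ⟨criticalSign F a b t, fun _ => ⟨hgen.criticalSign_ne_zero hab htI he,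
        fun c d hcd he' => ?_⟩⟩
      rcases Sym2.eq_iff.mp (hgen.2.1 t htI c d a b hcd hab he' he) with ⟨rfl, rfl⟩ | ⟨rfl, rfl⟩
      · rfl
      · exact criticalSign_comm he'
    · exact ⟨0, fun h => absurd h ht⟩
  choose q hq using hq
  set S := hfin.toFinset with hS
  have hmemS : ∀ t, t ∈ S ↔ t ∈ crossingTimes F := fun t => hfin.mem_toFinset
  obtain ⟨w, hw, hwB⟩ := exists_signs hτ hdiff hR hgen hidx S.sort S.sortedLT_sort.pairwise
    (fun t => by rw [Finset.mem_sort, hmemS])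
  have hwl : w.length = S.card := by
    have := congrArg List.length hw
    simpa using this
  set t : Fin S.card → ℝ := fun k => S.orderEmbOfFin rfl k with ht
  have htS : ∀ k, t k ∈ crossingTimes F := fun k => (hmemS _).mp (S.orderEmbOfFin_mem rfl k)
  have hsign : ∀ s : ℝ, ∃ e : ℤˣ, ∀ k, t k = s → e = (w.get (Fin.cast hwl.symm k)).2 := by
    intro s
    by_cases h : ∃ k, t k = s
    · obtain ⟨k, rfl⟩ := h
      exact ⟨_, fun j hj => by rw [(S.orderEmbOfFin rfl).injective hj]⟩
    · exact ⟨1, fun k hk => absurd ⟨k, hk⟩ h⟩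
  choose e he using hsign
  -- For real `q ≠ 0`, value `q` and derivative `iεq` make the derivative of the argument equal to
  -- `ε`.
  obtain ⟨A, hA, hA'⟩ := exists_hermite_interpolation S
    (fun s hs => Set.Ioo_subset_Ico_self (hsub ((hmemS s).mp hs))) (fun s => (q s : ℂ))
    (fun s => ((e s : ℤ) : ℂ) * q s * Complex.I)
  -- This is where the absence of a crossing at height `π` is needed; it allows `y_k = q_k
  -- cos(t_k/2)`.
  have hcos : ∀ k, Real.cos (t k / 2) ≠ 0 := fun k => cos_half_ne_zero (hsub (htS k)) fun h =>
    hgen.2.2 (h ▸ htS k)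
  have hy : ∀ k, q (t k) * Real.cos (t k / 2) / Real.cos (t k / 2) = q (t k) := fun k =>
    mul_div_cancel_right₀ _ (hcos k)
  refine ⟨A, S.card, t, fun k => idx (t k), fun k => e (t k),
    fun k => q (t k) * Real.cos (t k / 2), (S.orderEmbOfFin rfl).strictMono, ?_,
    fun k => hidx _ (htS k), ?_, fun k => ?_, fun k a b hab heq => ?_, trigDegLE_iff.mpr hA,
    fun k => ?_⟩
  · rw [ht, Finset.range_orderEmbOfFin, hS, Set.Finite.coe_toFinset]
  · rw [← hwB]
    congr 1
    refine List.ext_getElem (by simp [hwl]) fun j h1 h2 => ?_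
    rw [List.getElem_ofFn]
    have hj : j < S.card := by simpa using h1
    refine Prod.ext ?_ (he _ ⟨j, hj⟩ rfl)
    have h3 : (w.map Prod.fst)[j]'(by simpa using h2) = (S.sort.map idx)[j]'(by simpa using hj) := by
      simp only [hw]
    rw [List.getElem_map, List.getElem_map] at h3
    rw [h3]
    rfl
  · rw [hy]; exact (hq _ (htS k)).1
  · rw [hy, ← (hq _ (htS k)).2 a b hab heq]
    exact hgen.exists_criticalPoint hdiff hab (Set.Ioo_subset_Icc_self (hsub (htS k))) heq
  · obtain ⟨h1, h2⟩ := hA' (t k) (S.orderEmbOfFin_mem rfl k)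
    rw [hy]
    refine ⟨h1, ?_⟩
    have him : deriv (fun t' => (A t').im) (t k) = (e (t k) : ℤ) * q (t k) := by
      have := (Complex.imCLM.hasFDerivAt.comp_hasDerivAt (t k) h2).deriv
      simpa [Function.comp_def] using this
    have hq0 := (hq _ (htS k)).1
    rw [him, h1]
    simp only [Complex.ofReal_re, Complex.ofReal_im, zero_mul, sub_zero, Complex.norm_real,
      Real.norm_eq_abs, sq_abs]
    field_simp

end

theorem freqs_one_floor (D : ℝ) : freqs 1 D ⊆ freqs 1 (⌊D⌋₊ : ℕ) := by
  rintro x ⟨hx, k, hk⟩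
  refine ⟨?_, k, hk⟩
  obtain rfl : x = k := by simpa using hk
  have h1 : ((k.natAbs : ℕ) : ℝ) = |(k : ℝ)| := by rw [Nat.cast_natAbs, Int.cast_abs]
  rw [← h1] at hx ⊢
  exact_mod_cast Nat.le_floor hx

theorem periodic_of_mem_trigSpan {D : ℝ} {f : ℝ → ℂ} (hf : f ∈ trigSpan (freqs 1 D)) (t : ℝ) :
    f (t + 2 * Real.pi) = f t := by
  induction hf using Submodule.span_induction with
  | mem f hf =>
    obtain ⟨x, ⟨-, k, hk⟩, rfl⟩ := hf
    obtain rfl : x = k := by simpa using hk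
    have : wave k (2 * Real.pi) = 1 := by
      rw [wave, Complex.exp_eq_one_iff]
      exact ⟨k, by push_cast; ring⟩
    rw [wave_add, this, one_mul]
  | zero => rfl
  | add f g _ _ hf hg => rw [Pi.add_apply, Pi.add_apply, hf, hg]
  | smul c f _ hf => rw [Pi.smul_apply, Pi.smul_apply, hf]

/-! ### Frequencies of the strands -/

section
variable {n : ℕ} {B : BraidWord n} {F : Component B → ℝ → ℝ}

variable (B) in
/-- A common multiple of the numbers of strands of the components. -/
noncomputable def strandCountProd : ℕ := ∏ C : Component B, strandCount C

theorem strandCountProd_pos : 0 < strandCountProd B :=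
  Finset.prod_pos fun C _ => strandCount_pos C

/-- Division of the variable by `s_C` scales the degree bound `⌊s_C ℓ/2⌋` to at most `ℓ/2`. The
product of all `s_C` is a common denominator for the frequencies of all strands. -/
theorem IsGenericParametrization.strand_mem_trigSpan (hB : 1 ≤ B.length)
    (hF : IsGenericParametrization B F) (a : Strand B) :
    (fun t => (strand F a t : ℂ)) ∈ trigSpan (freqs (strandCountProd B) (B.length / 2)) := by
  have h1 := (hF.realTrigDegLE hB a.1).mem_trigSpan
  have hs : (0 : ℝ) < strandCount a.1 := by exact_mod_cast strandCount_pos a.1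
  have h2 := trigSpan_affine (u := freqs (strandCountProd B) (B.length / 2))
    (1 / strandCount a.1) (2 * Real.pi * (a.2 : ℕ) / strandCount a.1) (fun x hx => ?_) h1
  · convert h2 using 1
    funext t
    simp only [strand]
    congr 2
    ring
  · obtain ⟨hx, k, hk⟩ := hx
    obtain rfl : x = k := by simpa using hk
    constructor
    · rw [abs_mul, abs_of_pos (one_div_pos.mpr hs), one_div, inv_mul_le_iff₀ hs]
      refine hx.trans (Nat.cast_div_le.trans (le_of_eq ?_))
      push_cast; ring
    · obtain ⟨q, hq⟩ : strandCount a.1 ∣ strandCountProd B :=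
        Finset.dvd_prod_of_mem _ (Finset.mem_univ a.1)
      refine ⟨q * k, ?_⟩
      rw [hq]; push_cast; field_simp

/-! ### The coefficients of `g` -/

/-- The part of the coefficients of `g` that belongs to a set of strands, averaged over the
rotations of the closed braid. -/
noncomputable def averagedProd (F : Component B → ℝ → ℝ) (S : Finset (Strand B)) : ℝ → ℂ :=
  translateAverage (strandCountProd B) fun t => ∏ a ∈ S, (strand F a t : ℂ)

theorem IsGenericParametrization.averagedProd_mem (hB : 1 ≤ B.length)
    (hF : IsGenericParametrization B F) (S : Finset (Strand B)) :
    averagedProd F S ∈ trigSpan (freqs 1 (S.card * (B.length / 2))) :=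
  translateAverage_mem (prod_mem_trigSpan_freqs S fun a _ => hF.strand_mem_trigSpan hB a)

theorem gFun_periodic (hper : ∀ C θ, F C (θ + 2 * Real.pi) = F C θ) (u : ℂ) :
    Function.Periodic (fun t => gFun F u (t / 2)) (2 * Real.pi) := by
  intro t
  simp only [gFun_eq_prod_strand, mul_div_cancel₀ _ (two_ne_zero' ℝ), strand_add_two_pi hper]
  exact Equiv.prod_comp (strandShift B) fun a => (u - (strand F a t : ℂ))

/-- A product over a subset of strands need not have period `2π`, but `g` at half height does, since
translation permutes all strands. Averaging therefore fixes `g` and can be applied to each subset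
separately. -/
theorem gFun_expansion (hper : ∀ C θ, F C (θ + 2 * Real.pi) = F C θ) (u : ℂ) (t : ℝ) :
    gFun F u t = ∑ S : Finset (Strand B),
      (-1) ^ S.card * u ^ (n + 1 - S.card) * averagedProd F S (2 * t) := by
  classical
  have h1 : ∀ t, gFun F u (t / 2) = ∑ S : Finset (Strand B),
      (-1) ^ S.card * u ^ (n + 1 - S.card) * ∏ a ∈ S, (strand F a t : ℂ) := by
    intro t
    rw [gFun_eq_prod_strand, mul_div_cancel₀ _ (two_ne_zero' ℝ)]
    simp only [sub_eq_neg_add]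
    rw [Finset.prod_add, Finset.powerset_univ]
    refine Finset.sum_congr rfl fun S _ => ?_
    rw [Finset.prod_neg, Finset.prod_const, Finset.card_sdiff_of_subset (Finset.subset_univ S),
      Finset.card_univ, card_strand]
    ring
  have h2 := congrFun (translateAverage_of_periodic (strandCountProd_pos (B := B))
    (gFun_periodic hper u)) (2 * t)
  simp only [mul_div_cancel_left₀ t (two_ne_zero' ℝ)] at h2
  rw [← h2]
  simp only [translateAverage, averagedProd, h1]
  rw [Finset.sum_comm, Finset.mul_sum]
  refine Finset.sum_congr rfl fun S _ => ?_
  rw [← Finset.mul_sum]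
  ring

theorem IsGenericParametrization.trigDegLE_gFun (hB : 1 ≤ B.length)
    (hF : IsGenericParametrization B F) (u : ℂ) : TrigDegLE ((n + 1) * B.length) (gFun F u) := by
  rw [trigDegLE_iff]
  have h1 : gFun F u = ∑ S : Finset (Strand B), ((-1) ^ S.card * u ^ (n + 1 - S.card) : ℂ) •
      fun t => averagedProd F S (2 * t + 0) := by
    funext t
    rw [gFun_expansion (fun C θ => (hF.realTrigDegLE hB C).periodic θ)]
    simp [Finset.sum_apply]
  rw [h1]
  refine Submodule.sum_mem _ fun S _ => Submodule.smul_mem _ _ ?_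
  refine trigSpan_affine 2 0 (fun x hx => ?_) (hF.averagedProd_mem hB S)
  obtain ⟨hx, k, hk⟩ := hx
  obtain rfl : x = k := by simpa using hk
  refine ⟨?_, 2 * k, by push_cast; ring⟩
  rw [abs_mul, abs_two]
  have hS : (S.card : ℝ) ≤ n + 1 := by
    have := Finset.card_le_univ S
    rw [card_strand] at this
    exact_mod_cast this
  have hL : (0 : ℝ) ≤ B.length := Nat.cast_nonneg _
  push_cast
  nlinarith

/-- After the substitution the term of a subset `S` carries `r^(2k|S|)`. Doubling the variable makes
its frequencies even and at most `|S|ℓ ≤ 2k|S|` in size, so both size and parity are right for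
monomials in `v` and its conjugate. -/
theorem IsGenericParametrization.exists_represents_pFun (hB : 1 ≤ B.length)
    (hF : IsGenericParametrization B F) {k : ℕ} (hk : B.length ≤ 2 * k) :
    ∃ P, Represents P (pFun F k) := by
  have key : ∀ S : Finset (Strand B), ∃ Q : MvPolynomial (Fin 3) ℂ, Q.totalDegree ≤ 2 * k * S.card ∧
      Represents Q fun _ r t => (r : ℂ) ^ (2 * k * S.card) * averagedProd F S (2 * t + 0) := by
    intro S
    refine exists_mvPolynomial_of_mem_trigSpan _ ?_
    refine trigSpan_affine 2 0 (fun x hx => ?_) (hF.averagedProd_mem hB S)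
    obtain ⟨hx, j, hj⟩ := hx
    obtain rfl : x = j := by simpa using hj
    refine ⟨2 * j, by push_cast; ring, ?_, k * S.card - j, by push_cast; ring⟩
    have h1 : |((2 * j : ℤ) : ℝ)| ≤ ((2 * k * S.card : ℕ) : ℝ) := by
      push_cast
      rw [abs_mul, abs_two]
      have h2 : (B.length : ℝ) ≤ 2 * k := by exact_mod_cast hk
      have h3 : (0 : ℝ) ≤ S.card := Nat.cast_nonneg _
      nlinarith
    exact_mod_cast h1
  choose Q _ hQ using key
  refine ⟨∑ S : Finset (Strand B), MvPolynomial.C ((-1) ^ S.card) *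
    MvPolynomial.X 0 ^ (n + 1 - S.card) * Q S, fun u r t hr => ?_⟩
  have hr0 : (r : ℂ) ≠ 0 := by exact_mod_cast hr.ne'
  rw [map_sum, pFun, gFun_expansion (fun C θ => (hF.realTrigDegLE hB C).periodic θ),
    Finset.mul_sum]
  refine Finset.sum_congr rfl fun S _ => ?_
  rw [map_mul, hQ S u r t hr]
  simp only [map_mul, map_pow, MvPolynomial.eval_X, Matrix.cons_val_zero,
    add_zero, map_neg, map_one]
  have hS : S.card ≤ n + 1 := by
    have := Finset.card_le_univ S
    rwa [card_strand] at this
  obtain ⟨j, hj⟩ := Nat.exists_eq_add_of_le hS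
  have h1 : n + 1 - S.card = j := by omega
  rw [h1, hj, div_pow, ← pow_mul, mul_add (2 * k), pow_add]
  field_simp

theorem IsGenericParametrization.admissibleK (hB : 1 ≤ B.length)
    (hF : IsGenericParametrization B F) : AdmissibleK F (B.length / 2 + 1) := by
  refine ⟨⟨(n + 1) * B.length, ?_, hF.trigDegLE_gFun hB⟩, hF.exists_represents_pFun hB (by omega)⟩
  have : B.length < 2 * (B.length / 2 + 1) := by omega
  calc (n + 1) * B.length < (n + 1) * (2 * (B.length / 2 + 1)) :=
        Nat.mul_lt_mul_of_pos_left this (Nat.succ_pos n)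
    _ = _ := by ring

theorem pFun_homogeneous (F : Component B → ℝ → ℝ) (k : ℕ) (u : ℂ) {r c : ℝ} (hc : 0 < c)
    (t : ℝ) : pFun F k ((c : ℂ) ^ (2 * k) * u) (c * r) t =
      (c : ℂ) ^ (2 * k * (n + 1)) * pFun F k u r t := by
  have hc0 : (c : ℂ) ≠ 0 := by exact_mod_cast hc.ne'
  rw [pFun, pFun, Complex.ofReal_mul, mul_pow, mul_pow,
    mul_div_mul_left _ _ (pow_ne_zero _ hc0), mul_assoc]

/-- A polynomial that represents `p_k` can be chosen of degree at most `2ks`. -/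
theorem exists_represents_totalDegree_le {k : ℕ} (hk : 1 ≤ k) {P : MvPolynomial (Fin 3) ℂ}
    (hP : Represents P (pFun F k)) :
    ∃ P', MvPolynomial.totalDegree P' ≤ 2 * k * (n + 1) ∧ Represents P' (pFun F k) := by
  set W := 2 * k * (n + 1) with hW
  -- `p_k` is homogeneous of weight `2ks` when `u` has weight `2k`. Keeping only that weighted part
  -- loses nothing, and for `k ≥ 1` the degree is at most the weight.
  let wt : (Fin 3 →₀ ℕ) → ℕ := fun d => 2 * k * d 0 + d 1 + d 2
  refine ⟨∑ d ∈ P.support.filter fun d => wt d = W, MvPolynomial.monomial d (P.coeff d), ?_,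
    fun u r t hr => ?_⟩
  · refine (MvPolynomial.totalDegree_finsetSum _ _).trans (Finset.sup_le fun d hd => ?_)
    refine (MvPolynomial.totalDegree_monomial_le _ _).trans ?_
    have hd' := (Finset.mem_filter.mp hd).2
    rw [Finsupp.sum_fintype _ _ (fun _ => rfl), Fin.sum_univ_three]
    have : 1 * d 0 ≤ 2 * k * d 0 := Nat.mul_le_mul_right _ (by omega)
    simp only [wt] at hd'
    simp only [id]
    omega
  · set v : ℂ := r * Complex.exp (t * Complex.I) with hv
    let term : (Fin 3 →₀ ℕ) → ℂ := fun d =>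
      P.coeff d * (u ^ d 0 * v ^ d 1 * (starRingEnd ℂ v) ^ d 2)
    -- For a fixed point, the scaling factor `c` becomes the variable; agreement for all `c > 0` is
    -- an identity of polynomials, and the coefficient at the weight `W` is compared.
    let Q : Polynomial ℂ := ∑ d ∈ P.support, Polynomial.monomial (wt d) (term d)
    have hQ : ∀ c : ℝ, 0 < c → Q.eval (c : ℂ) = (Polynomial.monomial W (pFun F k u r t)).eval
        (c : ℂ) := by
      intro c hc
      have h1 := hP ((c : ℂ) ^ (2 * k) * u) (c * r) t (mul_pos hc hr)
      rw [pFun_homogeneous F k u hc, MvPolynomial.eval_eq'] at h1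
      rw [Polynomial.eval_monomial, mul_comm (pFun F k u r t), ← h1, Polynomial.eval_finsetSum]
      refine Finset.sum_congr rfl fun d _ => ?_
      rw [Polynomial.eval_monomial, Fin.prod_univ_three]
      have h2 : ((c * r : ℝ) : ℂ) * Complex.exp (t * Complex.I) = c * v := by
        rw [hv]; push_cast; ring
      simp only [Matrix.cons_val_zero, Matrix.cons_val_one, Matrix.cons_val, h2, map_mul,
        Complex.conj_ofReal, term, wt]
      ring
    have hQ' : Q = Polynomial.monomial W (pFun F k u r t) := by
      refine Polynomial.eq_of_infinite_eval_eq _ _ (Set.Infinite.mono ?_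
        ((Set.Ioi_infinite (0 : ℝ)).image (Complex.ofReal_injective.injOn)))
      rintro _ ⟨c, hc, rfl⟩
      exact hQ c hc
    have h3 := congrArg (fun p => Polynomial.coeff p W) hQ'
    simp only [Q, Polynomial.finsetSum_coeff, Polynomial.coeff_monomial, if_true] at h3
    rw [← h3, map_sum, Finset.sum_filter]
    refine Finset.sum_congr rfl fun d _ => ?_
    split_ifs with h4
    · rw [MvPolynomial.eval_monomial, Finsupp.prod_fintype _ _ (fun _ => pow_zero _),
        Fin.prod_univ_three]
      simp [term, hv]
    · rfl

/-! ### The number of crossings -/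

open Classical in
variable (B) in
/-- The pairs of strands, ordered by their positions at height `0`. -/
noncomputable def strandPairs : Finset (Strand B × Strand B) :=
  Finset.univ.filter fun p => startPosition p.1 < startPosition p.2

theorem two_mul_card_strandPairs_le : 2 * (strandPairs B).card ≤ (n + 1) ^ 2 := by
  classical
  have h1 : Disjoint (strandPairs B) ((strandPairs B).map (Equiv.prodComm _ _).toEmbedding) := by
    rw [Finset.disjoint_left]
    rintro ⟨a, b⟩ h h'
    simp only [strandPairs, Finset.mem_map_equiv, Finset.mem_filter, Finset.mem_univ, true_and,
      Equiv.prodComm_symm, Equiv.prodComm_apply, Prod.swap] at h h'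
    exact lt_asymm h h'
  have h2 := Finset.card_le_univ
    ((strandPairs B) ∪ ((strandPairs B).map (Equiv.prodComm _ _).toEmbedding))
  rw [Finset.card_union_of_disjoint h1, Finset.card_map, Fintype.card_prod, card_strand] at h2
  nlinarith

/-- The product of all pair differences has frequencies at most `D`, half the number of pairs times
`ℓ`. Speeding it up by the common denominator `L` gives an honest trigonometric polynomial of degree
at most `LD`, nonzero at `0`. Each crossing height has `L` translates by multiples of `2π` in the
longer period, all zeros, so `L` times the number of crossings is at most `2LD`. -/
theorem IsGenericParametrization.card_crossings_le (hB : 1 ≤ B.length)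
    (hF : IsGenericParametrization B F) (T : Finset ℝ) (hT : ∀ t ∈ T, t ∈ crossingTimes F) :
    T.card ≤ (strandPairs B).card * B.length := by
  classical
  have hpi := Real.pi_pos
  set L := strandCountProd B with hL
  have hL0 : (0 : ℝ) < L := by exact_mod_cast strandCountProd_pos (B := B)
  have hper : ∀ C θ, F C (θ + 2 * Real.pi) = F C θ :=
    fun C θ => (hF.realTrigDegLE hB C).periodic θ
  set D : ℝ := (strandPairs B).card * (B.length / 2) with hD
  have h1 : (fun t => ∏ p ∈ strandPairs B, ((strand F p.1 t : ℂ) - strand F p.2 t)) ∈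
      trigSpan (freqs L D) := prod_mem_trigSpan_freqs (strandPairs B)
        (f := fun p t => (strand F p.1 t : ℂ) - strand F p.2 t)
        fun p _ => sub_mem (hF.strand_mem_trigSpan hB p.1) (hF.strand_mem_trigSpan hB p.2)
  have h2 := trigSpan_affine (L : ℝ) 0 (u := freqs 1 (L * D)) (fun x hx => ⟨by
    rw [abs_mul, abs_of_pos hL0]; exact mul_le_mul_of_nonneg_left hx.1 hL0.le, by
    obtain ⟨k, hk⟩ := hx.2; exact ⟨k, by simpa using hk⟩⟩) h1
  have h3 := trigDegLE_iff.mpr (trigSpan_mono (freqs_one_floor _) h2)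
  have hne : ∏ p ∈ strandPairs B, ((strand F p.1 (L * 0 + 0) : ℂ) - strand F p.2 (L * 0 + 0)) ≠ 0 := by
    rw [Finset.prod_ne_zero_iff]
    intro p hp h0
    have hp' : startPosition p.1 < startPosition p.2 := (Finset.mem_filter.mp hp).2
    have hab : p.1 ≠ p.2 := fun h => by rw [h] at hp'; exact lt_irrefl _ hp'
    refine hF.strand_ne hab (Or.inl (by simp)) (t := L * 0 + 0) ?_
    exact_mod_cast sub_eq_zero.mp h0
  set z : ℝ × ℕ → ℝ := fun p => (p.1 + p.2 * (2 * Real.pi)) / L with hz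
  have hTI : ∀ t ∈ T, t ∈ Set.Ioo 0 (2 * Real.pi) := fun t ht => hF.crossingTimes_subset (hT t ht)
  have hinj : Set.InjOn z (T ×ˢ Finset.range L : Finset (ℝ × ℕ)) := by
    rintro ⟨t, j⟩ h ⟨t', j'⟩ h' he
    simp only [Finset.coe_product, Set.mem_prod, Finset.mem_coe] at h h'
    have ht := hTI t h.1
    have ht' := hTI t' h'.1
    simp only [hz] at he
    rw [div_left_inj' hL0.ne'] at he
    have hj : j = j' := by
      rcases lt_trichotomy j j' with hlt | heq | hlt
      · have : (j : ℝ) + 1 ≤ j' := by exact_mod_cast hlt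
        nlinarith [ht.1, ht.2, ht'.1, ht'.2]
      · exact heq
      · have : (j' : ℝ) + 1 ≤ j := by exact_mod_cast hlt
        nlinarith [ht.1, ht.2, ht'.1, ht'.2]
    subst hj
    rw [add_right_cancel he]
  have h4 := card_zeros_le h3 hne ((T ×ˢ Finset.range L).image z) (by
    intro θ hθ
    obtain ⟨⟨t, j⟩, hp, rfl⟩ := Finset.mem_image.mp hθ
    obtain ⟨ht, hj⟩ := Finset.mem_product.mp hp
    have htI := hTI t ht
    have hj' : (j : ℝ) + 1 ≤ L := by exact_mod_cast Finset.mem_range.mp hj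
    refine ⟨⟨div_nonneg (by have := htI.1; positivity) hL0.le, ?_⟩, ?_⟩
    · rw [hz, div_lt_iff₀ hL0]
      simp only
      nlinarith [htI.2]
    · obtain ⟨-, a, b, hab, he⟩ := hT t ht
      have hzL : (L : ℝ) * z (t, j) + 0 = t + j * (2 * Real.pi) := by
        simp only [hz]; field_simp; ring
      simp only [hzL, strand_add_nat_mul_two_pi hper]
      -- Translation by `2πj` permutes the strands, so the colliding pair appears, in one of its two
      -- orders, among the translated factors.
      set σ := strandShift B ^ j
      have hroot : ∀ x y : Strand B, strand F x t = strand F y t →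
          startPosition (σ.symm x) < startPosition (σ.symm y) →
          ∏ p ∈ strandPairs B, ((strand F (σ p.1) t : ℂ) - strand F (σ p.2) t) = 0 := by
        intro x y hxy hlt
        refine Finset.prod_eq_zero (i := (σ.symm x, σ.symm y)) ?_ (by simp [hxy])
        exact Finset.mem_filter.mpr ⟨Finset.mem_univ _, hlt⟩
      have hne' : startPosition (σ.symm a) ≠ startPosition (σ.symm b) := fun h =>
        hab (σ.symm.injective (startPosition_injective h))
      rcases lt_or_gt_of_ne hne' with h | h
      · exact hroot a b he h
      · exact hroot b a he.symm h)
  rw [Finset.card_image_of_injOn hinj, Finset.card_product, Finset.card_range] at h4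
  have h5 : ((⌊(L : ℝ) * D⌋₊ : ℕ) : ℝ) ≤ L * D := Nat.floor_le (by positivity)
  have h6 : ((T.card * L : ℕ) : ℝ) ≤ 2 * (L * D) := by
    refine (Nat.cast_le.mpr h4).trans ?_
    push_cast
    linarith
  have h7 : (T.card : ℝ) ≤ (strandPairs B).card * B.length := by
    push_cast at h6
    rw [hD] at h6
    refine le_of_mul_le_mul_right (a := (L : ℝ)) ?_ hL0
    linarith
  exact_mod_cast h7

/-! ### The degree of `f` -/

theorem trigDegLE_oddExtension {N : ℕ} {A : ℝ → ℂ} (hA : TrigDegLE N A) :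
    TrigDegLE (2 * N + 1) (oddExtension A) := by
  rw [trigDegLE_iff] at hA ⊢
  have h1 := trigSpan_affine 2 0 (u := freqs 1 (2 * N)) (fun x hx => by
    obtain ⟨hx, k, hk⟩ := hx
    exact ⟨by rw [abs_mul, abs_two]; linarith, 2 * k, by push_cast at hk ⊢; linarith⟩) hA
  have h2 := natCast_mem_freqs_one (d := 1) (k := 1) le_rfl
  have h3 := mul_mem_trigSpan_freqs h1 (cos_mem_trigSpan _ h2.1 h2.2)
  convert h3 using 1
  · push_cast; rfl
  · funext t; simp [oddExtension]

/-- `A(2t)` has period `π` and `cos t` changes sign under translation by `π`, so only odd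
frequencies occur. These have the parity of `m`, as the monomials in `v` and its conjugate require.
-/
theorem exists_represents_oddExtension {N d m : ℕ} {A : ℝ → ℂ} (hA : TrigDegLE N A)
    (hd : TrigDegLE d (oddExtension A)) (hdm : d < m) (hm : Odd m) :
    ∃ Q : MvPolynomial (Fin 3) ℂ, Q.totalDegree ≤ m ∧
      Represents Q fun _ r t => (r : ℂ) ^ m * oddExtension A t := by
  refine exists_mvPolynomial_of_mem_trigSpan m ?_
  have h1 := mem_trigSpan_odd (trigDegLE_iff.mp hd) fun t => by
    have h2 : 2 * (t + Real.pi) = 2 * t + 2 * Real.pi := by ring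
    simp only [oddExtension, Real.cos_add_pi, h2, periodic_of_mem_trigSpan (trigDegLE_iff.mp hA)]
    push_cast; ring
  refine trigSpan_mono ?_ h1
  rintro x ⟨hx, k, hk, rfl⟩
  refine ⟨k, rfl, ?_, ?_⟩
  · have : |k| ≤ d := by exact_mod_cast hx
    omega
  · exact Odd.sub_odd (by exact_mod_cast hm) hk

theorem StepFive.exists_trigDegLE (hB : 1 ≤ B.length) (hF : IsGenericParametrization B F)
    {A : ℝ → ℂ} (hA : StepFive B F A) :
    ∃ N, TrigDegLE N A ∧ 2 * N ≤ (n + 1) ^ 2 * B.length := by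
  obtain ⟨N, t, i, ε, y, ht, hrange, -, -, -, -, hdeg, -⟩ := hA
  refine ⟨N, hdeg, ?_⟩
  have h1 := hF.card_crossings_le hB (Finset.univ.map ⟨t, ht.injective⟩) (by
    intro x hx
    obtain ⟨k, -, rfl⟩ := Finset.mem_map.mp hx
    rw [← hrange]
    exact ⟨k, rfl⟩)
  rw [Finset.card_map, Finset.card_univ, Fintype.card_fin] at h1
  calc 2 * N ≤ 2 * ((strandPairs B).card * B.length) := Nat.mul_le_mul_left 2 h1
    _ = 2 * (strandPairs B).card * B.length := by ring
    _ ≤ _ := Nat.mul_le_mul_right _ two_mul_card_strandPairs_le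

end

end BraidPoly

open BraidPoly in
/-- Let `B` be a braid word with `s = n + 1` strands and `ℓ = B.length ≥ 1` crossings. The
algorithm can be carried out for `B`, and whatever the results of its interpolation and
perturbation steps are, it produces, with the smallest allowed exponents `k` and `m`, a polynomial
`f` of degree at most `sℓ(2 + s) + 1 + ∑_C s_C² ℓ`. -/
theorem theorem2 (n : ℕ) (B : BraidWord n) (hB : 1 ≤ B.length) :
    (∃ F : Component B → ℝ → ℝ, IsGenericParametrization B F) ∧
    ∀ F : Component B → ℝ → ℝ, IsGenericParametrization B F →
      (∃ A : ℝ → ℂ, StepFive B F A) ∧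
      ∀ A : ℝ → ℂ, StepFive B F A →
        ∃ (k m : ℕ) (f : MvPolynomial (Fin 3) ℂ),
          IsLeast {k' | AdmissibleK F k'} k ∧ IsLeast {m' | AdmissibleM n A k m'} m ∧
          StepSix F A k m f ∧
          f.totalDegree ≤ (n + 1) * B.length * (2 + (n + 1)) + 1 +
            ∑ C : Component B, strandCount C ^ 2 * B.length := by
  refine ⟨exists_isGenericParametrization B hB, fun F hF => ⟨exists_stepFive hB hF, fun A hA => ?_⟩⟩
  obtain ⟨N, hAN, hN⟩ := hA.exists_trigDegLE hB hF
  have hk₀ := hF.admissibleK hB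
  set k := sInf {k' | AdmissibleK F k'} with hk
  have hkA : AdmissibleK F k := Nat.sInf_mem (s := {k' | AdmissibleK F k'}) ⟨_, hk₀⟩
  have hkle : k ≤ B.length / 2 + 1 := Nat.sInf_le hk₀
  obtain ⟨⟨d, hd, -⟩, P, hP⟩ := id hkA
  have hk1 : 1 ≤ k := by
    by_contra h
    have : k = 0 := by omega
    simp [this] at hd
  obtain ⟨P', hP'deg, hP'⟩ := exists_represents_totalDegree_le hk1 hP
  -- Both entries are odd; `2N + 3` is the least odd number above the degree bound `2N + 1`.
  have hm₀ : AdmissibleM n A k (max (2 * N + 3) (2 * k * (n + 1) + 1)) := by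
    refine ⟨?_, ⟨2 * N + 1, by omega, trigDegLE_oddExtension hAN⟩, by omega⟩
    rcases le_total (2 * N + 3) (2 * k * (n + 1) + 1) with h | h
    · rw [max_eq_right h]
      exact ⟨k * (n + 1), by ring⟩
    · rw [max_eq_left h]
      exact ⟨N + 1, by ring⟩
  set m := sInf {m' | AdmissibleM n A k m'} with hm
  have hmA : AdmissibleM n A k m := Nat.sInf_mem (s := {m' | AdmissibleM n A k m'}) ⟨_, hm₀⟩
  have hmle : m ≤ max (2 * N + 3) (2 * k * (n + 1) + 1) := Nat.sInf_le hm₀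
  obtain ⟨hodd, ⟨e, hem, he⟩, hkm⟩ := id hmA
  obtain ⟨Q, hQdeg, hQ⟩ := exists_represents_oddExtension hAN he hem hodd
  refine ⟨k, m, P' + Q, ⟨hkA, fun _ h => Nat.sInf_le h⟩, ⟨hmA, fun _ h => Nat.sInf_le h⟩,
    fun u r t hr => ?_, ?_⟩
  · rw [map_add, hP' u r t hr, hQ u r t hr]
  · have h1 : (P' + Q).totalDegree ≤ m :=
      (MvPolynomial.totalDegree_add _ _).trans (max_le (hP'deg.trans hkm.le) hQdeg)
    have h2 : 2 * k * (n + 1) ≤ (B.length + 2) * (n + 1) := Nat.mul_le_mul_right _ (by omega)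
    -- The sum over the components is discarded: `s²ℓ + 3` and `(ℓ + 2)s + 1` are both at most `sℓ(2
    -- + s) + 1` because `s, ℓ ≥ 1`.
    refine (h1.trans hmle).trans (le_trans (max_le ?_ ?_) (Nat.le_add_right _ _))
    · nlinarith
    · nlinarith
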